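/- Conventions. Manifolds are smooth, Hausdorff and finite-dimensional (of constant dimension), submanifolds are embedded. Let $\mathfrak g$ be a real Lie algebra with an invariant element $t\in(S^2\mathfrak g)^{\mathfrak g}$, let $t^\sharp\alpha=t(\alpha,\cdot)$ for $\alpha\in\mathfrak g^*$, and let $\phi\in\bigwedge^3\mathfrak g$ be given by $\phi(\alpha,\beta,\gamma)=\frac14\langle[t^\sharp\alpha,t^\sharp\beta],\gamma\rangle$. A $\mathfrak g$-quasi-Poisson manifold is a manifold $M$ with an action of $\mathfrak g$ (a Lie algebra homomorphism $\rho$ to the vector fields on $M$) and a $\mathfrak g$-invariant bivector field $\pi$ such that $[\pi,\pi]/2=\rho^{\otimes3}(\phi)$; it is quasi-Poisson-commutative if $\sigma:=\pi+\frac12\rho^{\otimes2}(t)$ vanishes. A quasi-Poisson map is an equivariant map $F$ with $F_*\pi=\pi$; a quasi-Poisson submanifold is a submanifold with a quasi-Poisson structure for which the inclusion is quasi-Poisson. A smooth equivariant map $\mu:M\to N$ to a quasi-Poisson-commutative manifold $N$ is left (right) central if $\sigma(d(\mu^*f),\cdot)=0$ (respectively $\sigma(\cdot,d(\mu^*f))=0$)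 for all $f\in C^\infty(N)$. A central pair $N_L\xleftarrow{\mu_L}M\xrightarrow{\mu_R}N_R$ consists of a left central map $\mu_L$ and a right central map $\mu_R$. For a Lie subalgebra $\mathfrak c\subset\mathfrak g$ put $\mathfrak c^\perp=t(\operatorname{Ann}\mathfrak c,\cdot)$; $\mathfrak c$ is coisotropic if the image of $t$ in $S^2(\mathfrak g/\mathfrak c)$ is $0$. The orbits of a Lie subalgebra $\mathfrak h$ are the classes of the equivalence relation generated by flowing along the vector fields $\rho(u)$, $u\in\mathfrak h$; a subset is invariant if it is a union of orbits. That $X/\mathfrak h$ is a manifold means that there is a surjective submersion from $X$ onto a manifold, denoted $X/\mathfrak h$, whose fibres are the $\mathfrak h$-orbits in $X$. Theorem (Central reduction 2). Let $N_L\xleftarrow{\mu_L}M\xrightarrow{\mu_R}N_R$ be a central pair of $\mathfrak g$-quasi-Poisson manifolds, let $\mathfrak c\subset\mathfrak g$ be a coisotropic Lie subalgebra, and let $\mathfrak h\subset\mathfrak c$ be an ideal of $\mathfrak c$ containing $\mathfrak c^\perp$. Let $\mathcal O_L\subset N_L$ and $\mathcal O_R\subset N_R$ be $\mathfrak c$-invariant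 submanifolds such that $\mu_L\times\mu_R:M\to N_L\times N_R$ is transverse to $\mathcal O_L\times\mathcal O_R$, and suppose that $M/\mathfrak h$, $\mathcal O_L/\mathfrak h$ and $\mathcal O_R/\mathfrak h$ are manifolds. Then: 1. $t$ descends to an invariant element $t'\in S^2(\mathfrak c/\mathfrak h)$ (the element with the same image in $S^2(\mathfrak g/\mathfrak h)$ as $t$), and $M/\mathfrak h$, with the action induced from the action of $\mathfrak c$ on $M$ and with the bivector field pushed forward from $M$, is a $\mathfrak c/\mathfrak h$-quasi-Poisson manifold with respect to $t'$. 2. The subset $M':=\bigl(\mu_L^{-1}(\mathcal O_L)\cap\mu_R^{-1}(\mathcal O_R)\bigr)/\mathfrak h\subset M/\mathfrak h$ is a $\mathfrak c/\mathfrak h$-quasi-Poisson submanifold. 3. The action of $\mathfrak g$ on $N_L$, $N_R$ restricts to actions of $\mathfrak c$ on $\mathcal O_L$, $\mathcal O_R$, which descend to actions of $\mathfrak c/\mathfrak h$ on $\mathcal O_L/\mathfrak h$, $\mathcal O_R/\mathfrak h$. With these actions $\mathcal O_L/\mathfrak h$ and $\mathcal O_R/\mathfrak h$ are quasi-Poisson-commutative,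 and the maps $M'\to\mathcal O_L/\mathfrak h$ and $M'\to\mathcal O_R/\mathfrak h$ induced by $\mu_L$ and $\mu_R$ form a central pair of $\mathfrak c/\mathfrak h$-quasi-Poisson manifolds. -/

import Mathlib

open scoped Manifold ContDiff TensorProduct

noncomputable section

namespace QuasiPoisson

/-! ### The Lie algebra `g` with an invariant element `t` of `S² g` -/

section Algebra

variable {g : Type*} [LieRing g] [LieAlgebra ℝ g]

/-- `t : g ⊗ g` lies in `(S² g)^g`: it is symmetric and annihilated by the adjoint action. -/
def IsInvariantSymmetric (t : g ⊗[ℝ] g) : Prop :=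
  TensorProduct.comm ℝ g g t = t ∧ ∀ u : g, ⁅u, t⁆ = 0

/-- The map `t♯ : g* → g`, `α ↦ t(α, ·)`. -/
def sharp (t : g ⊗[ℝ] g) : Module.Dual ℝ g →ₗ[ℝ] g where
  toFun α := TensorProduct.lid ℝ g (TensorProduct.map α LinearMap.id t)
  map_add' α β := by simp [TensorProduct.map_add_left]
  map_smul' r α := by simp [TensorProduct.map_smul_left]

/-- The trivector `φ(α, β, γ) = ¼ ⟨[t♯ α, t♯ β], γ⟩`, evaluated on covectors. -/
def phi (t : g ⊗[ℝ] g) (α β γ : Module.Dual ℝ g) : ℝ :=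
  (1 / 4 : ℝ) * γ ⁅sharp t α, sharp t β⁆

/-- A Lie subalgebra `c` is coisotropic when the image of `t` in `(g / c) ⊗ (g / c)` vanishes. -/
def IsCoisotropic (t : g ⊗[ℝ] g) (c : LieSubalgebra ℝ g) : Prop :=
  TensorProduct.map c.toSubmodule.mkQ c.toSubmodule.mkQ t = 0

/-- `c^⊥ = t(Ann c, ·)`. -/
def perp (t : g ⊗[ℝ] g) (c : LieSubalgebra ℝ g) : Submodule ℝ g :=
  c.toSubmodule.dualAnnihilator.map (sharp t)

/-- An ideal `h` of `c`, regarded as a linear subspace of `g`. -/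
def idealSpan {c : LieSubalgebra ℝ g} (h : LieIdeal ℝ c) : Submodule ℝ g :=
  h.toSubmodule.map c.toSubmodule.subtype

/-- The inclusion `c / h → g / h`. -/
def quotIncl {c : LieSubalgebra ℝ g} (h : LieIdeal ℝ c) : (c ⧸ h) →ₗ[ℝ] (g ⧸ idealSpan h) :=
  h.toSubmodule.mapQ (idealSpan h) c.toSubmodule.subtype (Submodule.le_comap_map _ _)

/-- `t'` in `(c / h) ⊗ (c / h)` is the element to which `t` descends: both have the same image in
`(g / h) ⊗ (g / h)`. -/
def DescendsTo {c : LieSubalgebra ℝ g} (h : LieIdeal ℝ c) (t : g ⊗[ℝ] g)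
    (t' : (c ⧸ h) ⊗[ℝ] (c ⧸ h)) : Prop :=
  TensorProduct.map (quotIncl h) (quotIncl h) t' =
    TensorProduct.map (idealSpan h).mkQ (idealSpan h).mkQ t

end Algebra

/-! ### Actions of Lie algebras and quasi-Poisson structures -/

section Manifolds

/-- The cotangent space at a point of a manifold modelled on `E`. -/
abbrev Cotangent (E : Type*) [NormedAddCommGroup E] [NormedSpace ℝ E]
    {M : Type*} [TopologicalSpace M] [ChartedSpace E M] (x : M) : Type _ :=
  TangentSpace 𝓘(ℝ, E) x →L[ℝ] ℝ

/-- A real-valued smooth function. -/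
abbrev IsSmoothFun (E : Type*) [NormedAddCommGroup E] [NormedSpace ℝ E]
    {M : Type*} [TopologicalSpace M] [ChartedSpace E M] (f : M → ℝ) : Prop :=
  ContMDiff 𝓘(ℝ, E) 𝓘(ℝ, ℝ) ∞ f

/-- The differential `df` of a function, as a field of covectors. -/
abbrev diff (E : Type*) [NormedAddCommGroup E] [NormedSpace ℝ E]
    {M : Type*} [TopologicalSpace M] [ChartedSpace E M] (f : M → ℝ) (x : M) : Cotangent E x :=
  mvfderiv 𝓘(ℝ, E) f x

/-- A (not yet smooth or skew-symmetric) field of bilinear forms on the cotangent spaces, i.e. of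
contravariant 2-tensors. -/
abbrev TwoTensorField (E : Type*) [NormedAddCommGroup E] [NormedSpace ℝ E]
    (M : Type*) [TopologicalSpace M] [ChartedSpace E M] : Type _ :=
  ∀ x : M, Cotangent E x →ₗ[ℝ] Cotangent E x →ₗ[ℝ] ℝ

/-- The bracket of functions `{f₁, f₂} = π(df₁, df₂)`. -/
def fnBracket {E : Type*} [NormedAddCommGroup E] [NormedSpace ℝ E]
    {M : Type*} [TopologicalSpace M] [ChartedSpace E M] (π : TwoTensorField E M)
    (f₁ f₂ : M → ℝ) : M → ℝ :=
  fun x => π x (diff E f₁ x) (diff E f₂ x)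

/-- An action of the Lie algebra `g` on `M`: a Lie algebra homomorphism `ρ` from `g` to the smooth
vector fields on `M`; `ρ x u` is the value at `x` of the vector field `ρ(u)`. -/
structure Action (g : Type*) [LieRing g] [LieAlgebra ℝ g]
    (E : Type*) [NormedAddCommGroup E] [NormedSpace ℝ E]
    (M : Type*) [TopologicalSpace M] [ChartedSpace E M] [IsManifold 𝓘(ℝ, E) ∞ M] where
  ρ : ∀ x : M, g →ₗ[ℝ] TangentSpace 𝓘(ℝ, E) x
  smooth : ∀ u : g, ContMDiff 𝓘(ℝ, E) 𝓘(ℝ, E).tangent ∞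
    (fun x => (⟨x, ρ x u⟩ : TangentBundle 𝓘(ℝ, E) M))
  map_lie : ∀ (u v : g) (x : M),
    VectorField.mlieBracket 𝓘(ℝ, E) (fun y => ρ y u) (fun y => ρ y v) x = ρ x ⁅u, v⁆

section

variable {g : Type*} [LieRing g] [LieAlgebra ℝ g]
  {E : Type*} [NormedAddCommGroup E] [NormedSpace ℝ E]
  {M : Type*} [TopologicalSpace M] [ChartedSpace E M] [IsManifold 𝓘(ℝ, E) ∞ M]

/-- The transpose `ρ_x* : T*_x M → g*`, so that `ρ^{⊗k}(s)(α₁, …) = s(ρ_x* α₁, …)`. -/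
def Action.dual (A : Action g E M) (x : M) (α : Cotangent E x) : Module.Dual ℝ g :=
  α.toLinearMap ∘ₗ A.ρ x

/-- The derivative `ρ(u) f` of a function. -/
def Action.lieDeriv (A : Action g E M) (u : g) (f : M → ℝ) : M → ℝ :=
  fun x => diff E f x (A.ρ x u)

/-- For a linear subspace `h` of `g`: `y` is reached from `x` by following the vector field `ρ(u)`
of some `u` in `h` for unit time (any time, as `u` may be rescaled). -/
def Action.FlowsTo (A : Action g E M) (h : Submodule ℝ g) (x y : M) : Prop :=
  ∃ u ∈ h, ∃ γ : ℝ → M, γ 0 = x ∧ γ 1 = y ∧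
    IsMIntegralCurveOn γ (fun z => A.ρ z u) (Set.Icc 0 1)

/-- `x` and `y` lie in the same `h`-orbit. -/
def Action.SameOrbit (A : Action g E M) (h : Submodule ℝ g) : M → M → Prop :=
  Relation.EqvGen (A.FlowsTo h)

/-- A subset is `h`-invariant when it is a union of `h`-orbits. -/
def Action.IsInvariantSet (A : Action g E M) (h : Submodule ℝ g) (S : Set M) : Prop :=
  ∀ x y : M, A.SameOrbit h x y → x ∈ S → y ∈ S

end

/-- A `g`-quasi-Poisson structure on the manifold `M`. -/
structure QPStructure {g : Type*} [LieRing g] [LieAlgebra ℝ g] (t : g ⊗[ℝ] g)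
    (E : Type*) [NormedAddCommGroup E] [NormedSpace ℝ E]
    (M : Type*) [TopologicalSpace M] [ChartedSpace E M] [IsManifold 𝓘(ℝ, E) ∞ M]
    extends Action g E M where
  /-- the bivector field -/
  π : TwoTensorField E M
  skew : ∀ (x : M) (α β : Cotangent E x), π x α β = -π x β α
  /-- smoothness of the bivector field, tested on exact differentials -/
  smooth_π : ∀ f₁ f₂ : M → ℝ, IsSmoothFun E f₁ → IsSmoothFun E f₂ →
    IsSmoothFun E (fnBracket π f₁ f₂)
  /-- `π` is `g`-invariant: its Lie derivative along each `ρ(u)` vanishes,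
  `ρ(u) (π(df₁, df₂)) = π(d(ρ(u) f₁), df₂) + π(df₁, d(ρ(u) f₂))` -/
  invariant : ∀ f₁ f₂ : M → ℝ, IsSmoothFun E f₁ → IsSmoothFun E f₂ → ∀ u : g,
    toAction.lieDeriv u (fnBracket π f₁ f₂) =
      fnBracket π (toAction.lieDeriv u f₁) f₂ + fnBracket π f₁ (toAction.lieDeriv u f₂)
  /-- `[π, π] / 2 = ρ^{⊗3}(φ)`, evaluated on `df₁, df₂, df₃`. For the Schouten bracket that extends
  the Lie bracket of vector fields, `[X ∧ Y, X ∧ Y] / 2 = [X, Y] ∧ X ∧ Y`, the value of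
  `[π, π] / 2` there is `{f₁, {f₂, f₃}} + {f₂, {f₃, f₁}} + {f₃, {f₁, f₂}}`. -/
  quasi_jacobi : ∀ f₁ f₂ f₃ : M → ℝ, IsSmoothFun E f₁ → IsSmoothFun E f₂ → IsSmoothFun E f₃ →
    ∀ x : M,
      fnBracket π f₁ (fnBracket π f₂ f₃) x + fnBracket π f₂ (fnBracket π f₃ f₁) x +
          fnBracket π f₃ (fnBracket π f₁ f₂) x =
        phi t (toAction.dual x (diff E f₁ x)) (toAction.dual x (diff E f₂ x))
          (toAction.dual x (diff E f₃ x))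

section

variable {g : Type*} [LieRing g] [LieAlgebra ℝ g] {t : g ⊗[ℝ] g}
  {E : Type*} [NormedAddCommGroup E] [NormedSpace ℝ E]
  {M : Type*} [TopologicalSpace M] [ChartedSpace E M] [IsManifold 𝓘(ℝ, E) ∞ M]

/-- The tensor field `σ = π + ½ ρ^{⊗2}(t)`. -/
def QPStructure.σ (P : QPStructure t E M) (x : M) (α β : Cotangent E x) : ℝ :=
  P.π x α β + (1 / 2 : ℝ) * P.dual x β (sharp t (P.dual x α))

/-- A smooth function `f` is left-central when `σ(df, ·) = 0`. -/
def QPStructure.IsLeftCentral (P : QPStructure t E M) (f : M → ℝ) : Prop :=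
  IsSmoothFun E f ∧ ∀ (x : M) (β : Cotangent E x), P.σ x (diff E f x) β = 0

/-- A smooth function `f` is right-central when `σ(·, df) = 0`. -/
def QPStructure.IsRightCentral (P : QPStructure t E M) (f : M → ℝ) : Prop :=
  IsSmoothFun E f ∧ ∀ (x : M) (α : Cotangent E x), P.σ x α (diff E f x) = 0

/-- Quasi-Poisson-commutative: `σ = 0`. -/
def QPStructure.IsCommutative (P : QPStructure t E M) : Prop :=
  ∀ (x : M) (α β : Cotangent E x), P.σ x α β = 0

end

/-! ### Maps between quasi-Poisson manifolds -/

section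

variable {g : Type*} [LieRing g] [LieAlgebra ℝ g] {t : g ⊗[ℝ] g}
  {k : Type*} [LieRing k] [LieAlgebra ℝ k] {s : k ⊗[ℝ] k}
  {E : Type*} [NormedAddCommGroup E] [NormedSpace ℝ E]
  {M : Type*} [TopologicalSpace M] [ChartedSpace E M] [IsManifold 𝓘(ℝ, E) ∞ M]
  {F : Type*} [NormedAddCommGroup F] [NormedSpace ℝ F]
  {N : Type*} [TopologicalSpace N] [ChartedSpace F N] [IsManifold 𝓘(ℝ, F) ∞ N]

/-- The vector fields `ρ(u)` on `M` and `ρ(w)` on `N` are `f`-related. -/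
def Related (A : Action g E M) (B : Action k F N) (f : M → N) (u : g) (w : k) : Prop :=
  ∀ x : M, mfderiv 𝓘(ℝ, E) 𝓘(ℝ, F) f x (A.ρ x u) = B.ρ (f x) w

/-- `f` is equivariant for two actions of `g`. -/
def IsEquivariant (A : Action g E M) (B : Action g F N) (f : M → N) : Prop :=
  ∀ u : g, Related A B f u u

/-- `f_* π_M = π_N`, at all points of the image of `f`. -/
def PushesForward (πM : TwoTensorField E M) (πN : TwoTensorField F N) (f : M → N) : Prop :=
  ∀ (x : M) (α β : Cotangent F (f x)),
    πM x (α ∘L mfderiv 𝓘(ℝ, E) 𝓘(ℝ, F) f x) (β ∘L mfderiv 𝓘(ℝ, E) 𝓘(ℝ, F) f x) = πN (f x) α β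

/-- Quasi-Poisson maps. -/
structure IsQuasiPoissonMap (P : QPStructure t E M) (R : QPStructure t F N) (f : M → N) :
    Prop where
  smooth : ContMDiff 𝓘(ℝ, E) 𝓘(ℝ, F) ∞ f
  equivariant : IsEquivariant P.toAction R.toAction f
  push : PushesForward P.π R.π f

/-- Left central maps to a quasi-Poisson-commutative manifold. -/
structure IsLeftCentralMap (P : QPStructure t E M) (R : QPStructure t F N) (f : M → N) :
    Prop where
  commutative : R.IsCommutative
  smooth : ContMDiff 𝓘(ℝ, E) 𝓘(ℝ, F) ∞ f
  equivariant : IsEquivariant P.toAction R.toAction f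
  central : ∀ φ : N → ℝ, IsSmoothFun F φ → P.IsLeftCentral (φ ∘ f)

/-- Right central maps to a quasi-Poisson-commutative manifold. -/
structure IsRightCentralMap (P : QPStructure t E M) (R : QPStructure t F N) (f : M → N) :
    Prop where
  commutative : R.IsCommutative
  smooth : ContMDiff 𝓘(ℝ, E) 𝓘(ℝ, F) ∞ f
  equivariant : IsEquivariant P.toAction R.toAction f
  central : ∀ φ : N → ℝ, IsSmoothFun F φ → P.IsRightCentral (φ ∘ f)

/-- A central pair `N_L ← M → N_R`. -/
structure IsCentralPair {F₁ : Type*} [NormedAddCommGroup F₁] [NormedSpace ℝ F₁]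
    {N₁ : Type*} [TopologicalSpace N₁] [ChartedSpace F₁ N₁] [IsManifold 𝓘(ℝ, F₁) ∞ N₁]
    (P : QPStructure t E M) (RL : QPStructure t F N) (RR : QPStructure t F₁ N₁)
    (μL : M → N) (μR : M → N₁) : Prop where
  left : IsLeftCentralMap P RL μL
  right : IsRightCentralMap P RR μR

/-- For a submanifold `i : O → N` that is a union of `h`-orbits of `N`, the map `q : O → Q` exhibits
`Q` as the quotient manifold `O / h`: it is a surjective submersion whose fibres are the `h`-orbits
contained in `O`. With `i = id` this is the quotient `N / h`. -/
structure IsOrbitQuotient (A : Action g F N) (h : Submodule ℝ g)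
    {E₁ : Type*} [NormedAddCommGroup E₁] [NormedSpace ℝ E₁]
    {O : Type*} [TopologicalSpace O] [ChartedSpace E₁ O]
    {E₂ : Type*} [NormedAddCommGroup E₂] [NormedSpace ℝ E₂]
    {Q : Type*} [TopologicalSpace Q] [ChartedSpace E₂ Q] (i : O → N) (q : O → Q) : Prop where
  surjective : Function.Surjective q
  submersion : Manifold.IsSubmersion 𝓘(ℝ, E₁) 𝓘(ℝ, E₂) ∞ q
  fibres : ∀ a b : O, q a = q b ↔ A.SameOrbit h (i a) (i b)

end

/-- The map `f : M → N` is transverse to the submanifold `i : O → N`: wherever `f x = i a`, the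
images of `df_x` and of `di_a` span the tangent space of `N`. -/
def IsTransverse {E H M : Type*} [NormedAddCommGroup E] [NormedSpace ℝ E] [TopologicalSpace H]
    (I : ModelWithCorners ℝ E H) [TopologicalSpace M] [ChartedSpace H M]
    {E₁ H₁ O : Type*} [NormedAddCommGroup E₁] [NormedSpace ℝ E₁] [TopologicalSpace H₁]
    (I₁ : ModelWithCorners ℝ E₁ H₁) [TopologicalSpace O] [ChartedSpace H₁ O]
    {E₂ H₂ N : Type*} [NormedAddCommGroup E₂] [NormedSpace ℝ E₂] [TopologicalSpace H₂]
    (J : ModelWithCorners ℝ E₂ H₂) [TopologicalSpace N] [ChartedSpace H₂ N]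
    (f : M → N) (i : O → N) : Prop :=
  ∀ (x : M) (a : O), f x = i a →
    LinearMap.range (mfderiv I J f x : E →L[ℝ] E₂).toLinearMap ⊔
      LinearMap.range (mfderiv I₁ J i a : E₁ →L[ℝ] E₂).toLinearMap = ⊤

/-- `μ_L⁻¹(O_L) ∩ μ_R⁻¹(O_R)`, with `O_L` and `O_R` the images of `iL` and `iR`. -/
def constraintSet {M NL NR OL OR : Type*} (μL : M → NL) (μR : M → NR) (iL : OL → NL)
    (iR : OR → NR) : Set M :=
  μL ⁻¹' Set.range iL ∩ μR ⁻¹' Set.range iR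

end Manifolds

end QuasiPoisson

end

/-! Two facts carry the theorem. The first is algebraic. If `α` kills `h`, then `t♯ α` lies in `c`:
for `β` in `Ann c`, symmetry gives `β (t♯ α) = α (t♯ β)`, and `t♯ β` lies in `c^⊥ ⊆ h`. Hence on
covectors that kill `h` both `t` and `φ` depend only on the induced functionals on `c / h`
(`exists_descendsTo`, `DescendsTo.exists_sharp_eq`, `DescendsTo.phi_eq`). The second is that
centrality of `μ` is a pointwise identity, `π(μ^*κ, ·) = ∓½ t(ρ^*κ, ρ^*·)` (`IsCentralWith`).

Quotient: functions on `M / h` are the `h`-invariant functions on `M`. Their brackets are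
`h`-invariant because `π` is, and their differentials kill `ρ(h)`, so the quasi-Jacobi identity
descends with `φ` of `t'` (`QPStructure.exists_descend`).

Submanifold: by transversality the constraint set is locally the zero set of a map that factors
through `(μ_L, μ_R)` and has surjective derivative. The set is a union of `h`-orbits, so composing
this map with a local section of `q` defines `M'` in `M / h`. A conormal of `M'` pulls back to
`μ_L^*κ_L + μ_R^*κ_R` with `κ_L`, `κ_R` conormal to `O_L`, `O_R`. These submanifolds are
`c`-invariant, so `ρ^*κ` lies in `Ann c` and `t♯ (ρ^*κ)` in `c^⊥ ⊆ h`. Covectors pulled back from `M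
/ h` kill `ρ(h)`, so by centrality the reduced bivector annihilates the conormals, i.e. it is
tangent to `M'` (`reduced_bivector_eq_zero`).

Targets: on a commutative manifold the skew and symmetric parts of `σ` vanish separately, so `ρ ⊗ ρ
(t) = 0`. This passes to `ρ ⊗ ρ (t') = 0` on `O / h`, which is therefore commutative with the zero
bivector (`Action.exists_commutative`). The centrality identity passes to the induced maps
(`inducedMap_central`), whose derivatives are computed with local retractions to `O` and local
sections of `q`. -/

namespace QuasiPoisson

open Set Filter Topology

/-! ### Differentials of functions and Lie brackets of vector fields -/

section Calculus

variable {E : Type*} [NormedAddCommGroup E] [NormedSpace ℝ E]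
  {M : Type*} [TopologicalSpace M] [ChartedSpace E M]
  {F : Type*} [NormedAddCommGroup F] [NormedSpace ℝ F]
  {N : Type*} [TopologicalSpace N] [ChartedSpace F N]

theorem diff_comp {f : N → ℝ} {i : M → N} {x : M}
    (hf : MDifferentiableAt 𝓘(ℝ, F) 𝓘(ℝ, ℝ) f (i x))
    (hi : MDifferentiableAt 𝓘(ℝ, E) 𝓘(ℝ, F) i x) :
    diff E (f ∘ i) x = (diff F f (i x)).comp (mfderiv 𝓘(ℝ, E) 𝓘(ℝ, F) i x) :=
  mvfderiv_comp x hf hi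

theorem diff_congr {f g : M → ℝ} {x : M} (h : f =ᶠ[𝓝 x] g) : diff E f x = diff E g x := by
  unfold diff mvfderiv
  rw [h.mfderiv_eq, h.eq_of_nhds]

theorem IsSmoothFun.mdifferentiableAt {f : M → ℝ} (hf : IsSmoothFun E f) (x : M) :
    MDifferentiableAt 𝓘(ℝ, E) 𝓘(ℝ, ℝ) f x :=
  (hf x).mdifferentiableAt (by simp)

variable [IsManifold 𝓘(ℝ, E) ∞ M] [IsManifold 𝓘(ℝ, F) ∞ N]

theorem contMDiff_diff_apply {f : M → ℝ} (hf : IsSmoothFun E f)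
    {X : ∀ x : M, TangentSpace 𝓘(ℝ, E) x}
    (hX : ContMDiff 𝓘(ℝ, E) 𝓘(ℝ, E).tangent ∞ (fun x => (⟨x, X x⟩ : TangentBundle 𝓘(ℝ, E) M))) :
    IsSmoothFun E (fun x => diff E f x (X x)) := by
  have h1 := (hf.contMDiff_tangentMap (m := ∞) (by simp)).comp hX
  exact (contMDiff_snd_tangentBundle_modelSpace ℝ 𝓘(ℝ, ℝ)).comp h1

/-- A locally defined smooth function agrees near a point with a global one. -/
theorem exists_isSmoothFun_eventuallyEq [T2Space M] [FiniteDimensional ℝ E] {x : M} {U : Set M}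
    (hU : U ∈ 𝓝 x) {f : M → ℝ} (hf : ContMDiffOn 𝓘(ℝ, E) 𝓘(ℝ, ℝ) ∞ f U) :
    ∃ g : M → ℝ, IsSmoothFun E g ∧ g =ᶠ[𝓝 x] f := by
  obtain ⟨χ, -, hχ⟩ := (SmoothBumpFunction.nhds_basis_tsupport (I := 𝓘(ℝ, E)) x).mem_iff.1
    (interior_mem_nhds.2 hU)
  refine ⟨fun y => χ y * f y, contMDiff_of_tsupport fun y hy => ?_, ?_⟩
  · have hy' : y ∈ tsupport χ := tsupport_mul_subset_left hy
    exact χ.contMDiffAt.mul ((hf y (interior_subset (hχ hy'))).contMDiffAt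
      (mem_interior_iff_mem_nhds.1 (hχ hy')))
  · filter_upwards [χ.eventuallyEq_one] with y hy
    simp [hy]

/-- A linear functional of the chart, cut off by a bump function, has any prescribed differential at
the point. This is how identities between functions become identities between covectors. -/
theorem exists_diff_eq [T2Space M] [FiniteDimensional ℝ E] {x : M} (α : Cotangent E x) :
    ∃ f : M → ℝ, IsSmoothFun E f ∧ diff E f x = α := by
  have hs : (chartAt E x).source ∈ 𝓝 x := (chartAt E x).open_source.mem_nhds (mem_chart_source E x)
  have hφ := contMDiffOn_extChartAt (I := 𝓘(ℝ, E)) (n := ∞) (x := x)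
  have hα : ContMDiff 𝓘(ℝ, E) 𝓘(ℝ, ℝ) ∞ (fun v : E => (show E →L[ℝ] ℝ from α) v) :=
    (show E →L[ℝ] ℝ from α).contMDiff
  obtain ⟨f, hf, hfx⟩ := exists_isSmoothFun_eventuallyEq hs (hα.comp_contMDiffOn hφ)
  refine ⟨f, hf, ?_⟩
  rw [diff_congr hfx]
  have h1 := diff_comp (E := E) (F := E) (x := x) (i := extChartAt 𝓘(ℝ, E) x)
    (f := fun v : E => (show E →L[ℝ] ℝ from α) v)
    (hα.mdifferentiableAt (by simp)) (mdifferentiableAt_extChartAt (mem_chart_source E x))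
  refine h1.trans ?_
  -- The tangent space at `x` is the model space through the preferred chart at `x`, whose
  -- derivative at `x` is thus the identity.
  rw [mfderiv_extChartAt_self]
  ext v
  have : diff E (fun v : E => (show E →L[ℝ] ℝ from α) v) (extChartAt 𝓘(ℝ, E) x x) = α := by
    unfold diff mvfderiv
    rw [mfderiv_eq_fderiv]
    exact (show E →L[ℝ] ℝ from α).fderiv
  exact congrArg (fun β : E →L[ℝ] ℝ => β v) this

theorem eq_of_forall_diff_eq [T2Space M] [FiniteDimensional ℝ E] {x : M}
    {v w : TangentSpace 𝓘(ℝ, E) x} (h : ∀ f : M → ℝ, IsSmoothFun E f → diff E f x v = diff E f x w) :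
    v = w := by
  by_contra hvw
  have : ‖(show E from v) - (show E from w)‖ ≠ 0 := norm_ne_zero_iff.2 (sub_ne_zero.2 hvw)
  obtain ⟨α, -, hα⟩ := exists_dual_vector ℝ _ this
  obtain ⟨f, hf, hfx⟩ := exists_diff_eq (x := x) (show Cotangent E x from α)
  have h2 := h f hf
  rw [hfx] at h2
  have h3 : α v = α w := h2
  rw [map_sub, h3, sub_self] at hα
  exact this (by simpa using hα.symm)

theorem fderiv_lieBracket {f : E → ℝ} {V W : E → E} {x : E} (hf : ContDiffAt ℝ 2 f x)
    (hV : DifferentiableAt ℝ V x) (hW : DifferentiableAt ℝ W x) :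
    fderiv ℝ f x (VectorField.lieBracket ℝ V W x) =
      fderiv ℝ (fun y => fderiv ℝ f y (W y)) x (V x) -
        fderiv ℝ (fun y => fderiv ℝ f y (V y)) x (W x) := by
  have h1 : DifferentiableAt ℝ (fderiv ℝ f) x :=
    (hf.fderiv_right (m := 1) (by norm_num)).differentiableAt (by simp)
  have hs : IsSymmSndFDerivAt ℝ f x := hf.isSymmSndFDerivAt (by simp)
  rw [fderiv_clm_apply h1 hW, fderiv_clm_apply h1 hV]
  simp only [VectorField.lieBracket, add_apply, ContinuousLinearMap.comp_apply,
    ContinuousLinearMap.flip_apply, map_sub]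
  -- The two Hessian terms cancel by symmetry of the second derivative.
  rw [hs.eq (V x) (W x)]
  ring

/-- The commutator formula for vector fields as derivations, obtained from `fderiv_lieBracket` by
reading everything in the chart at `x`. -/
theorem diff_mlieBracket [CompleteSpace E] {f : M → ℝ} (hf : IsSmoothFun E f)
    {X Y : ∀ x : M, TangentSpace 𝓘(ℝ, E) x}
    (hX : ContMDiff 𝓘(ℝ, E) 𝓘(ℝ, E).tangent ∞ (fun x => (⟨x, X x⟩ : TangentBundle 𝓘(ℝ, E) M)))
    (hY : ContMDiff 𝓘(ℝ, E) 𝓘(ℝ, E).tangent ∞ (fun x => (⟨x, Y x⟩ : TangentBundle 𝓘(ℝ, E) M)))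
    (x : M) :
    diff E f x (VectorField.mlieBracket 𝓘(ℝ, E) X Y x) =
      diff E (fun y => diff E f y (Y y)) x (X x) - diff E (fun y => diff E f y (X y)) x (Y x) := by
  have : IsManifold 𝓘(ℝ, E) 2 M := IsManifold.of_le (n := ∞) ENat.LEInfty.out
  have : IsManifold 𝓘(ℝ, E) 1 M := IsManifold.of_le (n := ∞) ENat.LEInfty.out
  set φ := extChartAt 𝓘(ℝ, E) x with hφ
  have hψ : ContMDiffOn 𝓘(ℝ, E) 𝓘(ℝ, E) ∞ φ.symm φ.target := contMDiffOn_extChartAt_symm x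
  have ht : φ.target ∈ 𝓝 (φ x) := extChartAt_target_mem_nhds x
  have hψd : ∀ y ∈ φ.target, MDifferentiableAt 𝓘(ℝ, E) 𝓘(ℝ, E) φ.symm y := fun y hy => by
    have := mdifferentiableWithinAt_extChartAt_symm (I := 𝓘(ℝ, E)) hy
    rwa [modelWithCornersSelf_coe, range_id, mdifferentiableWithinAt_univ] at this
  -- the derivative of a function read in the chart
  have hcomp : ∀ k : M → ℝ, IsSmoothFun E k → ∀ y ∈ φ.target, ∀ w : E,
      fderiv ℝ (k ∘ φ.symm) y w = diff E k (φ.symm y) (mfderiv 𝓘(ℝ, E) 𝓘(ℝ, E) φ.symm y w) := by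
    intro k hk y hy w
    have h1 := diff_comp (hk.mdifferentiableAt (φ.symm y)) (hψd y hy)
    have h2 : diff E (k ∘ φ.symm) y = fderiv ℝ (k ∘ φ.symm) y := by
      unfold diff mvfderiv
      rw [mfderiv_eq_fderiv]
      rfl
    rw [← h2]
    exact congrArg (fun β : E →L[ℝ] ℝ => β w) h1
  -- `V Z` is the vector field `Z` read in the chart.
  set V : (Z : ∀ x : M, TangentSpace 𝓘(ℝ, E) x) → E → E := fun Z y =>
    (mfderiv 𝓘(ℝ, E) 𝓘(ℝ, E) φ.symm y).inverse (Z (φ.symm y)) with hVdef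
  have hVeq : ∀ Z : ∀ x : M, TangentSpace 𝓘(ℝ, E) x, V Z =
      VectorField.mpullbackWithin 𝓘(ℝ, E) 𝓘(ℝ, E) φ.symm Z (range 𝓘(ℝ, E)) := by
    intro Z
    funext y
    simp only [hVdef, VectorField.mpullbackWithin_apply, modelWithCornersSelf_coe, range_id,
      mfderivWithin_univ]
    rfl
  have hVd : ∀ Z : ∀ x : M, TangentSpace 𝓘(ℝ, E) x,
      ContMDiff 𝓘(ℝ, E) 𝓘(ℝ, E).tangent ∞ (fun x => (⟨x, Z x⟩ : TangentBundle 𝓘(ℝ, E) M)) →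
      DifferentiableAt ℝ (V Z) (φ x) := by
    intro Z hZ
    have := MDifferentiableWithinAt.differentiableWithinAt_mpullbackWithin_vectorField
      (I := 𝓘(ℝ, E)) (V := Z) (x := x) (s := univ)
      ((hZ x).mdifferentiableAt (by simp)).mdifferentiableWithinAt
    rw [hVeq]
    refine DifferentiableWithinAt.differentiableAt this ?_
    simp
  have hVapp : ∀ Z : ∀ x : M, TangentSpace 𝓘(ℝ, E) x, ∀ y ∈ φ.target,
      mfderiv 𝓘(ℝ, E) 𝓘(ℝ, E) φ.symm y (V Z y) = Z (φ.symm y) := by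
    intro Z y hy
    have hinv := isInvertible_mfderivWithin_extChartAt_symm (I := 𝓘(ℝ, E)) hy
    have h1 := hinv.self_apply_inverse (Z (φ.symm y))
    rw [modelWithCornersSelf_coe, range_id, mfderivWithin_univ] at h1
    exact h1
  have key : ∀ k : M → ℝ, IsSmoothFun E k → ∀ Z : ∀ x : M, TangentSpace 𝓘(ℝ, E) x,
      (fun y => fderiv ℝ (k ∘ φ.symm) y (V Z y)) =ᶠ[𝓝 (φ x)]
        (fun z => diff E k z (Z z)) ∘ φ.symm := by
    intro k hk Z
    filter_upwards [ht] with y hy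
    rw [hcomp k hk y hy, hVapp Z y hy]
    rfl
  have hφx : φ.symm (φ x) = x := extChartAt_to_inv x
  have hF : ContDiffAt ℝ 2 (f ∘ φ.symm) (φ x) := by
    have : ContMDiffAt 𝓘(ℝ, E) 𝓘(ℝ, ℝ) ∞ (f ∘ φ.symm) (φ x) :=
      (hf _).comp (φ x) (hψ.contMDiffAt ht)
    exact this.contDiffAt.of_le ENat.LEInfty.out
  have hbr := fderiv_lieBracket hF (hVd X hX) (hVd Y hY)
  rw [(key f hf Y).fderiv_eq, (key f hf X).fderiv_eq] at hbr
  have hend : ∀ k : M → ℝ, IsSmoothFun E k → ∀ Z : ∀ x : M, TangentSpace 𝓘(ℝ, E) x,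
      fderiv ℝ (k ∘ φ.symm) (φ x) (V Z (φ x)) = diff E k x (Z x) := by
    intro k hk Z
    have h1 : (fun z => diff E k z (Z z)) (φ.symm (φ x)) = diff E k x (Z x) := by rw [hφx]
    exact ((key k hk Z).eq_of_nhds).trans h1
  rw [hend _ (contMDiff_diff_apply hf hY) X, hend _ (contMDiff_diff_apply hf hX) Y] at hbr
  rw [← hbr, hcomp f hf _ (mem_extChartAt_target x), hφx]
  have e1 : ∀ w : E, (mfderiv 𝓘(ℝ, E) 𝓘(ℝ, E) φ x).inverse w = w := by
    intro w
    exact (congrArg (fun β : E →L[ℝ] E => β.inverse w)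
      (mfderiv_extChartAt_self (I := 𝓘(ℝ, E)) (x := x))).trans
      (congrArg (fun β : E →L[ℝ] E => β w) (ContinuousLinearMap.inverse_id (R := ℝ) (M := E)))
  have e2 : ∀ w : E, mfderiv 𝓘(ℝ, E) 𝓘(ℝ, E) φ.symm (φ x) w = w := by
    intro w
    have := mfderivWithin_range_extChartAt_symm (I := 𝓘(ℝ, E)) (x := x)
    rw [modelWithCornersSelf_coe, range_id, mfderivWithin_univ] at this
    exact congrArg (fun β : E →L[ℝ] E => β w) this
  have e3 : VectorField.mlieBracket 𝓘(ℝ, E) X Y x = VectorField.lieBracket ℝ (V X) (V Y) (φ x) := by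
    unfold VectorField.mlieBracket
    rw [VectorField.mlieBracketWithin_apply, hVeq, hVeq, ← hφ]
    simp only [preimage_univ, univ_inter, modelWithCornersSelf_coe, range_id]
    exact (e1 _).trans (congrFun (VectorField.lieBracketWithin_univ (𝕜 := ℝ) (E := E)) _)
  exact congrArg (fun w : E => (diff E f x : E →L[ℝ] ℝ) w) (e3.trans (e2 _).symm)

/-- Relatedness means `X (k ∘ i) = (X' k) ∘ i` for all functions `k`; applying this twice to the
commutator formula proves the claim, because functions separate tangent vectors. -/
theorem mlieBracket_related [T2Space N] [FiniteDimensional ℝ F] [CompleteSpace E] {i : M → N}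
    (hi : ContMDiff 𝓘(ℝ, E) 𝓘(ℝ, F) ∞ i)
    {X Y : ∀ x : M, TangentSpace 𝓘(ℝ, E) x} {X' Y' : ∀ x : N, TangentSpace 𝓘(ℝ, F) x}
    (hX : ContMDiff 𝓘(ℝ, E) 𝓘(ℝ, E).tangent ∞ (fun x => (⟨x, X x⟩ : TangentBundle 𝓘(ℝ, E) M)))
    (hY : ContMDiff 𝓘(ℝ, E) 𝓘(ℝ, E).tangent ∞ (fun x => (⟨x, Y x⟩ : TangentBundle 𝓘(ℝ, E) M)))
    (hX' : ContMDiff 𝓘(ℝ, F) 𝓘(ℝ, F).tangent ∞ (fun x => (⟨x, X' x⟩ : TangentBundle 𝓘(ℝ, F) N)))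
    (hY' : ContMDiff 𝓘(ℝ, F) 𝓘(ℝ, F).tangent ∞ (fun x => (⟨x, Y' x⟩ : TangentBundle 𝓘(ℝ, F) N)))
    (hXX' : ∀ x, mfderiv 𝓘(ℝ, E) 𝓘(ℝ, F) i x (X x) = X' (i x))
    (hYY' : ∀ x, mfderiv 𝓘(ℝ, E) 𝓘(ℝ, F) i x (Y x) = Y' (i x)) (x : M) :
    mfderiv 𝓘(ℝ, E) 𝓘(ℝ, F) i x (VectorField.mlieBracket 𝓘(ℝ, E) X Y x) =
      VectorField.mlieBracket 𝓘(ℝ, F) X' Y' (i x) := by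
  have : CompleteSpace F := FiniteDimensional.complete ℝ F
  have hrel : ∀ (Z : ∀ x : M, TangentSpace 𝓘(ℝ, E) x) (Z' : ∀ x : N, TangentSpace 𝓘(ℝ, F) x),
      (∀ x, mfderiv 𝓘(ℝ, E) 𝓘(ℝ, F) i x (Z x) = Z' (i x)) → ∀ k : N → ℝ, IsSmoothFun F k →
      ∀ x, diff E (k ∘ i) x (Z x) = diff F k (i x) (Z' (i x)) := by
    intro Z Z' hZ k hk x
    rw [diff_comp (hk.mdifferentiableAt _) (hi.mdifferentiableAt (by simp))]
    exact congrArg _ (hZ x)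
  refine eq_of_forall_diff_eq fun f hf => ?_
  have h1 : diff F f (i x) (mfderiv 𝓘(ℝ, E) 𝓘(ℝ, F) i x (VectorField.mlieBracket 𝓘(ℝ, E) X Y x)) =
      diff E (f ∘ i) x (VectorField.mlieBracket 𝓘(ℝ, E) X Y x) := by
    rw [diff_comp (hf.mdifferentiableAt _) (hi.mdifferentiableAt (by simp))]
    rfl
  have hfi : IsSmoothFun E (f ∘ i) := hf.comp hi
  rw [h1, diff_mlieBracket hfi hX hY, diff_mlieBracket hf hX' hY']
  rw [← hrel X X' hXX' _ (contMDiff_diff_apply hf hY') x,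
    ← hrel Y Y' hYY' _ (contMDiff_diff_apply hf hX') x]
  congr 3
  · ext y; exact hrel Y Y' hYY' f hf y
  · ext y; exact hrel X X' hXX' f hf y

end Calculus

/-! ### Derivatives as linear maps of model spaces -/

section Derivative

variable {E : Type*} [NormedAddCommGroup E] [NormedSpace ℝ E]
  {M : Type*} [TopologicalSpace M] [ChartedSpace E M]
  {F : Type*} [NormedAddCommGroup F] [NormedSpace ℝ F]
  {N : Type*} [TopologicalSpace N] [ChartedSpace F N]
  {G : Type*} [NormedAddCommGroup G] [NormedSpace ℝ G]
  {P : Type*} [TopologicalSpace P] [ChartedSpace G P]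

/-- The derivative of a map between manifolds, as a map between the model spaces. -/
noncomputable def der (E : Type*) [NormedAddCommGroup E] [NormedSpace ℝ E]
    (F : Type*) [NormedAddCommGroup F] [NormedSpace ℝ F]
    {M : Type*} [TopologicalSpace M] [ChartedSpace E M]
    {N : Type*} [TopologicalSpace N] [ChartedSpace F N] (i : M → N) (x : M) : E →L[ℝ] F :=
  mfderiv 𝓘(ℝ, E) 𝓘(ℝ, F) i x

theorem diff_eq_der (f : M → ℝ) (x : M) : diff E f x = der E ℝ f x := rfl

theorem der_comp {j : N → P} {i : M → N} {x : M}
    (hj : MDifferentiableAt 𝓘(ℝ, F) 𝓘(ℝ, G) j (i x))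
    (hi : MDifferentiableAt 𝓘(ℝ, E) 𝓘(ℝ, F) i x) :
    der E G (j ∘ i) x = (der F G j (i x)).comp (der E F i x) :=
  mfderiv_comp x hj hi

theorem der_comp_apply {j : N → P} {i : M → N} {x : M}
    (hj : MDifferentiableAt 𝓘(ℝ, F) 𝓘(ℝ, G) j (i x))
    (hi : MDifferentiableAt 𝓘(ℝ, E) 𝓘(ℝ, F) i x) (v : E) :
    der E G (j ∘ i) x v = der F G j (i x) (der E F i x v) := by
  rw [der_comp hj hi]; rfl

theorem der_congr {i j : M → N} {x : M} (h : i =ᶠ[𝓝 x] j) : der E F i x = der E F j x := by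
  unfold der
  exact h.mfderiv_eq

theorem der_id (x : M) : der E E (id : M → M) x = ContinuousLinearMap.id ℝ E :=
  mfderiv_id

theorem der_const (x : M) (y : N) : der E F (fun _ : M => y) x = 0 :=
  mfderiv_const

theorem der_eq_fderiv (f : E → F) (x : E) : der E F f x = fderiv ℝ f x :=
  mfderiv_eq_fderiv

theorem der_clm (f : E →L[ℝ] F) (x : E) : der E F f x = f := by
  rw [der_eq_fderiv, f.fderiv]

/-- The chain rule for the velocity of a curve. -/
theorem hasMFDerivWithinAt_comp_curve {f : M → N} {c : ℝ → M} {s : Set ℝ} {t : ℝ} {w : E}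
    (hf : MDifferentiableAt 𝓘(ℝ, E) 𝓘(ℝ, F) f (c t))
    (hc : HasMFDerivWithinAt 𝓘(ℝ, ℝ) 𝓘(ℝ, E) c s t
      ((1 : ℝ →L[ℝ] ℝ).smulRight w : ℝ →L[ℝ] E)) :
    HasMFDerivWithinAt 𝓘(ℝ, ℝ) 𝓘(ℝ, F) (f ∘ c) s t
      ((1 : ℝ →L[ℝ] ℝ).smulRight (der E F f (c t) w) : ℝ →L[ℝ] F) := by
  refine (hf.hasMFDerivAt.comp_hasMFDerivWithinAt t hc).congr_mfderiv ?_
  change (der E F f (c t)).comp ((1 : ℝ →L[ℝ] ℝ).smulRight w : ℝ →L[ℝ] E) = _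
  ext
  simp

end Derivative

/-! ### Local structure of submersions -/

section Submersion

universe u

variable {E : Type u} [NormedAddCommGroup E] [NormedSpace ℝ E]
  {M : Type*} [TopologicalSpace M] [ChartedSpace E M]
  {F : Type*} [NormedAddCommGroup F] [NormedSpace ℝ F]
  {N : Type*} [TopologicalSpace N] [ChartedSpace F N]
  {G : Type*} [NormedAddCommGroup G] [NormedSpace ℝ G]
  {P : Type*} [TopologicalSpace P] [ChartedSpace G P]
  {q : M → N}

theorem _root_.ContMDiffOn.mdifferentiableAt_of_mem {f : M → N} {U : Set M}
    (hf : ContMDiffOn 𝓘(ℝ, E) 𝓘(ℝ, F) ∞ f U) (hU : IsOpen U) {x : M} (hx : x ∈ U) :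
    MDifferentiableAt 𝓘(ℝ, E) 𝓘(ℝ, F) f x :=
  (hf.contMDiffAt (hU.mem_nhds hx)).mdifferentiableAt (by simp)

/-- A chart of the maximal atlas is smooth, and so is its inverse. -/
theorem chart_smooth {φ : OpenPartialHomeomorph M E}
    (hφ : φ ∈ IsManifold.maximalAtlas 𝓘(ℝ, E) ∞ M) :
    ContMDiffOn 𝓘(ℝ, E) 𝓘(ℝ, E) ∞ φ φ.source ∧
      ContMDiffOn 𝓘(ℝ, E) 𝓘(ℝ, E) ∞ φ.symm φ.target :=
  ⟨contMDiffOn_of_mem_maximalAtlas hφ, contMDiffOn_symm_of_mem_maximalAtlas hφ⟩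

theorem chart_der_symm_apply {φ : OpenPartialHomeomorph M E}
    (hφ : φ ∈ IsManifold.maximalAtlas 𝓘(ℝ, E) ∞ M) {x : M} (hx : x ∈ φ.source) (v : E) :
    der E E φ.symm (φ x) (der E E φ x v) = v := by
  rw [← der_comp_apply ((chart_smooth hφ).2.mdifferentiableAt_of_mem φ.open_target
    (φ.map_source hx)) ((chart_smooth hφ).1.mdifferentiableAt_of_mem φ.open_source hx)]
  rw [der_congr (j := id), der_id]
  · rfl
  · filter_upwards [φ.open_source.mem_nhds hx] with y hy using φ.left_inv hy

/-- The normal form of a submersion near a point. -/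
theorem submersion_normal_form (hq : Manifold.IsSubmersion 𝓘(ℝ, E) 𝓘(ℝ, F) ∞ q) (x : M) :
    ∃ (K : Type u) (_ : NormedAddCommGroup K) (_ : NormedSpace ℝ K) (e : E ≃L[ℝ] (F × K))
      (φ : OpenPartialHomeomorph M E) (ψ : OpenPartialHomeomorph N F),
      φ ∈ IsManifold.maximalAtlas 𝓘(ℝ, E) ∞ M ∧ ψ ∈ IsManifold.maximalAtlas 𝓘(ℝ, F) ∞ N ∧
      x ∈ φ.source ∧ MapsTo q φ.source ψ.source ∧
      ∀ z ∈ φ.target, ψ (q (φ.symm z)) = (e z).1 := by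
  have h := hq.isSubmersionAt x
  refine ⟨_, inferInstance, inferInstance, h.equiv, h.domChart, h.codChart,
    h.domChart_mem_maximalAtlas, h.codChart_mem_maximalAtlas, h.mem_domChart_source,
    h.source_subset_preimage_source, fun z hz => ?_⟩
  have hz' : z ∈ (h.domChart.extend 𝓘(ℝ, E)).target := by simpa using hz
  exact h.writtenInCharts hz'

/-- A submersion has local sections through every point. -/
theorem submersion_exists_section (hq : Manifold.IsSubmersion 𝓘(ℝ, E) 𝓘(ℝ, F) ∞ q) (x : M) :
    ∃ (V : Set N) (s : N → M), IsOpen V ∧ q x ∈ V ∧ ContMDiffOn 𝓘(ℝ, F) 𝓘(ℝ, E) ∞ s V ∧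
      s (q x) = x ∧ ∀ y ∈ V, q (s y) = y := by
  obtain ⟨K, _, _, e, φ, ψ, hφ, hψ, hx, hm, hw⟩ := submersion_normal_form hq x
  -- The section moves the base coordinate and freezes the fibre coordinate at its value at `x`.
  set j : F → E := fun w => e.symm (w, (e (φ x)).2) with hj
  have hjc : ContDiff ℝ ∞ j := by fun_prop
  have hjx : j (ψ (q x)) = φ x := by
    have := hw (φ x) (φ.map_source hx)
    rw [φ.left_inv hx] at this
    simp [hj, this]
  refine ⟨ψ.source ∩ ψ ⁻¹' (j ⁻¹' φ.target), fun y => φ.symm (j (ψ y)),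
    ψ.isOpen_inter_preimage (φ.open_target.preimage hjc.continuous), ⟨hm hx, ?_⟩, ?_, ?_, ?_⟩
  · simp only [mem_preimage, hjx, φ.map_source hx]
  · refine (chart_smooth hφ).2.comp (hjc.contMDiff.comp_contMDiffOn
      ((chart_smooth hψ).1.mono inter_subset_left)) fun y hy => hy.2
  · simp only [hjx, φ.left_inv hx]
  · intro y hy
    refine ψ.injOn (hm (φ.map_target hy.2)) hy.1 ?_
    rw [hw _ hy.2]
    simp [hj]

/-- A map that is smooth after composition with a surjective submersion is smooth. -/
theorem submersion_descend_contMDiff (hq : Manifold.IsSubmersion 𝓘(ℝ, E) 𝓘(ℝ, F) ∞ q)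
    (hs : Function.Surjective q) {G' H' P' : Type*}
    [NormedAddCommGroup G'] [NormedSpace ℝ G'] [TopologicalSpace H'] [TopologicalSpace P']
    [ChartedSpace H' P'] {J : ModelWithCorners ℝ G' H'} {f : N → P'}
    (hf : ContMDiff 𝓘(ℝ, E) J ∞ (f ∘ q)) : ContMDiff 𝓘(ℝ, F) J ∞ f := by
  intro y
  obtain ⟨x, rfl⟩ := hs y
  obtain ⟨V, s, hV, hx, hs, hsx, hqs⟩ := submersion_exists_section hq x
  have h1 : ContMDiffOn 𝓘(ℝ, F) J ∞ (f ∘ q ∘ s) V := hf.comp_contMDiffOn hs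
  refine (h1.contMDiffAt (hV.mem_nhds hx)).congr_of_eventuallyEq ?_
  filter_upwards [hV.mem_nhds hx] with y hy
  simp [hqs y hy]

/-- A map that is constant on the fibre of a submersion has derivative zero on its tangent space. -/
theorem submersion_der_eq_zero (hq : Manifold.IsSubmersion 𝓘(ℝ, E) 𝓘(ℝ, F) ∞ q) {x : M}
    {f : M → P} (hf : MDifferentiableAt 𝓘(ℝ, E) 𝓘(ℝ, G) f x)
    (hc : ∀ᶠ x' in 𝓝 x, q x' = q x → f x' = f x) {v : E} (hv : der E F q x v = 0) :
    der E G f x v = 0 := by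
  obtain ⟨K, _, _, e, φ, ψ, hφ, hψ, hx, hm, hw⟩ := submersion_normal_form hq x
  set w : E := der E E φ x v with hwdef
  have hφx := (chart_smooth hφ).1.mdifferentiableAt_of_mem φ.open_source hx
  have hew : (e w).1 = 0 := by
    have h1 := der_comp_apply (j := ψ) (i := q) (x := x)
      ((chart_smooth hψ).1.mdifferentiableAt_of_mem ψ.open_source (hm hx))
      (hq.contMDiff.mdifferentiableAt (by simp)) v
    have h2 := der_comp_apply (j := ((ContinuousLinearMap.fst ℝ F K).comp e.toContinuousLinearMap))
      (i := φ) (x := x) (ContinuousLinearMap.differentiableAt _).mdifferentiableAt hφx v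
    rw [der_clm] at h2
    rw [hv, map_zero, der_congr (j := ((ContinuousLinearMap.fst ℝ F K).comp
      e.toContinuousLinearMap) ∘ φ), h2] at h1
    · exact h1
    · filter_upwards [φ.open_source.mem_nhds hx] with y hy
      have := hw (φ y) (φ.map_source hy)
      rw [φ.left_inv hy] at this
      exact this
  -- A straight line in the chart in the direction of `v`. Since `(e w).1 = 0`, it stays in the
  -- fibre through `x`, where `f` is constant.
  set c : ℝ → M := fun t => φ.symm (φ x + t • w) with hc'
  have hl : HasDerivAt (fun t : ℝ => φ x + t • w) w 0 := by
    simpa using ((hasDerivAt_id (0 : ℝ)).smul_const w).const_add (φ x)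
  have hl0 : φ x + (0 : ℝ) • w = φ x := by simp
  have hct : Tendsto (fun t : ℝ => φ x + t • w) (𝓝 0) (𝓝 (φ x)) := by
    simpa using hl.continuousAt.tendsto
  have hcx : Tendsto c (𝓝 0) (𝓝 x) := by
    have := (φ.continuousAt_symm (φ.map_source hx)).tendsto.comp hct
    rwa [φ.left_inv hx] at this
  have hev : f ∘ c =ᶠ[𝓝 0] fun _ => f x := by
    filter_upwards [hcx.eventually hc, hct.eventually (φ.open_target.mem_nhds (φ.map_source hx))]
      with t ht htt
    refine ht (ψ.injOn (hm (φ.map_target htt)) (hm hx) ?_)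
    rw [hw _ htt]
    have := hw (φ x) (φ.map_source hx)
    rw [φ.left_inv hx] at this
    rw [this]
    simp [hew]
  have hs0 : MDifferentiableAt 𝓘(ℝ, E) 𝓘(ℝ, E) φ.symm (φ x + (0 : ℝ) • w) := by
    rw [hl0]
    exact (chart_smooth hφ).2.mdifferentiableAt_of_mem φ.open_target (φ.map_source hx)
  have hld : MDifferentiableAt 𝓘(ℝ, ℝ) 𝓘(ℝ, E) (fun t : ℝ => φ x + t • w) 0 :=
    hl.differentiableAt.mdifferentiableAt
  have hcd : der ℝ E c 0 1 = v := by
    have := der_comp_apply (j := φ.symm) (i := fun t : ℝ => φ x + t • w) (x := (0 : ℝ)) hs0 hld 1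
    rw [der_eq_fderiv, hl0] at this
    have h3 : fderiv ℝ (fun t : ℝ => φ x + t • w) 0 1 = w := by
      rw [fderiv_apply_one_eq_deriv, hl.deriv]
    rw [h3, chart_der_symm_apply hφ hx] at this
    exact this
  have hc0 : c 0 = x := by simp [hc', φ.left_inv hx]
  have h4 := der_comp_apply (j := f) (i := c) (x := (0 : ℝ)) (by rwa [hc0])
    (hs0.comp (0 : ℝ) hld) 1
  rw [hcd, hc0, der_congr hev, der_const] at h4
  exact h4.symm

end Submersion

/-! ### Local structure of embedded submanifolds -/

section Embedding

universe u

variable {E : Type*} [NormedAddCommGroup E] [NormedSpace ℝ E]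
  {M : Type*} [TopologicalSpace M] [ChartedSpace E M]
  {F : Type*} [NormedAddCommGroup F] [NormedSpace ℝ F]
  {O : Type*} [TopologicalSpace O] [ChartedSpace F O]
  {G : Type u} [NormedAddCommGroup G] [NormedSpace ℝ G]
  {N : Type*} [TopologicalSpace N] [ChartedSpace G N]
  {i : O → N}

/-- Near a point of an embedded submanifold, a map `r` that retracts to the submanifold (in its
intrinsic coordinates) and a submersion `Φ` whose zero set is the submanifold. -/
structure SliceData {W : Type*} [NormedAddCommGroup W] [NormedSpace ℝ W] (F G : Type*)
    [NormedAddCommGroup F] [NormedSpace ℝ F] [NormedAddCommGroup G] [NormedSpace ℝ G]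
    {O : Type*} [TopologicalSpace O] [ChartedSpace F O]
    {N : Type*} [TopologicalSpace N] [ChartedSpace G N]
    (i : O → N) (a : O) (U : Set N) (r : N → O) (Φ : N → W) : Prop where
  isOpen : IsOpen U
  mem : i a ∈ U
  smooth_r : ContMDiffOn 𝓘(ℝ, G) 𝓘(ℝ, F) ∞ r U
  smooth_Φ : ContMDiffOn 𝓘(ℝ, G) 𝓘(ℝ, W) ∞ Φ U
  leftInv : ∀ b, i b ∈ U → r (i b) = b
  mem_range_iff : ∀ y ∈ U, y ∈ range i ↔ Φ y = 0
  surjective : Function.Surjective (der G W Φ (i a))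
  ker : ∀ v, der G W Φ (i a) v = 0 → der F G i a (der G F r (i a) v) = v

variable {W : Type*} [NormedAddCommGroup W] [NormedSpace ℝ W] {a : O} {U : Set N} {r : N → O}
  {Φ : N → W}

/-- In the normal form `ψ (i b) = e (φ b, 0)` of an immersion, the first component of `e⁻¹ ∘ ψ`
gives the retraction and the second the defining map. -/
theorem isImmersionAtOfComplement_exists_sliceData
    (h : Manifold.IsImmersionAtOfComplement W 𝓘(ℝ, F) 𝓘(ℝ, G) ∞ i a)
    (hi : Topology.IsEmbedding i) :
    ∃ (U : Set N) (r : N → O) (Φ : N → W), SliceData F G i a U r Φ := by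
  set φ := h.domChart with hφdef
  set ψ := h.codChart with hψdef
  set e := h.equiv
  have hφ : φ ∈ IsManifold.maximalAtlas 𝓘(ℝ, F) ∞ O := h.domChart_mem_maximalAtlas
  have hψ : ψ ∈ IsManifold.maximalAtlas 𝓘(ℝ, G) ∞ N := h.codChart_mem_maximalAtlas
  have ha : a ∈ φ.source := h.mem_domChart_source
  have hm : MapsTo i φ.source ψ.source := h.source_subset_preimage_source
  have hw : ∀ b ∈ φ.source, ψ (i b) = e (φ b, 0) := by
    intro b hb
    have hz' : φ b ∈ (φ.extend 𝓘(ℝ, F)).target := by simpa using φ.map_source hb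
    have := h.writtenInCharts hz'
    simpa [← hφdef, ← hψdef, φ.left_inv hb] using this
  -- This is where `i` must be an embedding: `U₀` meets the image of `i` only in points coming from
  -- the chart domain, so no other sheet of `O` enters.
  obtain ⟨U₀, hU₀, hUφ⟩ := hi.isInducing.isOpen_iff.1 φ.open_source
  set j : G → F := fun w => (e.symm w).1 with hj
  have hjc : ContDiff ℝ ∞ j := by fun_prop
  set p : G → W := fun w => (e.symm w).2 with hp
  have hpc : ContDiff ℝ ∞ p := by fun_prop
  set U := (ψ.source ∩ ψ ⁻¹' (j ⁻¹' φ.target)) ∩ U₀ with hU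
  have hUo : IsOpen U := (ψ.isOpen_inter_preimage (φ.open_target.preimage hjc.continuous)).inter hU₀
  have haU : i a ∈ U := by
    refine ⟨⟨hm ha, ?_⟩, ?_⟩
    · simp [hj, hw a ha, φ.map_source ha]
    · rw [← mem_preimage, hUφ]; exact ha
  have hsub : ∀ b, i b ∈ U → b ∈ φ.source := fun b hb => by rw [← hUφ]; exact hb.2
  set r : N → O := fun y => φ.symm (j (ψ y)) with hr
  set Φ : N → W := fun y => p (ψ y) with hΦ
  have hrs : ContMDiffOn 𝓘(ℝ, G) 𝓘(ℝ, F) ∞ r U :=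
    (chart_smooth hφ).2.comp (hjc.contMDiff.comp_contMDiffOn
      ((chart_smooth hψ).1.mono fun y hy => hy.1.1)) fun y hy => hy.1.2
  have hΦs : ContMDiffOn 𝓘(ℝ, G) 𝓘(ℝ, W) ∞ Φ U :=
    hpc.contMDiff.comp_contMDiffOn ((chart_smooth hψ).1.mono fun y hy => hy.1.1)
  have hri : ∀ b, i b ∈ U → r (i b) = b := by
    intro b hb
    have hb' := hsub b hb
    simp [hr, hj, hw b hb', φ.left_inv hb']
  have hmem : ∀ y ∈ U, y ∈ range i ↔ Φ y = 0 := by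
    intro y hy
    constructor
    · rintro ⟨b, rfl⟩
      simp [hΦ, hp, hw b (hsub b hy)]
    · intro h0
      refine ⟨r y, ψ.injOn (hm (φ.map_target hy.1.2)) hy.1.1 ?_⟩
      rw [hw _ (φ.map_target hy.1.2), φ.right_inv hy.1.2]
      apply e.symm.injective
      rw [e.symm_apply_apply]
      exact Prod.ext rfl h0.symm
  have hψa := (chart_smooth hψ).1.mdifferentiableAt_of_mem ψ.open_source (hm ha)
  have hψs := (chart_smooth hψ).2.mdifferentiableAt_of_mem ψ.open_target (ψ.map_source (hm ha))
  have hia : MDifferentiableAt 𝓘(ℝ, F) 𝓘(ℝ, G) i a := h.contMDiffAt.mdifferentiableAt (by simp)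
  have hra := hrs.mdifferentiableAt_of_mem hUo haU
  have hΦa := hΦs.mdifferentiableAt_of_mem hUo haU
  have hφa := (chart_smooth hφ).1.mdifferentiableAt_of_mem φ.open_source ha
  have hev : ∀ᶠ b in 𝓝 a, i b ∈ U := hi.continuous.continuousAt.eventually (hUo.mem_nhds haU)
  set jl : G →L[ℝ] F := (ContinuousLinearMap.fst ℝ F W).comp e.symm.toContinuousLinearMap
  set pl : G →L[ℝ] W := (ContinuousLinearMap.snd ℝ F W).comp e.symm.toContinuousLinearMap
  have hdΦ : ∀ v, der G W Φ (i a) v = (e.symm (der G G ψ (i a) v)).2 := by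
    intro v
    have := der_comp_apply (j := pl) (i := ψ) (x := i a)
      (ContinuousLinearMap.differentiableAt _).mdifferentiableAt hψa v
    rw [der_clm] at this
    exact this
  have hdr : ∀ v, der F F φ a (der G F r (i a) v) = (e.symm (der G G ψ (i a) v)).1 := by
    intro v
    have h1 := der_comp_apply (j := jl) (i := ψ) (x := i a)
      (ContinuousLinearMap.differentiableAt _).mdifferentiableAt hψa v
    have h2 := der_comp_apply (j := φ) (i := r) (x := i a) (by rwa [hri a haU]) hra v
    rw [hri a haU] at h2
    rw [der_clm] at h1
    rw [← h2, der_congr (j := jl ∘ ψ), h1]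
    · rfl
    · filter_upwards [hUo.mem_nhds haU] with y hy
      simp only [Function.comp_apply, hr]
      rw [φ.right_inv hy.1.2]
      rfl
  refine ⟨U, r, Φ, hUo, haU, hrs, hΦs, hri, hmem, ?_, ?_⟩
  · intro c
    refine ⟨der G G ψ.symm (ψ (i a)) (e (0, c)), ?_⟩
    have h1 := der_comp_apply (j := ψ) (i := ψ.symm) (x := ψ (i a))
      (by rwa [ψ.left_inv (hm ha)]) hψs (e (0, c))
    rw [ψ.left_inv (hm ha), der_congr (j := id), der_id] at h1
    · rw [hdΦ, ← h1]
      simp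
    · filter_upwards [ψ.open_target.mem_nhds (ψ.map_source (hm ha))] with y hy
        using ψ.right_inv hy
  · intro v hv
    have hΦi : der G W Φ (i a) (der F G i a (der G F r (i a) v)) = 0 := by
      rw [← der_comp_apply hΦa hia, der_congr (j := fun _ => (0 : W)), der_const]
      · rfl
      · filter_upwards [hev] with b hb using (hmem _ hb).1 ⟨b, rfl⟩
    have hri' : der G F r (i a) (der F G i a (der G F r (i a) v)) = der G F r (i a) v := by
      rw [← der_comp_apply hra hia, der_congr (j := id), der_id]
      · rfl
      · filter_upwards [hev] with b hb using hri b hb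
    -- Both components under `e⁻¹` agree: the first because `r ∘ i = id`, the second because both
    -- sides are killed by the derivative of `Φ`.
    have h1 : der G G ψ (i a) (der F G i a (der G F r (i a) v)) = der G G ψ (i a) v := by
      apply e.symm.injective
      refine Prod.ext ?_ ?_
      · rw [← hdr, ← hdr, hri']
      · rw [← hdΦ, ← hdΦ, hΦi, hv]
    rw [← chart_der_symm_apply hψ (hm ha) v, ← h1, chart_der_symm_apply hψ (hm ha), hri']

theorem embedding_exists_sliceData (hi : Manifold.IsSmoothEmbedding 𝓘(ℝ, F) 𝓘(ℝ, G) ∞ i) :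
    ∃ (W : Type u) (_ : NormedAddCommGroup W) (_ : NormedSpace ℝ W),
      ∀ a : O, ∃ (U : Set N) (r : N → O) (Φ : N → W), SliceData F G i a U r Φ :=
  ⟨hi.isImmersion.complement, inferInstance, inferInstance, fun a =>
    isImmersionAtOfComplement_exists_sliceData
      (hi.isImmersion.isImmersionOfComplement_complement a) hi.isEmbedding⟩

namespace SliceData

theorem mdifferentiableAt_r (h : SliceData F G i a U r Φ) :
    MDifferentiableAt 𝓘(ℝ, G) 𝓘(ℝ, F) r (i a) :=
  h.smooth_r.mdifferentiableAt_of_mem h.isOpen h.mem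

theorem r_apply (h : SliceData F G i a U r Φ) : r (i a) = a := h.leftInv a h.mem

theorem der_r_der_of_mem (h : SliceData F G i a U r Φ) (hi : ContMDiff 𝓘(ℝ, F) 𝓘(ℝ, G) ∞ i)
    {b : O} (hb : i b ∈ U) (v : F) : der G F r (i b) (der F G i b v) = v := by
  rw [← der_comp_apply (h.smooth_r.mdifferentiableAt_of_mem h.isOpen hb)
    (hi.mdifferentiableAt (by simp)), der_congr (j := id), der_id]
  · rfl
  · filter_upwards [hi.continuous.continuousAt.eventually (h.isOpen.mem_nhds hb)] with b hb
      using h.leftInv b hb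

theorem der_r_der (h : SliceData F G i a U r Φ) (hi : ContMDiff 𝓘(ℝ, F) 𝓘(ℝ, G) ∞ i) (v : F) :
    der G F r (i a) (der F G i a v) = v :=
  h.der_r_der_of_mem hi h.mem v

theorem der_Φ_der (h : SliceData F G i a U r Φ) (hi : ContMDiff 𝓘(ℝ, F) 𝓘(ℝ, G) ∞ i) (v : F) :
    der G W Φ (i a) (der F G i a v) = 0 := by
  rw [← der_comp_apply (h.smooth_Φ.mdifferentiableAt_of_mem h.isOpen h.mem)
    (hi.mdifferentiableAt (by simp)), der_congr (j := fun _ => (0 : W)), der_const]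
  · rfl
  · filter_upwards [hi.continuous.continuousAt.eventually (h.isOpen.mem_nhds h.mem)] with b hb
      using (h.mem_range_iff _ hb).1 ⟨b, rfl⟩

/-- A differentiable curve in an embedded submanifold is differentiable in the submanifold. -/
theorem hasMFDerivWithinAt_lift {c : ℝ → O} {s : Set ℝ} {t : ℝ} {w : G}
    (h : SliceData F G i (c t) U r Φ)
    (hc : HasMFDerivWithinAt 𝓘(ℝ, ℝ) 𝓘(ℝ, G) (i ∘ c) s t
      ((1 : ℝ →L[ℝ] ℝ).smulRight w : ℝ →L[ℝ] G)) :
    HasMFDerivWithinAt 𝓘(ℝ, ℝ) 𝓘(ℝ, F) c s t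
      ((1 : ℝ →L[ℝ] ℝ).smulRight (der G F r (i (c t)) w) : ℝ →L[ℝ] F) := by
  refine (hasMFDerivWithinAt_comp_curve (c := i ∘ c) h.mdifferentiableAt_r hc).congr_of_eventuallyEq
    ?_ (h.leftInv _ h.mem).symm
  filter_upwards [hc.continuousWithinAt.eventually (h.isOpen.mem_nhds h.mem)] with t' ht'
    using (h.leftInv _ ht').symm

end SliceData

theorem embedding_der_injective (hi : Manifold.IsSmoothEmbedding 𝓘(ℝ, F) 𝓘(ℝ, G) ∞ i) (a : O) :
    Function.Injective (der F G i a) := by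
  obtain ⟨W, _, _, hW⟩ := embedding_exists_sliceData hi
  obtain ⟨U, r, Φ, h⟩ := hW a
  exact Function.LeftInverse.injective (h.der_r_der hi.contMDiff)

/-- A curve in an embedded submanifold is tangent to it. -/
theorem embedding_der_curve_mem_range (hi : Manifold.IsSmoothEmbedding 𝓘(ℝ, F) 𝓘(ℝ, G) ∞ i)
    {c : ℝ → N} {t : ℝ} (hc : MDifferentiableAt 𝓘(ℝ, ℝ) 𝓘(ℝ, G) c t)
    (hr : ∀ᶠ s in 𝓝 t, c s ∈ range i) {a : O} (ha : i a = c t) :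
    ∃ w : F, der F G i a w = der ℝ G c t 1 := by
  obtain ⟨W, _, _, hW⟩ := embedding_exists_sliceData hi
  obtain ⟨U, r, Φ, h⟩ := hW a
  refine ⟨_, h.ker _ ?_⟩
  have hΦ := h.smooth_Φ.mdifferentiableAt_of_mem h.isOpen h.mem
  rw [ha] at hΦ
  rw [ha, ← der_comp_apply hΦ hc, der_congr (j := fun _ => (0 : W)), der_const]
  · rfl
  · have hU : ∀ᶠ s in 𝓝 t, c s ∈ U :=
      hc.continuousAt.eventually (h.isOpen.mem_nhds (by rw [← ha]; exact h.mem))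
    filter_upwards [hr, hU] with s hs hsU using (h.mem_range_iff _ hsU).1 hs

end Embedding

/-! ### Flows, orbits and related vector fields -/

section Orbits

variable {g : Type*} [LieRing g] [LieAlgebra ℝ g]
  {E : Type*} [NormedAddCommGroup E] [NormedSpace ℝ E]
  {M : Type*} [TopologicalSpace M] [ChartedSpace E M] [IsManifold 𝓘(ℝ, E) ∞ M]
  {A : Action g E M} {h : Submodule ℝ g}

theorem Action.isSmoothFun_lieDeriv (A : Action g E M) (u : g) {f : M → ℝ}
    (hf : IsSmoothFun E f) : IsSmoothFun E (A.lieDeriv u f) :=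
  contMDiff_diff_apply hf (A.smooth u)

theorem Action.lieDeriv_lie [CompleteSpace E] (A : Action g E M) (u v : g) {f : M → ℝ}
    (hf : IsSmoothFun E f) (x : M) :
    A.lieDeriv ⁅u, v⁆ f x = A.lieDeriv u (A.lieDeriv v f) x - A.lieDeriv v (A.lieDeriv u f) x := by
  have := diff_mlieBracket hf (A.smooth u) (A.smooth v) x
  rw [A.map_lie] at this
  exact this

theorem Action.flowsTo_of_isMIntegralCurveOn {u : g} (hu : u ∈ h) {c : ℝ → M} {s : Set ℝ} {t : ℝ}
    (hc : IsMIntegralCurveOn c (fun z => A.ρ z u) s) (ht : ∀ τ ∈ Icc (0 : ℝ) 1, τ * t ∈ s) :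
    A.FlowsTo h (c 0) (c t) := by
  -- Running the curve at speed `t` replaces `u` by `t • u` and reaches `c t` at time one.
  refine ⟨t • u, h.smul_mem t hu, c ∘ (· * t), by simp, by simp, ?_⟩
  have h1 := (hc.comp_mul t).mono (s' := Icc 0 1) ht
  convert h1 using 1
  funext z
  simp

/-- Through every point there is a curve in the orbit with velocity `ρ(u)`. -/
theorem Action.exists_curve [CompleteSpace E] [T2Space M] (A : Action g E M) {u : g} (hu : u ∈ h)
    (x : M) : ∃ c : ℝ → M, c 0 = x ∧ MDifferentiableAt 𝓘(ℝ, ℝ) 𝓘(ℝ, E) c 0 ∧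
      der ℝ E c 0 1 = A.ρ x u ∧ ∀ᶠ t in 𝓝 0, A.FlowsTo h x (c t) := by
  have : IsManifold 𝓘(ℝ, E) 1 M := IsManifold.of_le (n := ∞) ENat.LEInfty.out
  obtain ⟨c, hc0, hc⟩ := exists_isMIntegralCurveAt_of_contMDiffAt_boundaryless (t₀ := 0)
    (((A.smooth u).of_le ENat.LEInfty.out : ContMDiff 𝓘(ℝ, E) 𝓘(ℝ, E).tangent 1 _) x)
  refine ⟨c, hc0, hc.hasMFDerivAt.mdifferentiableAt, ?_, ?_⟩
  · unfold der
    rw [hc.hasMFDerivAt.mfderiv]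
    subst hc0
    exact (one_smul ℝ (show E from A.ρ (c 0) u))
  · obtain ⟨ε, hε, hcε⟩ := isMIntegralCurveAt_iff'.1 hc
    filter_upwards [Metric.ball_mem_nhds 0 hε] with t ht
    rw [← hc0]
    refine Action.flowsTo_of_isMIntegralCurveOn hu hcε fun τ hτ => ?_
    rw [Metric.mem_ball, dist_zero_right, norm_mul, Real.norm_of_nonneg hτ.1]
    rw [Metric.mem_ball, dist_zero_right] at ht
    nlinarith [hτ.2, norm_nonneg t]

/-- A map that is constant on orbits kills the vector fields `ρ(u)`. -/
theorem Action.der_eq_zero_of_flowsTo [CompleteSpace E] [T2Space M]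
    {F : Type*} [NormedAddCommGroup F] [NormedSpace ℝ F]
    {N : Type*} [TopologicalSpace N] [ChartedSpace F N] {f : M → N}
    (hf : ContMDiff 𝓘(ℝ, E) 𝓘(ℝ, F) ∞ f)
    (hc : ∀ x y, A.FlowsTo h x y → f x = f y) {u : g} (hu : u ∈ h) (x : M) :
    der E F f x (A.ρ x u) = 0 := by
  obtain ⟨c, hc0, hcd, hcu, hcf⟩ := A.exists_curve hu x
  have h1 := der_comp_apply (j := f) (i := c) (x := (0 : ℝ))
    (hf.mdifferentiableAt (by simp)) hcd 1
  rw [hcu, hc0, der_congr (j := fun _ => f x), der_const] at h1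
  · exact h1.symm
  · filter_upwards [hcf] with t ht using (hc _ _ ht).symm

variable {k : Type*} [LieRing k] [LieAlgebra ℝ k]
  {F : Type*} [NormedAddCommGroup F] [NormedSpace ℝ F]
  {N : Type*} [TopologicalSpace N] [ChartedSpace F N] [IsManifold 𝓘(ℝ, F) ∞ N]
  {B : Action k F N} {h' : Submodule ℝ k}

theorem Action.FlowsTo.map {f : M → N} (hf : ContMDiff 𝓘(ℝ, E) 𝓘(ℝ, F) ∞ f)
    (hr : ∀ u ∈ h, ∃ w ∈ h', Related A B f u w) {x y : M} (hxy : A.FlowsTo h x y) :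
    B.FlowsTo h' (f x) (f y) := by
  obtain ⟨u, hu, c, rfl, rfl, hc⟩ := hxy
  obtain ⟨w, hw, huw⟩ := hr u hu
  refine ⟨w, hw, f ∘ c, rfl, rfl, fun t ht => ?_⟩
  have h1 := hasMFDerivWithinAt_comp_curve (f := f)
    (hf.mdifferentiableAt (x := c t) (by simp)) (hc t ht)
  have h2 : der E F f (c t) (A.ρ (c t) u) = B.ρ (f (c t)) w := huw (c t)
  rw [h2] at h1
  exact h1

theorem Action.SameOrbit.map {f : M → N} (hf : ContMDiff 𝓘(ℝ, E) 𝓘(ℝ, F) ∞ f)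
    (hr : ∀ u ∈ h, ∃ w ∈ h', Related A B f u w) {x y : M} (hxy : A.SameOrbit h x y) :
    B.SameOrbit h' (f x) (f y) := by
  induction hxy with
  | rel x y hxy => exact .rel _ _ (hxy.map hf hr)
  | refl x => exact .refl _
  | symm x y _ ih => exact .symm _ _ ih
  | trans x y z _ _ h1 h2 => exact .trans _ _ _ h1 h2

/-- A function killed by the vector fields `ρ(u)`, `u ∈ h`, is constant on the `h`-orbits. -/
theorem Action.SameOrbit.eq_of_lieDeriv_eq_zero {f : M → ℝ} (hf : IsSmoothFun E f)
    (h0 : ∀ u ∈ h, A.lieDeriv u f = 0) {x y : M} (hxy : A.SameOrbit h x y) : f x = f y := by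
  induction hxy with
  | rel x y hxy =>
    obtain ⟨u, hu, c, rfl, rfl, hc⟩ := hxy
    have h1 : ∀ t ∈ Icc (0 : ℝ) 1, HasDerivWithinAt (f ∘ c) 0 (Icc 0 1) t := by
      intro t ht
      have h2 : HasFDerivWithinAt (f ∘ c) ((1 : ℝ →L[ℝ] ℝ).smulRight
          (der E ℝ f (c t) (A.ρ (c t) u)) : ℝ →L[ℝ] ℝ) (Icc 0 1) t :=
        (hasMFDerivWithinAt_comp_curve (hf.mdifferentiableAt (c t)) (hc t ht)).hasFDerivWithinAt
      have h3 : der E ℝ f (c t) (A.ρ (c t) u) = 0 := congrFun (h0 u hu) (c t)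
      rw [h3] at h2
      simpa using h2.hasDerivWithinAt
    have := (convex_Icc (0 : ℝ) 1).is_const_of_fderivWithin_eq_zero (𝕜 := ℝ) (f := f ∘ c)
      (fun t ht => (h1 t ht).differentiableWithinAt) (fun t ht => by
        have := (h1 t ht).hasFDerivWithinAt.fderivWithin ((uniqueDiffOn_Icc one_pos) t ht)
        rw [this]; ext; simp) (left_mem_Icc.2 zero_le_one) (right_mem_Icc.2 zero_le_one)
    exact this
  | refl x => rfl
  | symm x y _ ih => exact ih.symm
  | trans x y z _ _ h1 h2 => exact h1.trans h2

end Orbits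

/-! ### Actions on orbit quotients -/

section Descent

variable {k : Type*} [LieRing k] [LieAlgebra ℝ k] {h : LieIdeal ℝ k}
  {E : Type*} [NormedAddCommGroup E] [NormedSpace ℝ E] [FiniteDimensional ℝ E]
  {M : Type*} [TopologicalSpace M] [T2Space M] [ChartedSpace E M] [IsManifold 𝓘(ℝ, E) ∞ M]
  {F : Type*} [NormedAddCommGroup F] [NormedSpace ℝ F] [FiniteDimensional ℝ F]
  {Q : Type*} [TopologicalSpace Q] [T2Space Q] [ChartedSpace F Q] [IsManifold 𝓘(ℝ, F) ∞ Q]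
  {A : Action k E M} {q : M → Q}

namespace IsOrbitQuotient

omit [FiniteDimensional ℝ E] [T2Space M] [FiniteDimensional ℝ F] [T2Space Q]
  [IsManifold 𝓘(ℝ, F) ∞ Q] in
theorem contMDiff {s : Submodule ℝ k} (hq : IsOrbitQuotient (E₁ := E) (E₂ := F) A s id q) :
    ContMDiff 𝓘(ℝ, E) 𝓘(ℝ, F) ∞ q := hq.submersion.contMDiff

omit [FiniteDimensional ℝ F] [T2Space Q] [IsManifold 𝓘(ℝ, F) ∞ Q] in
theorem der_eq_zero {s : Submodule ℝ k} (hq : IsOrbitQuotient (E₁ := E) (E₂ := F) A s id q)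
    {u : k} (hu : u ∈ s) (x : M) : der E F q x (A.ρ x u) = 0 := by
  have := FiniteDimensional.complete ℝ E
  exact Action.der_eq_zero_of_flowsTo hq.contMDiff
    (fun x y hxy => (hq.fibres x y).2 (.rel _ _ hxy)) hu x

omit [FiniteDimensional ℝ E] [T2Space M] [FiniteDimensional ℝ F] [T2Space Q]
  [IsManifold 𝓘(ℝ, F) ∞ Q] in
theorem lieDeriv_comp {s : Submodule ℝ k} (hq : IsOrbitQuotient (E₁ := E) (E₂ := F) A s id q)
    {f : Q → ℝ} (hf : IsSmoothFun F f) (u : k) (x : M) :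
    A.lieDeriv u (f ∘ q) x = der F ℝ f (q x) (der E F q x (A.ρ x u)) :=
  der_comp_apply (hf.mdifferentiableAt _) (hq.contMDiff.mdifferentiableAt (by simp)) _

omit [FiniteDimensional ℝ F] [T2Space Q] [IsManifold 𝓘(ℝ, F) ∞ Q] in
theorem lieDeriv_eq_zero {s : Submodule ℝ k}
    (hq : IsOrbitQuotient (E₁ := E) (E₂ := F) A s id q)
    {f : Q → ℝ} (hf : IsSmoothFun F f) {u : k} (hu : u ∈ s) : A.lieDeriv u (f ∘ q) = 0 := by
  funext x
  rw [hq.lieDeriv_comp hf, hq.der_eq_zero hu, map_zero]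
  rfl

/-- The projections to the quotient of the vector fields `ρ(u)` are constant on fibres. -/
theorem der_ρ_eq (hq : IsOrbitQuotient (E₁ := E) (E₂ := F) A h.toSubmodule id q) (u : k)
    {x x' : M} (hx : q x = q x') :
    der E F q x (A.ρ x u) = der E F q x' (A.ρ x' u) := by
  have := FiniteDimensional.complete ℝ E
  refine eq_of_forall_diff_eq (x := q x) fun f hf => ?_
  have hfq : IsSmoothFun E (f ∘ q) := hf.comp hq.contMDiff
  -- For `v` in `h`, `ρ(v) ρ(u) = ρ(⁅v, u⁆) + ρ(u) ρ(v)`, and both terms kill `f ∘ q` because `⁅v,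
  -- u⁆` again lies in the ideal. So `ρ(u) (f ∘ q)` is constant on fibres.
  have h0 : ∀ v ∈ h.toSubmodule, A.lieDeriv v (A.lieDeriv u (f ∘ q)) = 0 := by
    intro v hv
    funext y
    have h1 := A.lieDeriv_lie v u hfq y
    rw [hq.lieDeriv_eq_zero hf (lie_mem_left ℝ k h v u hv), hq.lieDeriv_eq_zero hf hv] at h1
    have h2 : A.lieDeriv u 0 y = 0 := by
      have : diff E (0 : M → ℝ) y = 0 := der_const y (0 : ℝ)
      simp [Action.lieDeriv, this]
    rw [h2] at h1
    simpa using h1.symm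
  have h1 := ((hq.fibres x x').1 hx).eq_of_lieDeriv_eq_zero (A.isSmoothFun_lieDeriv u hfq) h0
  simp only [id] at h1
  rw [hq.lieDeriv_comp hf, hq.lieDeriv_comp hf, ← hx] at h1
  exact h1

/-- An action of `k` descends to an action of `k / h` on the quotient by the ideal `h`. -/
theorem exists_action (hq : IsOrbitQuotient (E₁ := E) (E₂ := F) A h.toSubmodule id q) :
    ∃ B : Action (k ⧸ h) F Q, ∀ u : k, Related A B q u (LieSubmodule.Quotient.mk u) := by
  have := FiniteDimensional.complete ℝ E
  -- A section of sets only: by `der_ρ_eq` the projected field does not depend on it.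
  set σ := Function.surjInv hq.surjective
  have hσ : ∀ y, q (σ y) = y := Function.surjInv_eq hq.surjective
  let φ : Q → (k ⧸ h) →ₗ[ℝ] F := fun y =>
    h.toSubmodule.liftQ ((der E F q (σ y)).toLinearMap ∘ₗ A.ρ (σ y))
      fun u hu => hq.der_eq_zero hu (σ y)
  have hφ : ∀ (x : M) (u : k),
      φ (q x) (LieSubmodule.Quotient.mk u) = der E F q x (A.ρ x u) := fun x u =>
    hq.der_ρ_eq u (hσ (q x))
  have hs : ∀ w : k ⧸ h, ContMDiff 𝓘(ℝ, F) 𝓘(ℝ, F).tangent ∞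
      (fun y => (⟨y, φ y w⟩ : TangentBundle 𝓘(ℝ, F) Q)) := by
    intro w
    obtain ⟨u, rfl⟩ := LieSubmodule.Quotient.surjective_mk' h w
    -- After composition with `q` the field becomes the tangent map of `q` applied to `ρ(u)`, which
    -- is smooth.
    refine submersion_descend_contMDiff hq.submersion hq.surjective ?_
    have h1 := (hq.contMDiff.contMDiff_tangentMap (m := ∞) (by simp)).comp (A.smooth u)
    convert h1 using 1
    funext x
    exact congrArg (fun v : F => (⟨q x, v⟩ : TangentBundle 𝓘(ℝ, F) Q)) (hφ x u)
  refine ⟨⟨φ, hs, ?_⟩, fun u x => (hφ x u).symm⟩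
  intro w w' y
  obtain ⟨u, rfl⟩ := LieSubmodule.Quotient.surjective_mk' h w
  obtain ⟨u', rfl⟩ := LieSubmodule.Quotient.surjective_mk' h w'
  obtain ⟨x, rfl⟩ := hq.surjective y
  have h1 := mlieBracket_related hq.contMDiff (A.smooth u) (A.smooth u')
    (hs (LieSubmodule.Quotient.mk u)) (hs (LieSubmodule.Quotient.mk u'))
    (fun x => (hφ x u).symm) (fun x => (hφ x u').symm) x
  rw [A.map_lie] at h1
  exact h1.symm.trans (hφ x ⁅u, u'⁆).symm

end IsOrbitQuotient

end Descent

/-! ### Actions and orbits on embedded submanifolds -/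

section Restriction

variable {k : Type*} [LieRing k] [LieAlgebra ℝ k]
  {F : Type*} [NormedAddCommGroup F] [NormedSpace ℝ F] [FiniteDimensional ℝ F]
  {O : Type*} [TopologicalSpace O] [ChartedSpace F O] [IsManifold 𝓘(ℝ, F) ∞ O]
  {G : Type*} [NormedAddCommGroup G] [NormedSpace ℝ G] [FiniteDimensional ℝ G]
  {N : Type*} [TopologicalSpace N] [T2Space N] [ChartedSpace G N] [IsManifold 𝓘(ℝ, G) ∞ N]
  {i : O → N}

/-- An action whose vector fields are tangent to an embedded submanifold restricts to it. -/
theorem Action.exists_restrict (B : Action k G N)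
    (hi : Manifold.IsSmoothEmbedding 𝓘(ℝ, F) 𝓘(ℝ, G) ∞ i)
    (ht : ∀ (a : O) (u : k), ∃ w : F, der F G i a w = B.ρ (i a) u) :
    ∃ A : Action k F O, ∀ u : k, Related A B i u u := by
  have := FiniteDimensional.complete ℝ F
  have hinj := embedding_der_injective hi
  have hL : ∀ a : O, ∃ L : G →ₗ[ℝ] F, L ∘ₗ (der F G i a).toLinearMap = LinearMap.id := fun a =>
    LinearMap.exists_leftInverse_of_injective _ (LinearMap.ker_eq_bot.2 (hinj a))
  choose L hL using hL
  have hL' : ∀ a w, L a (der F G i a w) = w := fun a w => LinearMap.congr_fun (hL a) w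
  let φ : O → k →ₗ[ℝ] F := fun a => L a ∘ₗ (B.ρ (i a) : k →ₗ[ℝ] G)
  have hφ : ∀ a u, der F G i a (φ a u) = B.ρ (i a) u := by
    intro a u
    obtain ⟨w, hw⟩ := ht a u
    have : φ a u = L a (der F G i a w) := congrArg (L a) hw.symm
    rw [this, hL', hw]
  have hs : ∀ u : k, ContMDiff 𝓘(ℝ, F) 𝓘(ℝ, F).tangent ∞
      (fun a => (⟨a, φ a u⟩ : TangentBundle 𝓘(ℝ, F) O)) := by
    intro u a
    obtain ⟨W, _, _, hW⟩ := embedding_exists_sliceData hi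
    obtain ⟨U, r, Φ, h⟩ := hW a
    have h1 := h.smooth_r.contMDiffOn_tangentMapWithin (m := ∞) (by simp) h.isOpen.uniqueMDiffOn
    have h2 : ContMDiffOn 𝓘(ℝ, F) 𝓘(ℝ, G).tangent ∞
        (fun b => (⟨i b, B.ρ (i b) u⟩ : TangentBundle 𝓘(ℝ, G) N)) (i ⁻¹' U) :=
      ((B.smooth u).comp hi.contMDiff).contMDiffOn
    have h3 := h1.comp h2 fun b hb => hb
    have hU : i ⁻¹' U ∈ 𝓝 a := hi.contMDiff.continuous.continuousAt (h.isOpen.mem_nhds h.mem)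
    refine (h3.contMDiffAt hU).congr_of_eventuallyEq ?_
    filter_upwards [hU] with b hb
    have h4 : mfderivWithin 𝓘(ℝ, G) 𝓘(ℝ, F) r U (i b) = mfderiv 𝓘(ℝ, G) 𝓘(ℝ, F) r (i b) :=
      mfderivWithin_of_isOpen h.isOpen hb
    -- Although `L` was chosen point by point, near `a` the restricted field is the image of the
    -- ambient one under the derivative of the smooth retraction.
    have h5 : der G F r (i b) (B.ρ (i b) u) = φ b u := by
      rw [← hφ, h.der_r_der_of_mem hi.contMDiff hb]
    simp only [Function.comp_apply, tangentMapWithin, h4]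
    refine Bundle.TotalSpace.ext (h.leftInv b hb).symm ?_
    exact heq_of_eq h5.symm
  refine ⟨⟨φ, hs, ?_⟩, fun u a => hφ a u⟩
  intro u v a
  apply hinj a
  have h1 := mlieBracket_related hi.contMDiff (hs u) (hs v) (B.smooth u) (B.smooth v)
    (fun x => hφ x u) (fun x => hφ x v) a
  rw [B.map_lie] at h1
  exact h1.trans (hφ a ⁅u, v⁆).symm

variable {g : Type*} [LieRing g] [LieAlgebra ℝ g] {A : Action k F O} {B : Action g G N}
  {h : Submodule ℝ k} {h' : Submodule ℝ g}

omit [FiniteDimensional ℝ F] [FiniteDimensional ℝ G] [T2Space N] in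
/-- Flows on an invariant submanifold of the ambient manifold are flows of the submanifold. -/
theorem Action.FlowsTo.lift (hi : Manifold.IsSmoothEmbedding 𝓘(ℝ, F) 𝓘(ℝ, G) ∞ i)
    (hr : ∀ w ∈ h', ∃ u ∈ h, Related A B i u w)
    (hinv : B.IsInvariantSet h' (range i)) {a b : O} (hab : B.FlowsTo h' (i a) (i b)) :
    A.FlowsTo h a b := by
  obtain ⟨w, hw, c, hc0, hc1, hc⟩ := hab
  obtain ⟨u, hu, huw⟩ := hr w hw
  -- Each initial segment of the curve is itself a flow, so invariance keeps the whole curve in the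
  -- submanifold.
  have hmem : ∀ t ∈ Icc (0 : ℝ) 1, c t ∈ range i := by
    intro t ht
    refine hinv (c 0) (c t) (.rel _ _ ?_) ⟨a, hc0.symm⟩
    exact Action.flowsTo_of_isMIntegralCurveOn hw hc fun τ hτ =>
      ⟨mul_nonneg hτ.1 ht.1, mul_le_one₀ hτ.2 ht.1 ht.2⟩
  classical
  -- The value `a` outside `[0, 1]` is irrelevant, since the integral curve is only required on that
  -- interval.
  set d : ℝ → O := fun t => if ht : t ∈ Icc (0 : ℝ) 1 then (hmem t ht).choose else a
  have hd : ∀ t ∈ Icc (0 : ℝ) 1, i (d t) = c t := fun t ht => by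
    simp only [d, dif_pos ht]
    exact (hmem t ht).choose_spec
  refine ⟨u, hu, d, hi.isEmbedding.injective ?_, hi.isEmbedding.injective ?_, fun t ht => ?_⟩
  · rw [hd 0 (left_mem_Icc.2 zero_le_one), hc0]
  · rw [hd 1 (right_mem_Icc.2 zero_le_one), hc1]
  obtain ⟨W, _, _, hW⟩ := embedding_exists_sliceData hi
  obtain ⟨U, r, Φ, hs⟩ := hW (d t)
  have h1 : HasMFDerivWithinAt 𝓘(ℝ, ℝ) 𝓘(ℝ, G) c (Icc 0 1) t
      ((1 : ℝ →L[ℝ] ℝ).smulRight (B.ρ (c t) w : G) : ℝ →L[ℝ] G) := hc t ht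
  have h2 := h1.congr_of_eventuallyEq (f₁ := i ∘ d)
    (by filter_upwards [self_mem_nhdsWithin] with t ht using hd t ht) (hd t ht)
  have h3 := hs.hasMFDerivWithinAt_lift h2
  have h4 : der F G i (d t) (A.ρ (d t) u) = B.ρ (c t) w := by
    rw [← hd t ht]
    exact huw (d t)
  have h5 : der G F r (i (d t)) (B.ρ (c t) w : G) = (A.ρ (d t) u : F) := by
    rw [← h4]
    exact hs.der_r_der hi.contMDiff _
  rw [h5] at h3
  exact h3

omit [FiniteDimensional ℝ F] [FiniteDimensional ℝ G] [T2Space N] in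
theorem Action.SameOrbit.lift (hi : Manifold.IsSmoothEmbedding 𝓘(ℝ, F) 𝓘(ℝ, G) ∞ i)
    (hr : ∀ w ∈ h', ∃ u ∈ h, Related A B i u w)
    (hinv : B.IsInvariantSet h' (range i)) {x y : N} (hxy : B.SameOrbit h' x y) :
    ∀ a b : O, i a = x → i b = y → A.SameOrbit h a b := by
  induction hxy with
  | rel x y hxy =>
    rintro a b rfl rfl
    exact .rel _ _ (hxy.lift hi hr hinv)
  | refl x =>
    rintro a b rfl hb
    rw [hi.isEmbedding.injective hb]
    exact .refl _
  | symm x y _ ih => exact fun a b ha hb => .symm _ _ (ih b a hb ha)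
  | trans x y z hxy _ h1 h2 =>
    intro a b ha hb
    -- The intermediate point of the chain lies in the submanifold by invariance.
    obtain ⟨e, he⟩ := hinv x y hxy ⟨a, ha⟩
    exact .trans _ _ _ (h1 a e ha he) (h2 e b he hb)

end Restriction

/-! ### Locality and naturality of brackets of functions -/

section Bracket

variable {E : Type*} [NormedAddCommGroup E] [NormedSpace ℝ E]
  {M : Type*} [TopologicalSpace M] [ChartedSpace E M]
  {F : Type*} [NormedAddCommGroup F] [NormedSpace ℝ F]
  {N : Type*} [TopologicalSpace N] [ChartedSpace F N]

theorem fnBracket_congr (π : TwoTensorField E M) {f₁ f₂ f₁' f₂' : M → ℝ} {x : M}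
    (h₁ : f₁ =ᶠ[𝓝 x] f₁') (h₂ : f₂ =ᶠ[𝓝 x] f₂') :
    fnBracket π f₁ f₂ =ᶠ[𝓝 x] fnBracket π f₁' f₂' := by
  filter_upwards [h₁.eventuallyEq_nhds, h₂.eventuallyEq_nhds] with y hy₁ hy₂
  unfold fnBracket
  rw [diff_congr hy₁, diff_congr hy₂]

theorem fnBracket_zero_left (π : TwoTensorField E M) (f : M → ℝ) : fnBracket π 0 f = 0 := by
  funext x
  have : diff E (0 : M → ℝ) x = 0 := der_const x (0 : ℝ)
  simp [fnBracket, this]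

theorem fnBracket_zero_right (π : TwoTensorField E M) (f : M → ℝ) : fnBracket π f 0 = 0 := by
  funext x
  have : diff E (0 : M → ℝ) x = 0 := der_const x (0 : ℝ)
  simp [fnBracket, this]

theorem Action.lieDeriv_congr {g : Type*} [LieRing g] [LieAlgebra ℝ g] [IsManifold 𝓘(ℝ, E) ∞ M]
    (A : Action g E M) (u : g) {f f' : M → ℝ} {x : M} (h : f =ᶠ[𝓝 x] f') :
    A.lieDeriv u f =ᶠ[𝓝 x] A.lieDeriv u f' := by
  filter_upwards [h.eventuallyEq_nhds] with y hy
  unfold Action.lieDeriv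
  rw [diff_congr hy]

/-- With `Related.lieDeriv_comp`, this carries the axioms of a quasi-Poisson structure down a
submersion or back along an embedding. -/
theorem fnBracket_comp {πM : TwoTensorField E M} {πN : TwoTensorField F N} {i : M → N}
    (hi : ContMDiff 𝓘(ℝ, E) 𝓘(ℝ, F) ∞ i) (hp : PushesForward πM πN i) {f₁ f₂ : N → ℝ}
    (h₁ : IsSmoothFun F f₁) (h₂ : IsSmoothFun F f₂) :
    fnBracket πM (f₁ ∘ i) (f₂ ∘ i) = fnBracket πN f₁ f₂ ∘ i := by
  funext x
  unfold fnBracket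
  rw [diff_comp (h₁.mdifferentiableAt _) (hi.mdifferentiableAt (by simp)),
    diff_comp (h₂.mdifferentiableAt _) (hi.mdifferentiableAt (by simp))]
  exact hp x _ _

variable {g : Type*} [LieRing g] [LieAlgebra ℝ g] {k : Type*} [LieRing k] [LieAlgebra ℝ k]
  [IsManifold 𝓘(ℝ, E) ∞ M] [IsManifold 𝓘(ℝ, F) ∞ N]

theorem Related.lieDeriv_comp {A : Action g E M} {B : Action k F N} {i : M → N}
    (hi : ContMDiff 𝓘(ℝ, E) 𝓘(ℝ, F) ∞ i) {u : g} {w : k} (h : Related A B i u w) {f : N → ℝ}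
    (hf : IsSmoothFun F f) : A.lieDeriv u (f ∘ i) = B.lieDeriv w f ∘ i := by
  funext x
  unfold Action.lieDeriv
  rw [diff_comp (hf.mdifferentiableAt _) (hi.mdifferentiableAt (by simp))]
  exact congrArg (diff F f (i x)) (h x)

theorem Related.dual_diff {A : Action g E M} {B : Action k F N} {i : M → N}
    (hi : ContMDiff 𝓘(ℝ, E) 𝓘(ℝ, F) ∞ i) {u : g} {w : k} (h : Related A B i u w) {f : N → ℝ}
    (hf : IsSmoothFun F f) (x : M) :
    A.dual x (diff E (f ∘ i) x) u = B.dual (i x) (diff F f (i x)) w :=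
  congrFun (h.lieDeriv_comp hi hf) x

end Bracket

/-- Precomposition with a continuous linear map. -/
def pullCotangent {E F : Type*} [NormedAddCommGroup E] [NormedSpace ℝ E] [NormedAddCommGroup F]
    [NormedSpace ℝ F] (D : E →L[ℝ] F) : (F →L[ℝ] ℝ) →ₗ[ℝ] (E →L[ℝ] ℝ) where
  toFun α := α.comp D
  map_add' _ _ := rfl
  map_smul' _ _ := rfl

/-! ### Quasi-Poisson structures on quotients -/

section Descent

variable {g : Type*} [LieRing g] [LieAlgebra ℝ g] {t : g ⊗[ℝ] g}
  {k : Type*} [LieRing k] [LieAlgebra ℝ k] {h : LieIdeal ℝ k}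
  {E : Type*} [NormedAddCommGroup E] [NormedSpace ℝ E] [FiniteDimensional ℝ E]
  {M : Type*} [TopologicalSpace M] [T2Space M] [ChartedSpace E M] [IsManifold 𝓘(ℝ, E) ∞ M]
  {F : Type*} [NormedAddCommGroup F] [NormedSpace ℝ F] [FiniteDimensional ℝ F]
  {Q : Type*} [TopologicalSpace Q] [T2Space Q] [ChartedSpace F Q] [IsManifold 𝓘(ℝ, F) ∞ Q]
  {A : Action k E M} {q : M → Q}

/-- A quasi-Poisson structure descends to the quotient by an ideal `h` of a subalgebra `k → g`, as
soon as `φ` descends. -/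
theorem QPStructure.exists_descend (P : QPStructure t E M) {ι : k → g}
    (hA : ∀ x u, A.ρ x u = P.ρ x (ι u))
    (hq : IsOrbitQuotient (E₁ := E) (E₂ := F) A h.toSubmodule id q)
    {B : Action (k ⧸ h) F Q} (hB : ∀ u : k, Related A B q u (LieSubmodule.Quotient.mk u))
    {t' : (k ⧸ h) ⊗[ℝ] (k ⧸ h)}
    (hφ : ∀ (α β γ : Module.Dual ℝ g) (α' β' γ' : Module.Dual ℝ (k ⧸ h)),
      (∀ u, α (ι u) = α' (LieSubmodule.Quotient.mk u)) →
      (∀ u, β (ι u) = β' (LieSubmodule.Quotient.mk u)) →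
      (∀ u, γ (ι u) = γ' (LieSubmodule.Quotient.mk u)) → phi t α β γ = phi t' α' β' γ') :
    ∃ R : QPStructure t' F Q, R.toAction = B ∧ PushesForward P.π R.π q := by
  have hqs := hq.contMDiff
  have hinv : ∀ f₁ f₂ : Q → ℝ, IsSmoothFun F f₁ → IsSmoothFun F f₂ → ∀ x x', q x = q x' →
      fnBracket P.π (f₁ ∘ q) (f₂ ∘ q) x = fnBracket P.π (f₁ ∘ q) (f₂ ∘ q) x' := by
    intro f₁ f₂ hf₁ hf₂ x x' hx
    have hl : ∀ (u : k) (f : M → ℝ), A.lieDeriv u f = P.lieDeriv (ι u) f := by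
      intro u f
      funext x
      unfold Action.lieDeriv
      rw [hA]
    -- Invariance of `π` makes `ρ(u)` a derivation of the bracket, and it kills both arguments when
    -- `u` lies in `h`.
    refine ((hq.fibres x x').1 hx).eq_of_lieDeriv_eq_zero (P.smooth_π _ _ (hf₁.comp hqs)
      (hf₂.comp hqs)) fun u hu => ?_
    rw [hl, P.invariant _ _ (hf₁.comp hqs) (hf₂.comp hqs), ← hl, ← hl,
      hq.lieDeriv_eq_zero hf₁ hu, hq.lieDeriv_eq_zero hf₂ hu, fnBracket_zero_left,
      fnBracket_zero_right, add_zero]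
  set σ := Function.surjInv hq.surjective
  have hσ : ∀ y, q (σ y) = y := Function.surjInv_eq hq.surjective
  -- The bivector is pushed forward from the one point `σ y` of the fibre; `hinv` shows that any
  -- other point gives the same result.
  let π₁ : Q → (F →L[ℝ] ℝ) →ₗ[ℝ] (F →L[ℝ] ℝ) →ₗ[ℝ] ℝ := fun y =>
    (show (E →L[ℝ] ℝ) →ₗ[ℝ] (E →L[ℝ] ℝ) →ₗ[ℝ] ℝ from P.π (σ y)).compl₁₂
      (pullCotangent (der E F q (σ y))) (pullCotangent (der E F q (σ y)))
  let π' : TwoTensorField F Q := π₁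
  have hpush : PushesForward P.π π' q := by
    intro x α β
    obtain ⟨f₁, hf₁, rfl⟩ := exists_diff_eq α
    obtain ⟨f₂, hf₂, rfl⟩ := exists_diff_eq β
    have h1 := hinv f₁ f₂ hf₁ hf₂ x (σ (q x)) (hσ (q x)).symm
    unfold fnBracket at h1
    simp only [diff_eq_der, der_comp (hf₁.mdifferentiableAt _) (hqs.mdifferentiableAt (by simp)),
      der_comp (hf₂.mdifferentiableAt _) (hqs.mdifferentiableAt (by simp))] at h1
    rw [hσ (q x)] at h1
    exact h1
  have hbr := fun f₁ f₂ (hf₁ : IsSmoothFun F f₁) (hf₂ : IsSmoothFun F f₂) =>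
    fnBracket_comp hqs hpush hf₁ hf₂
  have hsm : ∀ f₁ f₂ : Q → ℝ, IsSmoothFun F f₁ → IsSmoothFun F f₂ →
      IsSmoothFun F (fnBracket π' f₁ f₂) := by
    intro f₁ f₂ hf₁ hf₂
    refine submersion_descend_contMDiff hq.submersion hq.surjective ?_
    rw [← hbr f₁ f₂ hf₁ hf₂]
    exact P.smooth_π _ _ (hf₁.comp hqs) (hf₂.comp hqs)
  have hrel : ∀ u : k, Related P.toAction B q (ι u) (LieSubmodule.Quotient.mk u) := by
    intro u x
    rw [← hA]
    exact hB u x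
  refine ⟨⟨B, π', ?_, hsm, ?_, ?_⟩, rfl, hpush⟩
  · intro y α β
    exact P.skew _ _ _
  · intro f₁ f₂ hf₁ hf₂ w
    obtain ⟨u, rfl⟩ := LieSubmodule.Quotient.surjective_mk' h w
    funext y
    obtain ⟨x, rfl⟩ := hq.surjective y
    have h1 := congrFun (P.invariant _ _ (hf₁.comp hqs) (hf₂.comp hqs) (ι u)) x
    rw [hbr _ _ hf₁ hf₂, (hrel u).lieDeriv_comp hqs (hsm _ _ hf₁ hf₂),
      (hrel u).lieDeriv_comp hqs hf₁, (hrel u).lieDeriv_comp hqs hf₂, Pi.add_apply,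
      hbr _ _ (B.isSmoothFun_lieDeriv _ hf₁) hf₂, hbr _ _ hf₁ (B.isSmoothFun_lieDeriv _ hf₂)] at h1
    exact h1
  · intro f₁ f₂ f₃ hf₁ hf₂ hf₃ y
    obtain ⟨x, rfl⟩ := hq.surjective y
    have h1 := P.quasi_jacobi _ _ _ (hf₁.comp hqs) (hf₂.comp hqs) (hf₃.comp hqs) x
    rw [hbr _ _ hf₂ hf₃, hbr _ _ hf₃ hf₁, hbr _ _ hf₁ hf₂, hbr _ _ hf₁ (hsm _ _ hf₂ hf₃),
      hbr _ _ hf₂ (hsm _ _ hf₃ hf₁), hbr _ _ hf₃ (hsm _ _ hf₁ hf₂)] at h1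
    exact h1.trans (hφ _ _ _ _ _ _ (fun u => (hrel u).dual_diff hqs hf₁ x)
      (fun u => (hrel u).dual_diff hqs hf₂ x) (fun u => (hrel u).dual_diff hqs hf₃ x))

end Descent

/-! ### Quasi-Poisson structures on submanifolds -/

section Restriction

variable {k : Type*} [LieRing k] [LieAlgebra ℝ k] {s : k ⊗[ℝ] k}
  {F : Type*} [NormedAddCommGroup F] [NormedSpace ℝ F] [FiniteDimensional ℝ F]
  {O : Type*} [TopologicalSpace O] [ChartedSpace F O] [IsManifold 𝓘(ℝ, F) ∞ O]
  {G : Type*} [NormedAddCommGroup G] [NormedSpace ℝ G] [FiniteDimensional ℝ G]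
  {N : Type*} [TopologicalSpace N] [T2Space N] [ChartedSpace G N] [IsManifold 𝓘(ℝ, G) ∞ N]
  {i : O → N}

omit [FiniteDimensional ℝ F] [IsManifold 𝓘(ℝ, F) ∞ O] in
/-- Functions on an embedded submanifold extend locally. -/
theorem embedding_exists_extension (hi : Manifold.IsSmoothEmbedding 𝓘(ℝ, F) 𝓘(ℝ, G) ∞ i)
    {f : O → ℝ} (hf : IsSmoothFun F f) (a : O) :
    ∃ f' : N → ℝ, IsSmoothFun G f' ∧ f' ∘ i =ᶠ[𝓝 a] f := by
  obtain ⟨W, _, _, hW⟩ := embedding_exists_sliceData hi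
  obtain ⟨U, r, Φ, h⟩ := hW a
  obtain ⟨f', hf', hff'⟩ := exists_isSmoothFun_eventuallyEq (h.isOpen.mem_nhds h.mem)
    (hf.comp_contMDiffOn h.smooth_r)
  refine ⟨f', hf', ?_⟩
  have hc := hi.contMDiff.continuous.continuousAt (x := a)
  filter_upwards [hc.eventually hff', hc.eventually (h.isOpen.mem_nhds h.mem)] with b hb hbU
  rw [Function.comp_apply, hb, Function.comp_apply, h.leftInv b hbU]

omit [FiniteDimensional ℝ F] in
/-- A quasi-Poisson structure restricts to an embedded submanifold to which the action and the
bivector field are tangent. -/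
theorem QPStructure.exists_restrict (R : QPStructure s G N)
    (hi : Manifold.IsSmoothEmbedding 𝓘(ℝ, F) 𝓘(ℝ, G) ∞ i) {A : Action k F O}
    (hA : ∀ u : k, Related A R.toAction i u u)
    (hπ : ∀ (a : O) (α β : G →L[ℝ] ℝ), α.comp (der F G i a) = 0 → R.π (i a) α β = 0) :
    ∃ P : QPStructure s F O, P.toAction = A ∧ IsQuasiPoissonMap P R i := by
  have his := hi.contMDiff
  have hL : ∀ a : O, ∃ L : G →L[ℝ] F, ∀ w, L (der F G i a w) = w := by
    intro a
    obtain ⟨W, _, _, hW⟩ := embedding_exists_sliceData hi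
    obtain ⟨U, r, Φ, h⟩ := hW a
    exact ⟨der G F r (i a), h.der_r_der his⟩
  choose L hL using hL
  let π₁ : O → (F →L[ℝ] ℝ) →ₗ[ℝ] (F →L[ℝ] ℝ) →ₗ[ℝ] ℝ := fun a =>
    (show (G →L[ℝ] ℝ) →ₗ[ℝ] (G →L[ℝ] ℝ) →ₗ[ℝ] ℝ from R.π (i a)).compl₁₂
      (pullCotangent (L a)) (pullCotangent (L a))
  let π' : TwoTensorField F O := π₁
  have hpush : PushesForward π' R.π i := by
    intro a α β
    set π₀ : (G →L[ℝ] ℝ) →ₗ[ℝ] (G →L[ℝ] ℝ) →ₗ[ℝ] ℝ := R.π (i a)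
    -- By `hπ` only the restriction of `α` to the submanifold matters, so `L` may be any left
    -- inverse; skewness then gives the same for the second slot.
    have h1 : ∀ α β : G →L[ℝ] ℝ, π₀ ((α.comp (der F G i a)).comp (L a)) β = π₀ α β := by
      intro α β
      have h2 := hπ a ((α.comp (der F G i a)).comp (L a) - α) β (by
        ext w
        simp [hL])
      have h3 : π₀ ((α.comp (der F G i a)).comp (L a) - α) β = 0 := h2
      rw [map_sub, LinearMap.sub_apply, sub_eq_zero] at h3
      exact h3
    have h4 : ∀ α β : G →L[ℝ] ℝ, π₀ α β = -π₀ β α := R.skew (i a)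
    change π₀ (((show G →L[ℝ] ℝ from α).comp (der F G i a)).comp (L a))
      (((show G →L[ℝ] ℝ from β).comp (der F G i a)).comp (L a)) = π₀ α β
    rw [h1, h4, h1, ← h4]
  have hbr := fun f₁ f₂ (hf₁ : IsSmoothFun G f₁) (hf₂ : IsSmoothFun G f₂) =>
    fnBracket_comp his hpush hf₁ hf₂
  have hext := fun f (hf : IsSmoothFun F f) a => embedding_exists_extension hi hf a
  refine ⟨⟨A, π', fun a α β => R.skew _ _ _, ?_, ?_, ?_⟩, rfl, his, hA, hpush⟩
  -- Brackets are local, so each axiom is checked near `a` on local extensions of the functions to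
  -- `N`.
  · intro f₁ f₂ hf₁ hf₂ a
    obtain ⟨f₁', h₁', h₁⟩ := hext f₁ hf₁ a
    obtain ⟨f₂', h₂', h₂⟩ := hext f₂ hf₂ a
    refine ContMDiffAt.congr_of_eventuallyEq ?_ (fnBracket_congr π' h₁ h₂).symm
    rw [hbr _ _ h₁' h₂']
    exact ((R.smooth_π _ _ h₁' h₂').comp his) a
  · intro f₁ f₂ hf₁ hf₂ u
    funext a
    obtain ⟨f₁', h₁', h₁⟩ := hext f₁ hf₁ a
    obtain ⟨f₂', h₂', h₂⟩ := hext f₂ hf₂ a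
    have e := congrFun (R.invariant _ _ h₁' h₂' u) (i a)
    rw [Pi.add_apply] at e ⊢
    rw [← (A.lieDeriv_congr u (fnBracket_congr π' h₁ h₂)).eq_of_nhds,
      ← (fnBracket_congr π' (A.lieDeriv_congr u h₁) h₂).eq_of_nhds,
      ← (fnBracket_congr π' h₁ (A.lieDeriv_congr u h₂)).eq_of_nhds, hbr _ _ h₁' h₂',
      (hA u).lieDeriv_comp his (R.smooth_π _ _ h₁' h₂'), (hA u).lieDeriv_comp his h₁',
      (hA u).lieDeriv_comp his h₂', hbr _ _ (R.isSmoothFun_lieDeriv u h₁') h₂',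
      hbr _ _ h₁' (R.isSmoothFun_lieDeriv u h₂')]
    exact e
  · intro f₁ f₂ f₃ hf₁ hf₂ hf₃ a
    obtain ⟨f₁', h₁', h₁⟩ := hext f₁ hf₁ a
    obtain ⟨f₂', h₂', h₂⟩ := hext f₂ hf₂ a
    obtain ⟨f₃', h₃', h₃⟩ := hext f₃ hf₃ a
    have e := R.quasi_jacobi _ _ _ h₁' h₂' h₃' (i a)
    have hd : ∀ f' : N → ℝ, IsSmoothFun G f' →
        A.dual a (diff F (f' ∘ i) a) = R.dual (i a) (diff G f' (i a)) := fun f' hf' =>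
      LinearMap.ext fun u => (hA u).dual_diff his hf' a
    rw [← (fnBracket_congr π' h₁ (fnBracket_congr π' h₂ h₃)).eq_of_nhds,
      ← (fnBracket_congr π' h₂ (fnBracket_congr π' h₃ h₁)).eq_of_nhds,
      ← (fnBracket_congr π' h₃ (fnBracket_congr π' h₁ h₂)).eq_of_nhds, hbr _ _ h₁' h₂',
      hbr _ _ h₂' h₃', hbr _ _ h₃' h₁', hbr _ _ h₁' (R.smooth_π _ _ h₂' h₃'),
      hbr _ _ h₂' (R.smooth_π _ _ h₃' h₁'), hbr _ _ h₃' (R.smooth_π _ _ h₁' h₂'),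
      ← diff_congr h₁, ← diff_congr h₂, ← diff_congr h₃, hd _ h₁', hd _ h₂', hd _ h₃']
    exact e

end Restriction

/-! ### Descent of `t` and `φ` to `c / h` -/

section TensorAlgebra

/-- A tensor over a field is determined by its contractions with functionals on the first factor. -/
theorem tensor_eq_zero_of_contractions {V W : Type*} [AddCommGroup V] [Module ℝ V]
    [AddCommGroup W] [Module ℝ W] {z : V ⊗[ℝ] W}
    (hz : ∀ α : Module.Dual ℝ V, TensorProduct.lid ℝ W (TensorProduct.map α LinearMap.id z) = 0) :
    z = 0 := by
  classical
  let b := Module.Basis.ofVectorSpace ℝ V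
  apply (TensorProduct.equivFinsuppOfBasisLeft (N := W) b).injective
  rw [map_zero]
  ext j
  have h : ∀ z : V ⊗[ℝ] W, TensorProduct.equivFinsuppOfBasisLeft b z j =
      TensorProduct.lid ℝ W (TensorProduct.map (b.coord j) LinearMap.id z) := by
    intro z
    induction z with
    | zero => simp
    | add x y hx hy => simp [hx, hy]
    | tmul x y => simp [TensorProduct.equivFinsuppOfBasisLeft_apply_tmul]
  rw [h, hz]
  rfl

variable {g : Type*} [LieRing g] [LieAlgebra ℝ g]

/-- Contractions of images of `t` are images of values of `t♯`; this turns equations between tensors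
into equations between vectors. -/
theorem contraction_map (t : g ⊗[ℝ] g) {V W : Type*} [AddCommGroup V] [Module ℝ V]
    [AddCommGroup W] [Module ℝ W] (f : g →ₗ[ℝ] V) (f' : g →ₗ[ℝ] W) (α : Module.Dual ℝ V) :
    TensorProduct.lid ℝ W (TensorProduct.map α LinearMap.id (TensorProduct.map f f' t)) =
      f' (sharp t (α ∘ₗ f)) := by
  unfold sharp
  induction t with
  | zero => simp
  | add x y hx hy =>
    simp only [map_add, LinearMap.coe_mk, AddHom.coe_mk] at hx hy ⊢
    rw [hx, hy]
  | tmul x y => simp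

theorem sharp_comm (t : g ⊗[ℝ] g) (α β : Module.Dual ℝ g) :
    β (sharp t α) = α (sharp (TensorProduct.comm ℝ g g t) β) := by
  unfold sharp
  induction t with
  | zero => simp
  | add x y hx hy =>
    simp only [map_add, LinearMap.coe_mk, AddHom.coe_mk] at hx hy ⊢
    rw [hx, hy]
  | tmul x y => simp [mul_comm]

theorem IsInvariantSymmetric.sharp_symm {t : g ⊗[ℝ] g} (ht : IsInvariantSymmetric t)
    (α β : Module.Dual ℝ g) : β (sharp t α) = α (sharp t β) := by
  rw [sharp_comm, ht.1]

/-- The adjoint action on a tensor square is by the Leibniz rule, so it passes through any `f` that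
intertwines `ad a` with an endomorphism `D`. It serves to compare the actions on `g ⊗ g` and `(c /
h) ⊗ (c / h)` inside `(g / h) ⊗ (g / h)`. -/
theorem map_map_lie {k V : Type*} [LieRing k] [LieAlgebra ℝ k] [AddCommGroup V] [Module ℝ V]
    (f : k →ₗ[ℝ] V) (D : V →ₗ[ℝ] V) (a : k) (hf : ∀ x, f ⁅a, x⁆ = D (f x)) (x : k ⊗[ℝ] k) :
    TensorProduct.map f f ⁅a, x⁆ =
      (TensorProduct.map D LinearMap.id + TensorProduct.map LinearMap.id D :
        V ⊗[ℝ] V →ₗ[ℝ] V ⊗[ℝ] V) (TensorProduct.map f f x) := by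
  induction x with
  | zero => simp
  | add x y hx hy => simp only [lie_add, map_add, hx, hy]
  | tmul x y => simp [TensorProduct.LieModule.lie_tmul_right, hf]

variable {t : g ⊗[ℝ] g} {c : LieSubalgebra ℝ g} {h : LieIdeal ℝ c}

theorem mem_idealSpan {u : g} : u ∈ idealSpan h ↔ ∃ v : c, v ∈ h ∧ (v : g) = u := by
  simp only [idealSpan, Submodule.mem_map]
  rfl

/-- `t♯` maps the annihilator of `h` to `c` when `c^⊥ ⊆ h`. -/
theorem sharp_mem_of_annihilates (ht : IsInvariantSymmetric t) (hh : perp t c ≤ idealSpan h)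
    {α : Module.Dual ℝ g} (hα : ∀ u : c, u ∈ h → α (u : g) = 0) : sharp t α ∈ c := by
  have := (Subspace.forall_mem_dualAnnihilator_apply_eq_zero_iff c.toSubmodule (sharp t α)).1
    fun β hβ => by
      rw [ht.sharp_symm]
      obtain ⟨v, hv, hvβ⟩ := mem_idealSpan.1 (hh (Submodule.mem_map_of_mem hβ))
      rw [← hvβ]
      exact hα v hv
  exact this

theorem quotIncl_mk (v : c) :
    quotIncl h (LieSubmodule.Quotient.mk v) = (idealSpan h).mkQ (v : g) := rfl

theorem quotIncl_injective : Function.Injective (quotIncl h) := by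
  refine LinearMap.ker_eq_bot.1 (LinearMap.ker_eq_bot'.2 fun w hw => ?_)
  obtain ⟨v, rfl⟩ := LieSubmodule.Quotient.surjective_mk' h w
  have h1 : (idealSpan h).mkQ (v : g) = 0 := hw
  rw [Submodule.mkQ_apply, Submodule.Quotient.mk_eq_zero] at h1
  obtain ⟨v', hv', hvv⟩ := mem_idealSpan.1 h1
  rw [Subtype.ext hvv] at hv'
  exact (LieSubmodule.Quotient.mk_eq_zero' ).2 hv'

/-- All contractions of the image `z` of `t` in `(g / h) ⊗ (g / h)` lie in `c / h`, so `z` comes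
from the tensor square of `c / h`. A linear retraction `L` of `c / h → g / h` recovers `t'`, and
injectivity of `ι ⊗ ι` transfers symmetry and invariance. -/
theorem exists_descendsTo (ht : IsInvariantSymmetric t) (hh : perp t c ≤ idealSpan h) :
    ∃ t' : (c ⧸ h) ⊗[ℝ] (c ⧸ h), DescendsTo h t t' ∧ IsInvariantSymmetric t' := by
  set ι := quotIncl h with hι
  set p := (idealSpan h).mkQ with hp
  obtain ⟨L, hL⟩ := LinearMap.exists_leftInverse_of_injective ι
    (LinearMap.ker_eq_bot.2 quotIncl_injective)
  set z := TensorProduct.map p p t with hz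
  have hzc : TensorProduct.comm ℝ _ _ z = z := by
    rw [hz, ← TensorProduct.map_comm, ht.1]
  -- Contracting the first factor with `α` gives the class of `t♯ (α ∘ p)`. As `α ∘ p` kills `h`,
  -- this class lies in `c / h`, on which `ι ∘ L` is the identity.
  have h1 : TensorProduct.map LinearMap.id (ι ∘ₗ L) z = z := by
    rw [← sub_eq_zero]
    refine tensor_eq_zero_of_contractions fun α => ?_
    rw [map_sub, map_sub, hz,
      TensorProduct.map_map LinearMap.id (ι ∘ₗ L) p p, contraction_map, contraction_map, sub_eq_zero]
    have hmem : sharp t (α ∘ₗ p) ∈ c := by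
      refine sharp_mem_of_annihilates ht hh fun u hu => ?_
      have : p (u : g) = 0 :=
        (Submodule.Quotient.mk_eq_zero _).2 (mem_idealSpan.2 ⟨u, hu, rfl⟩)
      rw [LinearMap.comp_apply, this, map_zero]
    have hι' : p (sharp t (α ∘ₗ p)) =
        ι (LieSubmodule.Quotient.mk (⟨_, hmem⟩ : c)) := rfl
    rw [LinearMap.id_comp, LinearMap.comp_apply, hι', LinearMap.comp_apply]
    exact congrArg ι (LinearMap.congr_fun hL _)
  have h2 : TensorProduct.map (ι ∘ₗ L) LinearMap.id z = z := by
    have := congrArg (TensorProduct.comm ℝ _ _) h1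
    rwa [← TensorProduct.map_comm, hzc] at this
  have h3 : TensorProduct.map ι ι (TensorProduct.map L L z) = z := by
    have h4 : TensorProduct.map (ι ∘ₗ L) LinearMap.id
        (TensorProduct.map LinearMap.id (ι ∘ₗ L) z) = z := by rw [h1, h2]
    rwa [TensorProduct.map_map, LinearMap.id_comp, LinearMap.comp_id, ← TensorProduct.map_map]
      at h4
  have hinj : Function.Injective (TensorProduct.map ι ι) := by
    refine Function.LeftInverse.injective (g := TensorProduct.map L L) fun x => ?_
    rw [TensorProduct.map_map, hL, TensorProduct.map_id]
    rfl
  refine ⟨TensorProduct.map L L z, h3, ?_, fun w => ?_⟩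
  · apply hinj
    rw [← TensorProduct.map_comm, hzc]
  · obtain ⟨u, rfl⟩ := LieSubmodule.Quotient.surjective_mk' h w
    -- `ad u` preserves `h` because `u` lies in `c` and `h` is an ideal of `c`; the induced `D` on
    -- `g / h` extends the adjoint action on `c / h`.
    have hD : idealSpan h ≤ (idealSpan h).comap (LieAlgebra.ad ℝ g (u : g)) := by
      intro v hv
      obtain ⟨v', hv', rfl⟩ := mem_idealSpan.1 hv
      exact mem_idealSpan.2 ⟨⁅u, v'⁆, lie_mem_right ℝ c h u v' hv', rfl⟩
    set D := (idealSpan h).mapQ (idealSpan h) (LieAlgebra.ad ℝ g (u : g)) hD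
    apply hinj
    rw [map_map_lie ι D _ ?_, h3, hz, ← map_map_lie p D (u : g) fun x => rfl, ht.2, map_zero,
      map_zero]
    · intro x
      obtain ⟨v, rfl⟩ := LieSubmodule.Quotient.surjective_mk' h x
      rfl

/-- If `α` and `α'` agree on `c`, then `t♯ α` lies in `c` and represents `t'♯ α'`. -/
theorem DescendsTo.exists_sharp_eq {t' : (c ⧸ h) ⊗[ℝ] (c ⧸ h)} (htt' : DescendsTo h t t')
    (ht : IsInvariantSymmetric t) (hh : perp t c ≤ idealSpan h) {α : Module.Dual ℝ g}
    {α' : Module.Dual ℝ (c ⧸ h)} (hα : ∀ u : c, α u = α' (LieSubmodule.Quotient.mk u)) :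
    ∃ v : c, (v : g) = sharp t α ∧ LieSubmodule.Quotient.mk (N := h) v = sharp t' α' := by
  have h0 : ∀ u : c, u ∈ h → α (u : g) = 0 := by
    intro u hu
    rw [hα, (LieSubmodule.Quotient.mk_eq_zero').2 hu, map_zero]
  refine ⟨⟨sharp t α, sharp_mem_of_annihilates ht hh h0⟩, rfl, quotIncl_injective ?_⟩
  rw [quotIncl_mk]
  set αb : Module.Dual ℝ (g ⧸ idealSpan h) := (idealSpan h).liftQ α (by
    intro u hu
    obtain ⟨v, hv, rfl⟩ := mem_idealSpan.1 hu
    exact h0 v hv)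
  have h1 := congrArg (fun x => TensorProduct.lid ℝ _ (TensorProduct.map αb LinearMap.id x)) htt'
  simp only [contraction_map] at h1
  have h2 : αb ∘ₗ (idealSpan h).mkQ = α := Submodule.liftQ_mkQ _ _ _
  have h3 : αb ∘ₗ quotIncl h = α' := by
    ext x
    obtain ⟨v, rfl⟩ := LieSubmodule.Quotient.surjective_mk' h x
    exact hα v
  rw [h2, h3] at h1
  exact h1.symm

theorem DescendsTo.sharp_apply {t' : (c ⧸ h) ⊗[ℝ] (c ⧸ h)} (htt' : DescendsTo h t t')
    (ht : IsInvariantSymmetric t) (hh : perp t c ≤ idealSpan h) {α β : Module.Dual ℝ g}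
    {α' β' : Module.Dual ℝ (c ⧸ h)} (hα : ∀ u : c, α u = α' (LieSubmodule.Quotient.mk u))
    (hβ : ∀ u : c, β u = β' (LieSubmodule.Quotient.mk u)) :
    β (sharp t α) = β' (sharp t' α') := by
  obtain ⟨v, hv, hv'⟩ := htt'.exists_sharp_eq ht hh hα
  rw [← hv, ← hv', hβ]

/-- Both `t♯ α` and `t♯ β` lie in `c`, so their bracket may be taken in `c`, and `γ` sees only its
class modulo `h`. -/
theorem DescendsTo.phi_eq {t' : (c ⧸ h) ⊗[ℝ] (c ⧸ h)} (htt' : DescendsTo h t t')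
    (ht : IsInvariantSymmetric t) (hh : perp t c ≤ idealSpan h) {α β γ : Module.Dual ℝ g}
    {α' β' γ' : Module.Dual ℝ (c ⧸ h)} (hα : ∀ u : c, α u = α' (LieSubmodule.Quotient.mk u))
    (hβ : ∀ u : c, β u = β' (LieSubmodule.Quotient.mk u))
    (hγ : ∀ u : c, γ u = γ' (LieSubmodule.Quotient.mk u)) :
    phi t α β γ = phi t' α' β' γ' := by
  obtain ⟨v, hv, hv'⟩ := htt'.exists_sharp_eq ht hh hα
  obtain ⟨w, hw, hw'⟩ := htt'.exists_sharp_eq ht hh hβ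
  have h1 := hγ ⁅v, w⁆
  unfold phi
  rw [← hv, ← hv', ← hw, ← hw', ← LieSubmodule.Quotient.mk_bracket, ← h1]
  rfl

end TensorAlgebra

/-! ### Commutative structures with zero bivector -/

section Commutative

variable {k : Type*} [LieRing k] [LieAlgebra ℝ k] {s : k ⊗[ℝ] k}
  {F : Type*} [NormedAddCommGroup F] [NormedSpace ℝ F]
  {Q : Type*} [TopologicalSpace Q] [ChartedSpace F Q] [IsManifold 𝓘(ℝ, F) ∞ Q]

/-- An action with `ρ ⊗ ρ (s) = 0` is a quasi-Poisson-commutative structure with `π = 0`. -/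
theorem Action.exists_commutative (B : Action k F Q)
    (hB : ∀ (y : Q) (α β : Cotangent F y), B.dual y β (sharp s (B.dual y α)) = 0) :
    ∃ R : QPStructure s F Q, R.toAction = B ∧ R.IsCommutative := by
  have hz : ∀ (y : Q) (α : Cotangent F y), B.ρ y (sharp s (B.dual y α)) = 0 := by
    intro y α
    by_contra hne
    have : ‖(show F from B.ρ y (sharp s (B.dual y α)))‖ ≠ 0 := norm_ne_zero_iff.2 hne
    obtain ⟨β, -, hβ⟩ := exists_dual_vector ℝ _ this
    have h1 : β (show F from B.ρ y (sharp s (B.dual y α))) = 0 := hB y α β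
    rw [h1] at hβ
    exact this (by simpa using hβ.symm)
  have h0 : ∀ f f' : Q → ℝ, fnBracket (fun y => 0 : TwoTensorField F Q) f f' = 0 := fun _ _ => rfl
  refine ⟨⟨B, fun y => 0, fun _ _ _ => by simp, ?_, ?_, ?_⟩, rfl, ?_⟩
  · intro f₁ f₂ _ _
    rw [h0]
    exact contMDiff_const
  · intro f₁ f₂ _ _ u
    rw [h0, h0, h0, add_zero]
    funext x
    have : diff F (0 : Q → ℝ) x = 0 := der_const x (0 : ℝ)
    simp [Action.lieDeriv, this]
  · intro f₁ f₂ f₃ _ _ _ y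
    rw [h0, h0, h0]
    simp only [Pi.zero_apply, add_zero]
    -- The two Lie algebra elements are frozen at `y`. Their vector fields vanish at `y` by `hz`,
    -- hence so does the bracket of these fields, which is `ρ` of the bracket occurring in `φ`.
    have h1 := B.map_lie (sharp s (B.dual y (diff F f₁ y))) (sharp s (B.dual y (diff F f₂ y))) y
    have h2 : VectorField.mlieBracket 𝓘(ℝ, F)
        (fun z => B.ρ z (sharp s (B.dual y (diff F f₁ y))))
        (fun z => B.ρ z (sharp s (B.dual y (diff F f₂ y)))) y = 0 :=
      VectorField.mlieBracketWithin_eq_zero_of_eq_zero (hz y _) (hz y _)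
    rw [h2] at h1
    have h3 : B.dual y (diff F f₃ y)
        ⁅sharp s (B.dual y (diff F f₁ y)), sharp s (B.dual y (diff F f₂ y))⁆ = 0 := by
      change diff F f₃ y (B.ρ y _) = 0
      rw [← h1]
      simp
    unfold phi
    rw [h3]
    simp
  · intro y α β
    simp only [QPStructure.σ, hB, mul_zero, add_zero]
    rfl

end Commutative

/-! ### The inverse function theorem -/

section InverseFunction

variable {F : Type*} [NormedAddCommGroup F] [NormedSpace ℝ F]
  {F' : Type*} [NormedAddCommGroup F'] [NormedSpace ℝ F']

/-- The inverse function theorem, with an inverse that is smooth on its whole domain. -/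
theorem exists_openPartialHomeomorph_of_hasFDerivAt [CompleteSpace F]
    {U : Set F} (hU : IsOpen U) {x : F}
    (hx : x ∈ U) {f : F → F'} (hf : ContDiffOn ℝ ∞ f U) (e : F ≃L[ℝ] F')
    (he : HasFDerivAt f (e : F →L[ℝ] F') x) :
    ∃ θ : OpenPartialHomeomorph F F', x ∈ θ.source ∧ θ.source ⊆ U ∧ (∀ z, θ z = f z) ∧
      ContDiffOn ℝ ∞ θ.symm θ.target := by
  have hfx : ContDiffAt ℝ ∞ f x := hf.contDiffAt (hU.mem_nhds hx)
  set θ := hfx.toOpenPartialHomeomorph f he (by simp) with hθ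
  -- The derivative stays invertible on an open set; restricting to it makes the local inverse
  -- smooth at every point of its domain.
  set T : Set F := U ∩ fderiv ℝ f ⁻¹' range ((↑) : (F ≃L[ℝ] F') → F →L[ℝ] F') with hT
  have hTo : IsOpen T := ContinuousOn.isOpen_inter_preimage
    (hf.continuousOn_fderiv_of_isOpen hU ENat.LEInfty.out) hU (ContinuousLinearEquiv.isOpen)
  have hxT : x ∈ T := ⟨hx, e, he.fderiv.symm⟩
  refine ⟨θ.restr T, ?_, ?_, fun z => rfl, ?_⟩
  · rw [θ.restr_source' _ hTo]
    exact ⟨hfx.mem_toOpenPartialHomeomorph_source he (by simp), hxT⟩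
  · rw [θ.restr_source' _ hTo]
    exact fun z hz => hz.2.1
  · intro w hw
    have hs := (θ.restr T).map_target hw
    rw [θ.restr_source' _ hTo] at hs
    obtain ⟨-, hzU, e', he'⟩ := hs
    have hd : ContDiffAt ℝ ∞ f ((θ.restr T).symm w) := hf.contDiffAt (hU.mem_nhds hzU)
    refine ((θ.restr T).contDiffAt_symm hw (f₀' := e') ?_ hd).contDiffWithinAt
    rw [he']
    exact (hd.differentiableAt (by simp)).hasFDerivAt

/-- A surjective linear map is completed to an isomorphism by a map to any space of the right
dimension. -/
theorem exists_equiv_prod_of_surjective [FiniteDimensional ℝ F] {K W : Type*}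
    [NormedAddCommGroup K] [NormedSpace ℝ K] [FiniteDimensional ℝ K]
    [NormedAddCommGroup W] [NormedSpace ℝ W] [FiniteDimensional ℝ W] (D : F →L[ℝ] W)
    (hD : Function.Surjective D)
    (hd : Module.finrank ℝ F = Module.finrank ℝ K + Module.finrank ℝ W) :
    ∃ (p : F →L[ℝ] K) (e : F ≃L[ℝ] K × W), ∀ v, e v = (p v, D v) := by
  have hk : Module.finrank ℝ (LinearMap.ker D.toLinearMap) = Module.finrank ℝ K := by
    have h1 := D.toLinearMap.finrank_range_add_finrank_ker
    have h2 : LinearMap.range D.toLinearMap = ⊤ := LinearMap.range_eq_top.2 hD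
    rw [h2, finrank_top] at h1
    omega
  set l := LinearEquiv.ofFinrankEq _ _ hk
  obtain ⟨p, hp⟩ := LinearMap.exists_extend (l : LinearMap.ker D.toLinearMap →ₗ[ℝ] K)
  have hinj : Function.Injective (p.prod D.toLinearMap) := by
    refine LinearMap.ker_eq_bot.1 (LinearMap.ker_eq_bot'.2 fun v hv => ?_)
    have h1 : p v = 0 := congrArg Prod.fst hv
    have h2 : D v = 0 := congrArg Prod.snd hv
    have h3 := LinearMap.congr_fun hp (⟨v, h2⟩ : LinearMap.ker D.toLinearMap)
    have h4 : l (⟨v, h2⟩ : LinearMap.ker D.toLinearMap) = 0 := h3.symm.trans h1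
    exact congrArg Subtype.val ((LinearEquiv.map_eq_zero_iff l).1 h4)
  have hr : Module.finrank ℝ F = Module.finrank ℝ (K × W) := by rw [hd, Module.finrank_prod]
  exact ⟨LinearMap.toContinuousLinearMap p,
    (LinearEquiv.ofInjectiveOfFinrankEq _ hinj hr).toContinuousLinearEquiv, fun v => rfl⟩

end InverseFunction

/-! ### Level sets as embedded submanifolds -/

section LevelSet

variable {F : Type*} [NormedAddCommGroup F] [NormedSpace ℝ F]
  {Q : Type*} [TopologicalSpace Q]
  {K W : Type*} [NormedAddCommGroup K] [NormedSpace ℝ K]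
  [NormedAddCommGroup W] [NormedSpace ℝ W]

/-- The chart of a subset `S` obtained from a slice chart `χ`, in which `S` is the zero set of the
second component. -/
noncomputable def sliceChart (e₀ : (K × W) ≃L[ℝ] F) (S : Set Q) (χ : OpenPartialHomeomorph Q F)
    (hχ : ∀ z ∈ χ.source, z ∈ S ↔ (e₀.symm (χ z)).2 = 0) [Nonempty S] :
    OpenPartialHomeomorph S K where
  toFun s := (e₀.symm (χ s)).1
  -- The arbitrary point is a default outside the target and plays no role.
  invFun v := by
    classical
    exact if h : e₀ (v, 0) ∈ χ.target then
      ⟨χ.symm (e₀ (v, 0)), (hχ _ (χ.map_target h)).2 (by simp [χ.right_inv h])⟩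
    else Classical.arbitrary S
  source := Subtype.val ⁻¹' χ.source
  target := {v | e₀ (v, 0) ∈ χ.target}
  map_source' s hs := by
    have h2 := (hχ s hs).1 s.2
    have h3 : e₀ ((e₀.symm (χ s)).1, 0) = χ s := by
      rw [← h2]; exact e₀.apply_symm_apply _
    change e₀ ((e₀.symm (χ s)).1, 0) ∈ χ.target
    rw [h3]
    exact χ.map_source hs
  map_target' v hv := by
    have hv' : e₀ (v, 0) ∈ χ.target := hv
    rw [dif_pos hv']
    exact χ.map_target hv'
  left_inv' s hs := by
    have h2 := (hχ s hs).1 s.2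
    have h3 : e₀ ((e₀.symm (χ s)).1, 0) = χ s := by
      rw [← h2]; exact e₀.apply_symm_apply _
    have hv' : e₀ ((e₀.symm (χ s)).1, 0) ∈ χ.target := h3.symm ▸ χ.map_source hs
    rw [dif_pos hv']
    exact Subtype.ext (by simp only [h3]; exact χ.left_inv hs)
  right_inv' v hv := by
    have hv' : e₀ (v, 0) ∈ χ.target := hv
    rw [dif_pos hv']
    simp [χ.right_inv hv']
  open_source := χ.open_source.preimage continuous_subtype_val
  open_target := χ.open_target.preimage (by fun_prop)
  continuousOn_toFun := by
    have h1 : ContinuousOn χ χ.source := χ.continuousOn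
    have h2 : ContinuousOn (fun s : S => χ s) (Subtype.val ⁻¹' χ.source) :=
      h1.comp continuous_subtype_val.continuousOn fun s hs => hs
    exact (continuous_fst.comp e₀.symm.continuous).comp_continuousOn h2
  continuousOn_invFun := by
    rw [IsInducing.subtypeVal.continuousOn_iff]
    have h1 : ContinuousOn (fun v : K => χ.symm (e₀ (v, 0))) {v | e₀ (v, 0) ∈ χ.target} :=
      χ.symm.continuousOn.comp (by fun_prop) fun v hv => hv
    refine h1.congr fun v hv => ?_
    have hv' : e₀ (v, 0) ∈ χ.target := hv
    simp [dif_pos hv']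

theorem sliceChart_symm_coe (e₀ : (K × W) ≃L[ℝ] F) (S : Set Q) (χ : OpenPartialHomeomorph Q F)
    (hχ : ∀ z ∈ χ.source, z ∈ S ↔ (e₀.symm (χ z)).2 = 0) [Nonempty S] {v : K}
    (hv : v ∈ (sliceChart e₀ S χ hχ).target) :
    (((sliceChart e₀ S χ hχ).symm v : S) : Q) = χ.symm (e₀ (v, 0)) := by
  have hv' : e₀ (v, 0) ∈ χ.target := hv
  classical
  change ((dite (e₀ (v, 0) ∈ χ.target) _ _ : S) : Q) = _
  rw [dif_pos hv']

variable [FiniteDimensional ℝ F] [ChartedSpace F Q]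
  [IsManifold 𝓘(ℝ, F) ∞ Q]

/-- A map with surjective derivative is the second component of a chart. -/
theorem exists_chart_of_surjective_der [FiniteDimensional ℝ K]
    [FiniteDimensional ℝ W] (e₀ : (K × W) ≃L[ℝ] F) {V : Set Q} (hV : IsOpen V) {y : Q}
    (hy : y ∈ V) {Ψ : Q → W} (hΨ : ContMDiffOn 𝓘(ℝ, F) 𝓘(ℝ, W) ∞ Ψ V)
    (hs : Function.Surjective (der F W Ψ y)) :
    ∃ χ ∈ IsManifold.maximalAtlas 𝓘(ℝ, F) ∞ Q, y ∈ χ.source ∧ χ.source ⊆ V ∧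
      ∀ z ∈ χ.source, (e₀.symm (χ z)).2 = Ψ z := by
  set φ := chartAt F y
  have hφ : φ ∈ IsManifold.maximalAtlas 𝓘(ℝ, F) ∞ Q := IsManifold.chart_mem_maximalAtlas y
  have hyφ : y ∈ φ.source := mem_chart_source F y
  set U : Set F := φ.target ∩ φ.symm ⁻¹' V
  have hU : IsOpen U := φ.isOpen_inter_preimage_symm hV
  have hyU : φ y ∈ U := ⟨φ.map_source hyφ, by rw [mem_preimage, φ.left_inv hyφ]; exact hy⟩
  set f : F → W := Ψ ∘ φ.symm with hf
  have hfU : ContDiffOn ℝ ∞ f U := by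
    rw [← contMDiffOn_iff_contDiffOn]
    exact hΨ.comp ((contMDiffOn_symm_of_mem_maximalAtlas hφ).mono inter_subset_left)
      fun z hz => hz.2
  have hfd : DifferentiableAt ℝ f (φ y) :=
    (hfU.contDiffAt (hU.mem_nhds hyU)).differentiableAt (by simp)
  have hfs : Function.Surjective (fderiv ℝ f (φ y)) := by
    intro w
    obtain ⟨v, hv⟩ := hs w
    refine ⟨der F F φ y v, ?_⟩
    have h1 : MDifferentiableAt 𝓘(ℝ, F) 𝓘(ℝ, F) φ.symm (φ y) :=
      ((contMDiffOn_symm_of_mem_maximalAtlas hφ).contMDiffAt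
        (φ.open_target.mem_nhds hyU.1)).mdifferentiableAt (by simp)
    have h2 : MDifferentiableAt 𝓘(ℝ, F) 𝓘(ℝ, F) φ y :=
      (contMDiffAt_of_mem_maximalAtlas hφ hyφ).mdifferentiableAt (by simp)
    have h3 : MDifferentiableAt 𝓘(ℝ, F) 𝓘(ℝ, W) f (φ y) := hfd.mdifferentiableAt
    have h4 : der F W (f ∘ φ) y = der F W Ψ y := der_congr (by
      filter_upwards [φ.open_source.mem_nhds hyφ] with z hz
      simp [hf, φ.left_inv hz])
    rw [← hv, ← h4, der_comp_apply h3 h2, der_eq_fderiv]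
  have hd : Module.finrank ℝ F = Module.finrank ℝ K + Module.finrank ℝ W := by
    rw [← e₀.toLinearEquiv.finrank_eq, Module.finrank_prod]
  obtain ⟨p, e, he⟩ := exists_equiv_prod_of_surjective (K := K) _ hfs hd
  -- The linear map `p` supplies the coordinates missing from `f`, so the pair is a local
  -- diffeomorphism; `e₀` identifies its values with the model space.
  have hG : ContDiffOn ℝ ∞ (fun v => e₀ (p v, f v)) U :=
    e₀.contDiff.comp_contDiffOn (p.contDiff.contDiffOn.prodMk hfU)
  have hGd : HasFDerivAt (fun v => e₀ (p v, f v)) (e.trans e₀ : F →L[ℝ] F) (φ y) := by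
    have h1 := (e₀ : (K × W) →L[ℝ] F).hasFDerivAt.comp (φ y)
      (p.hasFDerivAt.prodMk hfd.hasFDerivAt)
    refine h1.congr_fderiv ?_
    ext v
    simp [he]
  obtain ⟨θ, hθ₁, hθ₂, hθ₃, hθ₄⟩ := exists_openPartialHomeomorph_of_hasFDerivAt hU hyU hG _ hGd
  have hsrc : ∀ z ∈ (φ ≫ₕ θ).source, z ∈ φ.source ∧ φ z ∈ θ.source := fun z hz => by
    simpa using hz
  refine ⟨φ ≫ₕ θ, ?_, ?_, ?_, ?_⟩
  · refine OpenPartialHomeomorph.mem_maximalAtlas_of_contMDiffOn _ ?_ ?_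
    · have hθ : ContMDiffOn 𝓘(ℝ, F) 𝓘(ℝ, F) ∞ θ θ.source :=
        ((hG.mono hθ₂).congr fun z _ => hθ₃ z).contMDiffOn
      exact hθ.comp ((contMDiffOn_of_mem_maximalAtlas hφ).mono fun z hz => (hsrc z hz).1)
        fun z hz => (hsrc z hz).2
    · refine (contMDiffOn_symm_of_mem_maximalAtlas hφ).comp
        (hθ₄.contMDiffOn.mono fun z hz => ?_) fun z hz => ?_
      · exact (OpenPartialHomeomorph.trans_target φ θ ▸ hz).1
      · exact (OpenPartialHomeomorph.trans_target φ θ ▸ hz).2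
  · simpa using ⟨hyφ, hθ₁⟩
  · intro z hz
    have := hθ₂ (hsrc z hz).2
    have h2 := this.2
    rwa [mem_preimage, φ.left_inv (hsrc z hz).1] at h2
  · intro z hz
    simp [hθ₃, hf, φ.left_inv (hsrc z hz).1]

/-- A subset that is locally the zero set of a map with surjective derivative is an embedded
submanifold. -/
theorem exists_submanifold_of_level_set (S : Set Q)
    (hS : ∀ y ∈ S, ∃ (V : Set Q) (Ψ : Q → W), IsOpen V ∧ y ∈ V ∧
      ContMDiffOn 𝓘(ℝ, F) 𝓘(ℝ, W) ∞ Ψ V ∧ Function.Surjective (der F W Ψ y) ∧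
      ∀ z ∈ V, z ∈ S ↔ Ψ z = 0) :
    ∃ (d : ℕ) (_ : ChartedSpace (EuclideanSpace ℝ (Fin d)) S) (_ : IsManifold (𝓡 d) ∞ S),
      Manifold.IsSmoothEmbedding (𝓡 d) 𝓘(ℝ, F) ∞ (Subtype.val : S → Q) ∧
        (S.Nonempty → d + Module.finrank ℝ W = Module.finrank ℝ F) := by
  rcases S.eq_empty_or_nonempty with rfl | hne
  -- An empty `S` is given dimension zero; this is why the dimension formula is stated for nonempty
  -- `S` only.
  · let cs : ChartedSpace (EuclideanSpace ℝ (Fin 0)) (∅ : Set Q) := ChartedSpace.empty _ _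
    refine ⟨0, cs, isManifold_of_contDiffOn _ _ _ ?_, ⟨?_, ?_⟩, fun h => absurd h not_nonempty_empty⟩
    · intro e e' he
      exact he.elim
    · exact ⟨PUnit, inferInstance, inferInstance, fun x => x.2.elim⟩
    · exact IsEmbedding.subtypeVal
  have : Nonempty S := hne.to_subtype
  obtain ⟨y₀, hy₀⟩ := hne
  obtain ⟨V₀, Ψ₀, -, -, -, hsur₀, -⟩ := hS y₀ hy₀
  have : FiniteDimensional ℝ W :=
    Module.Finite.of_surjective (der F W Ψ₀ y₀).toLinearMap hsur₀
  set d := Module.finrank ℝ F - Module.finrank ℝ W with hd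
  have hle : Module.finrank ℝ W ≤ Module.finrank ℝ F :=
    LinearMap.finrank_le_finrank_of_surjective (f := (der F W Ψ₀ y₀).toLinearMap) hsur₀
  set K := EuclideanSpace ℝ (Fin d)
  have hrank : Module.finrank ℝ (K × W) = Module.finrank ℝ F := by
    rw [Module.finrank_prod, finrank_euclideanSpace_fin]
    omega
  set e₀ : (K × W) ≃L[ℝ] F := ContinuousLinearEquiv.ofFinrankEq hrank
  have hch : ∀ s : S, ∃ χ ∈ IsManifold.maximalAtlas 𝓘(ℝ, F) ∞ Q, (s : Q) ∈ χ.source ∧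
      ∀ z ∈ χ.source, z ∈ S ↔ (e₀.symm (χ z)).2 = 0 := by
    intro s
    obtain ⟨V, Ψ, hV, hsV, hΨ, hsur, hiff⟩ := hS s s.2
    obtain ⟨χ, h1, h2, h3, h4⟩ := exists_chart_of_surjective_der e₀ hV hsV hΨ hsur
    exact ⟨χ, h1, h2, fun z hz => by rw [hiff z (h3 hz), h4 z hz]⟩
  choose χ hχ hmem hχS using hch
  let ψ : S → OpenPartialHomeomorph S K := fun s => sliceChart e₀ S (χ s) (hχS s)
  let cs : ChartedSpace K S :=
    { atlas := range ψ
      chartAt := ψ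
      mem_chart_source := fun s => hmem s
      chart_mem_atlas := fun s => mem_range_self s }
  have hm : IsManifold (𝓡 d) ∞ S := by
    refine isManifold_of_contDiffOn _ _ _ ?_
    rintro _ _ ⟨s, rfl⟩ ⟨s', rfl⟩
    simp only [modelWithCornersSelf_coe, modelWithCornersSelf_coe_symm, Function.id_comp,
      Function.comp_id, preimage_id, range_id, inter_univ]
    have h1 : ContMDiffOn 𝓘(ℝ, F) 𝓘(ℝ, F) ∞ ((χ s') ∘ (χ s).symm)
        ((χ s).target ∩ (χ s).symm ⁻¹' (χ s').source) :=
      (contMDiffOn_of_mem_maximalAtlas (hχ s')).comp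
        ((contMDiffOn_symm_of_mem_maximalAtlas (hχ s)).mono inter_subset_left) fun z hz => hz.2
    rw [contMDiffOn_iff_contDiffOn] at h1
    have hmaps : ∀ v ∈ ((ψ s).symm ≫ₕ ψ s').source,
        e₀ (v, 0) ∈ (χ s).target ∩ (χ s).symm ⁻¹' (χ s').source := by
      intro v hv
      have hv1 : v ∈ (ψ s).target := hv.1
      have hv2 : (((ψ s).symm v : S) : Q) ∈ (χ s').source := hv.2
      rw [sliceChart_symm_coe e₀ S (χ s) (hχS s) hv1] at hv2
      exact ⟨hv1, hv2⟩
    have h2 : ContDiffOn ℝ ∞ (fun v : K => (e₀.symm (χ s' ((χ s).symm (e₀ (v, 0))))).1)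
        ((ψ s).symm ≫ₕ ψ s').source := by
      have h3 : ContDiff ℝ ∞ (fun v : K => e₀ (v, 0)) := by fun_prop
      have h4 : ContDiff ℝ ∞ (fun v : F => (e₀.symm v).1) := by fun_prop
      exact h4.comp_contDiffOn (h1.comp h3.contDiffOn hmaps)
    refine h2.congr fun v hv => ?_
    change (e₀.symm (χ s' (((ψ s).symm v : S) : Q))).1 = _
    rw [sliceChart_symm_coe e₀ S (χ s) (hχS s) hv.1]
  refine ⟨d, cs, hm, ⟨?_, IsEmbedding.subtypeVal⟩, fun _ => Nat.sub_add_cancel hle⟩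
  -- In the charts `ψ s` and `χ s` the inclusion is `v ↦ e₀ (v, 0)`, the normal form of an
  -- immersion.
  refine Manifold.IsImmersionOfComplement.isImmersion (F := W) fun s => ?_
  refine Manifold.IsImmersionAtOfComplement.mk_of_charts e₀ (ψ s) (χ s) (hmem s) (hmem s)
    (IsManifold.subset_maximalAtlas (mem_range_self s)) (hχ s) (fun z hz => hz) ?_
  intro v hv
  have hv1 : v ∈ (ψ s).target := by simpa using hv
  have hv2 : e₀ (v, 0) ∈ (χ s).target := hv1
  simp only [Function.comp_apply, OpenPartialHomeomorph.extend_coe,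
    OpenPartialHomeomorph.extend_coe_symm, modelWithCornersSelf_coe, modelWithCornersSelf_coe_symm,
    id_eq]
  rw [sliceChart_symm_coe e₀ S (χ s) (hχS s) hv1]
  exact (χ s).right_inv hv2

end LevelSet

/-! ### Invariant submanifolds and their quotients -/

section InvariantSubmanifold

variable {g : Type*} [LieRing g] [LieAlgebra ℝ g] {c : LieSubalgebra ℝ g} {h : LieIdeal ℝ c}
  {F : Type*} [NormedAddCommGroup F] [NormedSpace ℝ F]
  {O : Type*} [TopologicalSpace O] [ChartedSpace F O] [IsManifold 𝓘(ℝ, F) ∞ O]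
  {G : Type*} [NormedAddCommGroup G] [NormedSpace ℝ G]
  {N : Type*} [TopologicalSpace N] [ChartedSpace G N] [IsManifold 𝓘(ℝ, G) ∞ N]
  {K : Type*} [NormedAddCommGroup K] [NormedSpace ℝ K]
  {Q : Type*} [TopologicalSpace Q] [ChartedSpace K Q] [IsManifold 𝓘(ℝ, K) ∞ Q]
  {B : Action g G N} {A : Action c F O} {i : O → N} {q : O → Q}

theorem idealSpan_le : idealSpan h ≤ c.toSubmodule := by
  rintro _ ⟨v, -, rfl⟩
  exact v.2

theorem Action.SameOrbit.mono {h₁ h₂ : Submodule ℝ g} (hle : h₁ ≤ h₂) {x y : N}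
    (hxy : B.SameOrbit h₁ x y) : B.SameOrbit h₂ x y :=
  Relation.EqvGen.mono (p := B.FlowsTo h₂) (fun _ _ ⟨u, hu, γ, hγ⟩ => ⟨u, hle hu, γ, hγ⟩)
    _ _ hxy

theorem Action.IsInvariantSet.mono {h₁ h₂ : Submodule ℝ g} (hle : h₁ ≤ h₂) {S : Set N}
    (hS : B.IsInvariantSet h₂ S) : B.IsInvariantSet h₁ S :=
  fun x y hxy => hS x y (hxy.mono hle)

/-- The restriction of an action to a Lie subalgebra. -/
noncomputable def Action.restrict (B : Action g G N) (c : LieSubalgebra ℝ g) : Action c G N where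
  ρ x := B.ρ x ∘ₗ c.toSubmodule.subtype
  smooth u := B.smooth u
  map_lie u v x := B.map_lie u v x

/-- The action of `c` restricts to a `c`-invariant submanifold. -/
theorem Action.exists_restrict_of_isInvariantSet [FiniteDimensional ℝ F] [FiniteDimensional ℝ G]
    [T2Space N] (B : Action g G N) (hi : Manifold.IsSmoothEmbedding 𝓘(ℝ, F) 𝓘(ℝ, G) ∞ i)
    (hO : B.IsInvariantSet c.toSubmodule (range i)) :
    ∃ A : Action c F O, ∀ u : c, Related A B i u (u : g) := by
  refine Action.exists_restrict (B.restrict c) hi fun a u => ?_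
  obtain ⟨γ, hγ0, hγd, hγ', hγ⟩ := B.exists_curve (h := c.toSubmodule) u.2 (i a)
  obtain ⟨w, hw⟩ := embedding_der_curve_mem_range hi hγd
    (hγ.mono fun s hs => hO _ _ (.rel _ _ hs) (mem_range_self a)) hγ0.symm
  exact ⟨w, hw.trans hγ'⟩

omit [IsManifold 𝓘(ℝ, K) ∞ Q] in
/-- The quotient `O / h` for the ambient action is the quotient for the restricted action. -/
theorem IsOrbitQuotient.of_restrict (hi : Manifold.IsSmoothEmbedding 𝓘(ℝ, F) 𝓘(ℝ, G) ∞ i)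
    (hO : B.IsInvariantSet c.toSubmodule (range i))
    (hA : ∀ u : c, Related A B i u (u : g))
    (hq : IsOrbitQuotient (E₁ := F) (E₂ := K) B (idealSpan h) i q) :
    IsOrbitQuotient (E₁ := F) (E₂ := K) A h.toSubmodule id q where
  surjective := hq.surjective
  submersion := hq.submersion
  fibres a b := by
    rw [hq.fibres]
    constructor
    · intro hab
      refine Action.SameOrbit.lift hi (fun w hw => ?_) (hO.mono idealSpan_le) hab a b rfl rfl
      obtain ⟨v, hv, rfl⟩ := mem_idealSpan.1 hw
      exact ⟨v, hv, hA v⟩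
    · intro hab
      exact Action.SameOrbit.map (A := A) (B := B) (f := i) (h := h.toSubmodule)
        hi.isImmersion.contMDiff (fun u hu => ⟨(u : g), mem_idealSpan.2 ⟨u, hu, rfl⟩, hA u⟩) hab

/-- `c` acts on an invariant submanifold `O`, and `c / h` acts on `O / h`. -/
theorem IsOrbitQuotient.exists_actions [FiniteDimensional ℝ F] [FiniteDimensional ℝ G]
    [T2Space N] [FiniteDimensional ℝ K] [T2Space Q]
    (hi : Manifold.IsSmoothEmbedding 𝓘(ℝ, F) 𝓘(ℝ, G) ∞ i)
    (hO : B.IsInvariantSet c.toSubmodule (range i))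
    (hq : IsOrbitQuotient (E₁ := F) (E₂ := K) B (idealSpan h) i q) :
    ∃ (A : Action c F O) (BQ : Action (c ⧸ h) K Q),
      IsOrbitQuotient (E₁ := F) (E₂ := K) A h.toSubmodule id q ∧
      (∀ u : c, Related A B i u (u : g)) ∧
      ∀ u : c, Related A BQ q u (LieSubmodule.Quotient.mk u) := by
  obtain ⟨A, hA⟩ := B.exists_restrict_of_isInvariantSet hi hO
  have : T2Space O := hi.isEmbedding.t2Space
  have hq' := hq.of_restrict hi hO hA
  obtain ⟨BQ, hBQ⟩ := hq'.exists_action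
  exact ⟨A, BQ, hq', hA, hBQ⟩

/-- Exchanging `α` and `β` reverses the sign of the `π` term of `σ` and preserves the `t` term, so
both vanish. -/
theorem QPStructure.IsCommutative.dual_sharp_eq_zero {t : g ⊗[ℝ] g} (ht : IsInvariantSymmetric t)
    {P : QPStructure t G N} (hP : P.IsCommutative) (x : N) (α β : Cotangent G x) :
    P.dual x β (sharp t (P.dual x α)) = 0 := by
  have h1 := hP x α β
  have h2 := hP x β α
  have h3 := P.skew x α β
  have h4 := ht.sharp_symm (P.dual x α) (P.dual x β)
  simp only [QPStructure.σ] at h1 h2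
  linarith

/-- If `N` is quasi-Poisson-commutative then `ρ ⊗ ρ (t') = 0` on `O / h`. -/
theorem IsOrbitQuotient.dual_sharp_eq_zero {t : g ⊗[ℝ] g} {t' : (c ⧸ h) ⊗[ℝ] (c ⧸ h)}
    (ht : IsInvariantSymmetric t) (hh : perp t c ≤ idealSpan h) (htt' : DescendsTo h t t')
    {P : QPStructure t G N} (hP : P.IsCommutative)
    (hi : Manifold.IsSmoothEmbedding 𝓘(ℝ, F) 𝓘(ℝ, G) ∞ i)
    (hA : ∀ u : c, Related A P.toAction i u (u : g))
    {BQ : Action (c ⧸ h) K Q} (hsurj : Function.Surjective q)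
    (hBQ : ∀ u : c, Related A BQ q u (LieSubmodule.Quotient.mk u))
    (y : Q) (α β : Cotangent K y) : BQ.dual y β (sharp t' (BQ.dual y α)) = 0 := by
  obtain ⟨a, rfl⟩ := hsurj y
  obtain ⟨W, _, _, hsl⟩ := embedding_exists_sliceData hi
  obtain ⟨U, r, Φ, hS⟩ := hsl a
  -- `D` sends `ρ(u)` at `i a` to `ρ` of the class of `u` at `q a`. So `α ∘ D` is a covector on `N`
  -- whose functional on `c` descends to that of `α`, and `t'` can be replaced by `t`.
  let D : G →L[ℝ] K := (der F K q a).comp (der G F r (i a))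
  have hD : ∀ u : c, D (P.ρ (i a) (u : g)) = BQ.ρ (q a) (LieSubmodule.Quotient.mk u) := by
    intro u
    have h1 : der F G i a (A.ρ a u) = P.ρ (i a) (u : g) := hA u a
    have h2 : der F K q a (A.ρ a u) = BQ.ρ (q a) (LieSubmodule.Quotient.mk u) := hBQ u a
    rw [← h2, ← h1]
    exact congrArg (der F K q a) (hS.der_r_der hi.isImmersion.contMDiff _)
  have hext : ∀ (α : K →L[ℝ] ℝ) (u : c), P.dual (i a) (α.comp D) (u : g) =
      BQ.dual (q a) α (LieSubmodule.Quotient.mk u) := fun α u => congrArg α (hD u)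
  rw [← htt'.sharp_apply ht hh (hext α) (hext β)]
  exact hP.dual_sharp_eq_zero ht (i a) (α.comp D) (β.comp D)

end InvariantSubmanifold

/-! ### Centrality as an identity of covectors -/

section Central

variable {g : Type*} [LieRing g] [LieAlgebra ℝ g] {t : g ⊗[ℝ] g}
  {E : Type*} [NormedAddCommGroup E] [NormedSpace ℝ E]
  {M : Type*} [TopologicalSpace M] [ChartedSpace E M] [IsManifold 𝓘(ℝ, E) ∞ M]
  {F : Type*} [NormedAddCommGroup F] [NormedSpace ℝ F]
  {N : Type*} [TopologicalSpace N] [ChartedSpace F N] [IsManifold 𝓘(ℝ, F) ∞ N]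
  {P : QPStructure t E M} {R : QPStructure t F N} {f : M → N}

/-- `π(f^*κ, ·) = ε t(ρ^*κ, ρ^*·)`: for equivariant maps to a commutative manifold and a symmetric
`t`, left centrality is the case `ε = -½` and right centrality the case `ε = ½`. -/
def IsCentralWith (ε : ℝ) (P : QPStructure t E M) (R : QPStructure t F N) (f : M → N) : Prop :=
  ∀ (x : M) (κ : F →L[ℝ] ℝ) (γ : E →L[ℝ] ℝ),
    P.π x (κ.comp (der E F f x)) γ = ε * P.dual x γ (sharp t (R.dual (f x) κ))

theorem IsEquivariant.dual_comp {A : Action g E M} {B : Action g F N} (hf : IsEquivariant A B f)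
    (x : M) (κ : F →L[ℝ] ℝ) : A.dual x (κ.comp (der E F f x)) = B.dual (f x) κ := by
  ext u
  exact congrArg κ (hf u x)

/-- Every covector on `N` is the differential of a function there, and equivariance turns `ρ^* f^*
κ` into `ρ^* κ`. -/
theorem IsLeftCentralMap.isCentralWith [FiniteDimensional ℝ F] [T2Space N]
    (hf : IsLeftCentralMap P R f) : IsCentralWith (-(1 / 2)) P R f := by
  intro x κ γ
  obtain ⟨φ, hφ, hd⟩ := exists_diff_eq (x := f x) κ
  have h1 := (hf.central φ hφ).2 x γ
  have h2 : diff E (φ ∘ f) x = κ.comp (der E F f x) := by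
    rw [← hd]
    exact der_comp (hφ.mdifferentiableAt _) (hf.smooth.mdifferentiableAt (by simp))
  have h3 := hf.equivariant.dual_comp x κ
  rw [h2] at h1
  rw [← h3]
  have h4 : P.π x (κ.comp (der E F f x)) γ + (1 / 2 : ℝ) *
    P.dual x γ (sharp t (P.dual x (κ.comp (der E F f x)))) = 0 := h1
  linarith

/-- As for left central maps; moving `f^* κ` into the first slot reverses the sign of `π` but not of
`t`, hence the opposite `ε`. -/
theorem IsRightCentralMap.isCentralWith [FiniteDimensional ℝ F] [T2Space N]
    (ht : IsInvariantSymmetric t) (hf : IsRightCentralMap P R f) :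
    IsCentralWith (1 / 2) P R f := by
  intro x κ γ
  obtain ⟨φ, hφ, hd⟩ := exists_diff_eq (x := f x) κ
  have h1 := (hf.central φ hφ).2 x γ
  have h2 : diff E (φ ∘ f) x = κ.comp (der E F f x) := by
    rw [← hd]
    exact der_comp (hφ.mdifferentiableAt _) (hf.smooth.mdifferentiableAt (by simp))
  have h3 := hf.equivariant.dual_comp x κ
  rw [h2] at h1
  rw [← h3, ht.sharp_symm]
  have h4 : P.π x γ (κ.comp (der E F f x)) + (1 / 2 : ℝ) *
    P.dual x (κ.comp (der E F f x)) (sharp t (P.dual x γ)) = 0 := h1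
  have h5 : P.π x γ (κ.comp (der E F f x)) = -P.π x (κ.comp (der E F f x)) γ := P.skew x _ _
  linarith

theorem IsCentralWith.isLeftCentralMap (hc : R.IsCommutative)
    (hs : ContMDiff 𝓘(ℝ, E) 𝓘(ℝ, F) ∞ f) (he : IsEquivariant P.toAction R.toAction f)
    (hf : IsCentralWith (-(1 / 2)) P R f) : IsLeftCentralMap P R f where
  commutative := hc
  smooth := hs
  equivariant := he
  central φ hφ := by
    refine ⟨hφ.comp hs, fun x β => ?_⟩
    have h2 : diff E (φ ∘ f) x = ((der F ℝ φ (f x)).comp (der E F f x) : E →L[ℝ] ℝ) :=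
      der_comp (hφ.mdifferentiableAt _) (hs.mdifferentiableAt (by simp))
    have h3 := hf x (der F ℝ φ (f x)) β
    rw [h2]
    change P.π x ((der F ℝ φ (f x)).comp (der E F f x)) β + (1 / 2 : ℝ) *
      P.dual x β (sharp t (P.dual x ((der F ℝ φ (f x)).comp (der E F f x)))) = 0
    rw [he.dual_comp, h3]
    ring

theorem IsCentralWith.isRightCentralMap (ht : IsInvariantSymmetric t) (hc : R.IsCommutative)
    (hs : ContMDiff 𝓘(ℝ, E) 𝓘(ℝ, F) ∞ f) (he : IsEquivariant P.toAction R.toAction f)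
    (hf : IsCentralWith (1 / 2) P R f) : IsRightCentralMap P R f where
  commutative := hc
  smooth := hs
  equivariant := he
  central φ hφ := by
    refine ⟨hφ.comp hs, fun x α => ?_⟩
    have h2 : diff E (φ ∘ f) x = ((der F ℝ φ (f x)).comp (der E F f x) : E →L[ℝ] ℝ) :=
      der_comp (hφ.mdifferentiableAt _) (hs.mdifferentiableAt (by simp))
    have h3 := hf x (der F ℝ φ (f x)) α
    have h4 : P.π x α ((der F ℝ φ (f x)).comp (der E F f x)) =
      -P.π x ((der F ℝ φ (f x)).comp (der E F f x)) α := P.skew x _ _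
    rw [h2]
    change P.π x α ((der F ℝ φ (f x)).comp (der E F f x)) + (1 / 2 : ℝ) *
      P.dual x ((der F ℝ φ (f x)).comp (der E F f x)) (sharp t (P.dual x α)) = 0
    rw [he.dual_comp, h4, h3, ht.sharp_symm (P.dual x α)]
    ring

end Central

/-! ### Maps induced on the reduced spaces -/

section InducedMap

variable {g : Type*} [LieRing g] [LieAlgebra ℝ g] {c : LieSubalgebra ℝ g} {h : LieIdeal ℝ c}
  {t : g ⊗[ℝ] g} {t' : (c ⧸ h) ⊗[ℝ] (c ⧸ h)}
  {E : Type*} [NormedAddCommGroup E] [NormedSpace ℝ E]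
  {M : Type*} [TopologicalSpace M] [ChartedSpace E M] [IsManifold 𝓘(ℝ, E) ∞ M]
  {G : Type*} [NormedAddCommGroup G] [NormedSpace ℝ G]
  {N : Type*} [TopologicalSpace N] [ChartedSpace G N] [IsManifold 𝓘(ℝ, G) ∞ N]
  {F : Type*} [NormedAddCommGroup F] [NormedSpace ℝ F]
  {O : Type*} [TopologicalSpace O] [ChartedSpace F O] [IsManifold 𝓘(ℝ, F) ∞ O]
  {EQ : Type*} [NormedAddCommGroup EQ] [NormedSpace ℝ EQ]
  {Q : Type*} [TopologicalSpace Q] [ChartedSpace EQ Q] [IsManifold 𝓘(ℝ, EQ) ∞ Q]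
  {K : Type*} [NormedAddCommGroup K] [NormedSpace ℝ K]
  {QO : Type*} [TopologicalSpace QO] [ChartedSpace K QO] [IsManifold 𝓘(ℝ, K) ∞ QO]
  {P : QPStructure t E M} {PN : QPStructure t G N} {PQ : QPStructure t' EQ Q}
  {PO : QPStructure t' K QO} {A : Action c F O}
  {μ : M → N} {i : O → N} {q : M → Q} {qO : O → QO} {Z : Set M}

/-- A set that is saturated for the quotient map. -/
def IsSaturated {X Y : Type*} (q : X → Y) (Z : Set X) : Prop := ∀ x y, q x = q y → x ∈ Z → y ∈ Z

theorem IsEquivariant.sameOrbit (hs : ContMDiff 𝓘(ℝ, E) 𝓘(ℝ, G) ∞ μ)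
    (he : IsEquivariant P.toAction PN.toAction μ) {k : Submodule ℝ g} {x y : M}
    (hxy : P.SameOrbit k x y) : PN.SameOrbit k (μ x) (μ y) :=
  Action.SameOrbit.map (A := P.toAction) (B := PN.toAction) (h := k) (h' := k) hs
    (fun u hu => ⟨u, hu, he u⟩) hxy

omit [IsManifold 𝓘(ℝ, F) ∞ O] [IsManifold 𝓘(ℝ, EQ) ∞ Q] [IsManifold 𝓘(ℝ, K) ∞ QO] in
/-- The map of quotients induced by an equivariant map. -/
theorem exists_inducedMap (hs : ContMDiff 𝓘(ℝ, E) 𝓘(ℝ, G) ∞ μ)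
    (he : IsEquivariant P.toAction PN.toAction μ)
    (hq : IsOrbitQuotient (E₁ := E) (E₂ := EQ) P.toAction (idealSpan h) id q)
    (hqO : IsOrbitQuotient (E₁ := F) (E₂ := K) PN.toAction (idealSpan h) i qO)
    (hZi : Z ⊆ μ ⁻¹' range i) :
    ∃ ν : q '' Z → QO, ∀ (x : M) (hx : x ∈ Z) (a : O), i a = μ x →
      ν ⟨q x, mem_image_of_mem q hx⟩ = qO a := by
  have hch : ∀ y : q '' Z, ∃ b : QO, ∀ x ∈ Z, q x = y → ∀ a, i a = μ x → qO a = b := by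
    rintro ⟨_, x, hx, rfl⟩
    obtain ⟨a, ha⟩ := hZi hx
    refine ⟨qO a, fun x' hx' hqx a' ha' => ?_⟩
    rw [hqO.fibres, ha, ha']
    exact he.sameOrbit hs ((hq.fibres x' x).1 hqx)
  choose ν hν using hch
  exact ⟨ν, fun x hx a ha => (hν _ x hx rfl a ha).symm⟩

variable {d : Type*} [NormedAddCommGroup d] [NormedSpace ℝ d] [ChartedSpace d (q '' Z)]
  [IsManifold 𝓘(ℝ, d) ∞ (q '' Z)] {P' : QPStructure t' d (q '' Z)} {ν : q '' Z → QO}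

omit [IsManifold 𝓘(ℝ, F) ∞ O] [IsManifold 𝓘(ℝ, EQ) ∞ Q] [IsManifold 𝓘(ℝ, K) ∞ QO]
  [IsManifold 𝓘(ℝ, d) ∞ (q '' Z)] in
/-- Near a point of `M`, the induced map on quotients is `q_O ∘ r ∘ μ` for a local retraction `r`
to the submanifold. -/
theorem inducedMap_local (hs : ContMDiff 𝓘(ℝ, E) 𝓘(ℝ, G) ∞ μ)
    (hi : Manifold.IsSmoothEmbedding 𝓘(ℝ, F) 𝓘(ℝ, G) ∞ i)
    (hq : IsOrbitQuotient (E₁ := E) (E₂ := EQ) P.toAction (idealSpan h) id q)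
    (hqO : IsOrbitQuotient (E₁ := F) (E₂ := K) PN.toAction (idealSpan h) i qO)
    (hZi : Z ⊆ μ ⁻¹' range i) (hZ : IsSaturated q Z)
    (hval : ContMDiff 𝓘(ℝ, d) 𝓘(ℝ, EQ) ∞ (Subtype.val : q '' Z → Q))
    (hν : ∀ (x : M) (hx : x ∈ Z) (a : O), i a = μ x → ν ⟨q x, mem_image_of_mem q hx⟩ = qO a)
    {x : M} (hx : x ∈ Z) {a : O} (ha : i a = μ x) :
    ContMDiffAt 𝓘(ℝ, d) 𝓘(ℝ, K) ∞ ν ⟨q x, mem_image_of_mem q hx⟩ ∧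
    ∃ (D : G →L[ℝ] F) (S : EQ →L[ℝ] E), (∀ v, D (der F G i a v) = v) ∧
      (∀ v, (der F K qO a) (D (der E G μ x (S (der E EQ q x v)))) =
        der F K qO a (D (der E G μ x v))) ∧
      ∀ w, der d K ν ⟨q x, mem_image_of_mem q hx⟩ w = der F K qO a (D (der E G μ x
        (S (der d EQ Subtype.val (⟨q x, mem_image_of_mem q hx⟩ : q '' Z) w)))) := by
  set y₀ : q '' Z := ⟨q x, mem_image_of_mem q hx⟩ with hy₀
  obtain ⟨W, _, _, hsl⟩ := embedding_exists_sliceData hi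
  obtain ⟨U, r, Φ, hS⟩ := hsl a
  obtain ⟨V, s, hV, hxV, hsV, hsx, hqs⟩ := submersion_exists_section hq.submersion x
  have hsm : MDifferentiableAt 𝓘(ℝ, EQ) 𝓘(ℝ, E) s (q x) := hsV.mdifferentiableAt_of_mem hV hxV
  have hsc : ContMDiffAt 𝓘(ℝ, EQ) 𝓘(ℝ, E) ∞ s (q x) := hsV.contMDiffAt (hV.mem_nhds hxV)
  -- `Λ` agrees with `ν ∘ q` on `Z` near `x`, but it is defined and smooth on a whole neighbourhood
  -- of `x` in `M`.
  set Λ : M → QO := fun z => qO (r (μ z)) with hΛ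
  have hrU : ContMDiffAt 𝓘(ℝ, G) 𝓘(ℝ, F) ∞ r (μ x) :=
    hS.smooth_r.contMDiffAt (hS.isOpen.mem_nhds (ha ▸ hS.mem))
  have hrm : MDifferentiableAt 𝓘(ℝ, G) 𝓘(ℝ, F) r (μ x) := hrU.mdifferentiableAt (by simp)
  have hra : r (μ x) = a := ha ▸ hS.r_apply
  have hΛs : ContMDiffAt 𝓘(ℝ, E) 𝓘(ℝ, K) ∞ Λ x :=
    hqO.submersion.contMDiff.contMDiffAt.comp x (hrU.comp x hs.contMDiffAt)
  have hμm : MDifferentiableAt 𝓘(ℝ, E) 𝓘(ℝ, G) μ x := hs.mdifferentiableAt (by simp)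
  have hqOm : MDifferentiableAt 𝓘(ℝ, F) 𝓘(ℝ, K) qO a :=
    hqO.submersion.contMDiff.mdifferentiableAt (by simp)
  have hμU : ∀ᶠ x' in 𝓝 x, μ x' ∈ U :=
    hs.continuous.continuousAt.eventually (hS.isOpen.mem_nhds (ha ▸ hS.mem))
  have hΛder : ∀ v, der E K Λ x v = der F K qO a (der G F r (μ x) (der E G μ x v)) := by
    intro v
    have h1 := der_comp_apply (j := qO) (i := r ∘ μ) (x := x)
      (by rw [Function.comp_apply, hra]; exact hqOm) (hrm.comp x hμm) v
    rw [der_comp_apply hrm hμm, Function.comp_apply, hra] at h1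
    exact h1
  have hΛν : ∀ x' (hx' : x' ∈ Z), μ x' ∈ U → ν ⟨q x', mem_image_of_mem q hx'⟩ = Λ x' := by
    intro x' hx' hU
    obtain ⟨b, hb⟩ := hZi hx'
    rw [hν x' hx' b hb, hΛ]
    simp only
    rw [← hb, hS.leftInv b (by rw [hb]; exact hU)]
  -- By saturation the fibre of `q` through `x` lies in `Z`, where `Λ` equals `ν ∘ q` near `x` and
  -- so is constant along the fibre.
  have hker : ∀ v, der E EQ q x v = 0 → der E K Λ x v = 0 := by
    intro v hv
    refine submersion_der_eq_zero hq.submersion (hΛs.mdifferentiableAt (by simp)) ?_ hv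
    filter_upwards [hμU] with x' hU hqx
    have hx' : x' ∈ Z := hZ x x' hqx.symm hx
    rw [← hΛν x' hx' hU, ← hΛν x hx (ha ▸ hS.mem)]
    exact congrArg ν (Subtype.ext hqx)
  have hsq : ∀ w, der E EQ q x (der EQ E s (q x) w) = w := by
    intro w
    have h1 := der_comp_apply (j := q) (i := s) (x := q x)
      (hq.submersion.contMDiff.mdifferentiableAt (by simp)) hsm w
    rw [hsx, der_congr (j := id), der_id] at h1
    · exact h1.symm
    · filter_upwards [hV.mem_nhds hxV] with y hy using hqs y hy
  have hνloc : ν =ᶠ[𝓝 y₀] (Λ ∘ s) ∘ Subtype.val := by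
    have h1 : ∀ᶠ y in 𝓝 (q x), y ∈ V ∧ μ (s y) ∈ U :=
      Filter.Eventually.and (hV.mem_nhds hxV)
        (hsc.continuousAt.eventually (by rw [hsx]; exact hμU))
    filter_upwards [continuous_subtype_val.continuousAt.eventually h1] with y hy
    obtain ⟨z, hz, hzy⟩ := y.2
    have hqy : q (s y) = y := hqs y hy.1
    have hsZ : s y ∈ Z := hZ z (s y) (hzy.trans hqy.symm) hz
    have h2 : y = ⟨q (s y), mem_image_of_mem q hsZ⟩ := Subtype.ext hqy.symm
    calc ν y = ν ⟨q (s y), mem_image_of_mem q hsZ⟩ := congrArg ν h2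
      _ = Λ (s y) := hΛν _ hsZ hy.2
  have hΛsc : ContMDiffAt 𝓘(ℝ, EQ) 𝓘(ℝ, K) ∞ (Λ ∘ s) (q x) :=
    ContMDiffAt.comp (q x) (by rw [hsx]; exact hΛs) hsc
  refine ⟨?_, der G F r (μ x), der EQ E s (q x), ?_, ?_, ?_⟩
  · exact (ContMDiffAt.comp y₀ hΛsc hval.contMDiffAt).congr_of_eventuallyEq hνloc
  · intro v
    rw [← ha]
    exact hS.der_r_der hi.isImmersion.contMDiff v
  · intro v
    rw [← hΛder, ← hΛder, ← sub_eq_zero, ← map_sub]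
    apply hker
    rw [map_sub, hsq, sub_self]
  · intro w
    rw [der_congr hνloc, der_comp_apply (i := (Subtype.val : q '' Z → Q)) (x := y₀)
      (hΛsc.mdifferentiableAt (by simp)) (hval.mdifferentiableAt (by simp)), ← hΛder]
    have h1 := der_comp_apply (j := Λ) (i := s) (x := q x)
      (by rw [hsx]; exact hΛs.mdifferentiableAt (by simp)) hsm
    rw [hsx] at h1
    exact h1 _

/-- The map induced on the reduced spaces is smooth, equivariant and central. -/
theorem inducedMap_central {ε : ℝ} (ht : IsInvariantSymmetric t) (hh : perp t c ≤ idealSpan h)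
    (htt' : DescendsTo h t t') (hs : ContMDiff 𝓘(ℝ, E) 𝓘(ℝ, G) ∞ μ)
    (he : IsEquivariant P.toAction PN.toAction μ) (hε : IsCentralWith ε P PN μ)
    (hi : Manifold.IsSmoothEmbedding 𝓘(ℝ, F) 𝓘(ℝ, G) ∞ i)
    (hq : IsOrbitQuotient (E₁ := E) (E₂ := EQ) P.toAction (idealSpan h) id q)
    (hqO : IsOrbitQuotient (E₁ := F) (E₂ := K) PN.toAction (idealSpan h) i qO)
    (hPQ : ∀ u : c, Related P.toAction PQ.toAction q (u : g) (LieSubmodule.Quotient.mk u))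
    (hπ : PushesForward P.π PQ.π q)
    (hA : ∀ u : c, Related A PN.toAction i u (u : g))
    (hAO : ∀ u : c, Related A PO.toAction qO u (LieSubmodule.Quotient.mk u))
    (hZi : Z ⊆ μ ⁻¹' range i) (hZ : IsSaturated q Z)
    (hval : Manifold.IsSmoothEmbedding 𝓘(ℝ, d) 𝓘(ℝ, EQ) ∞ (Subtype.val : q '' Z → Q))
    (hP' : IsQuasiPoissonMap P' PQ Subtype.val) [FiniteDimensional ℝ EQ]
    (hν : ∀ (x : M) (hx : x ∈ Z) (a : O), i a = μ x → ν ⟨q x, mem_image_of_mem q hx⟩ = qO a) :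
    ContMDiff 𝓘(ℝ, d) 𝓘(ℝ, K) ∞ ν ∧ IsEquivariant P'.toAction PO.toAction ν ∧
      IsCentralWith ε P' PO ν := by
  have key := fun {x : M} (hx : x ∈ Z) {a : O} (ha : i a = μ x) =>
    inducedMap_local hs hi hq hqO hZi hZ hval.isImmersion.contMDiff hν hx ha
  -- the action on `S` in terms of the action on `M`
  have hact : ∀ x (hx : x ∈ Z) (u : c),
      der d EQ Subtype.val (⟨q x, mem_image_of_mem q hx⟩ : q '' Z)
        (P'.ρ ⟨q x, mem_image_of_mem q hx⟩ (LieSubmodule.Quotient.mk u)) =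
      der E EQ q x (P.ρ x (u : g)) := by
    intro x hx u
    have h1 := hP'.equivariant (LieSubmodule.Quotient.mk u) ⟨q x, mem_image_of_mem q hx⟩
    have h2 := hPQ u x
    exact h1.trans h2.symm
  have hactO : ∀ x (a : O) (D : G →L[ℝ] F) (ha : i a = μ x) (hD : ∀ v, D (der F G i a v) = v)
      (u : c), der F K qO a (D (der E G μ x (P.ρ x (u : g)))) =
        PO.ρ (qO a) (LieSubmodule.Quotient.mk u) := by
    intro x a D ha hD u
    have h1 : der E G μ x (P.ρ x (u : g)) = PN.ρ (μ x) (u : g) := he u x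
    have h2 : der F G i a (A.ρ a u) = PN.ρ (i a) (u : g) := hA u a
    have h3 : der F K qO a (A.ρ a u) = PO.ρ (qO a) (LieSubmodule.Quotient.mk u) := hAO u a
    have h4 : (PN.ρ (μ x) (u : g) : G) = PN.ρ (i a) (u : g) := by rw [ha]
    rw [h1, ← h3]
    refine congrArg (der F K qO a) ?_
    refine (congrArg D (h4.trans h2.symm)).trans (hD _)
  refine ⟨?_, ?_, ?_⟩
  · rintro ⟨_, x, hx, rfl⟩
    obtain ⟨a, ha⟩ := hZi hx
    exact (key hx ha).1
  · rintro w ⟨_, x, hx, rfl⟩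
    obtain ⟨u, rfl⟩ := LieSubmodule.Quotient.surjective_mk' h w
    obtain ⟨a, ha⟩ := hZi hx
    obtain ⟨-, D, S, hD, hS, hder⟩ := key hx ha
    have h1 := hder (P'.ρ ⟨q x, mem_image_of_mem q hx⟩ (LieSubmodule.Quotient.mk u))
    rw [hact x hx u] at h1
    refine (h1.trans ((hS _).trans (hactO x a D ha hD u))).trans ?_
    rw [hν x hx a ha]
    rfl
  · rintro ⟨_, x, hx, rfl⟩ κ γ
    obtain ⟨a, ha⟩ := hZi hx
    obtain ⟨-, D, S, hD, hS, hder⟩ := key hx ha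
    set y₀ : q '' Z := ⟨q x, mem_image_of_mem q hx⟩ with hy₀
    -- `κ₁` is a covector on `N`; `α₁` below is a covector on `Q` that restricts to `ν^* κ` on the
    -- reduced space (`hα`) and pulls back to `μ^* κ₁` on `M` (`hα'`). This brings the identity back
    -- to the centrality of `μ`.
    set κ₁ : G →L[ℝ] ℝ := κ.comp ((der F K qO a).comp D) with hκ₁
    set α₁ : EQ →L[ℝ] ℝ := κ₁.comp ((der E G μ x).comp S) with hα₁
    have : FiniteDimensional ℝ d := Module.Finite.of_injective
      (der d EQ Subtype.val y₀).toLinearMap (embedding_der_injective hval y₀)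
    obtain ⟨L, hL⟩ := LinearMap.exists_leftInverse_of_injective
      (der d EQ Subtype.val y₀).toLinearMap
      (LinearMap.ker_eq_bot.2 (embedding_der_injective hval y₀))
    set γ₁ : EQ →L[ℝ] ℝ := γ.comp (LinearMap.toContinuousLinearMap L) with hγ₁
    have hγ : γ₁.comp (der d EQ Subtype.val y₀) = γ := by
      ext w
      exact congrArg γ (LinearMap.congr_fun hL w)
    have hα : α₁.comp (der d EQ Subtype.val y₀) = κ.comp (der d K ν y₀) := by
      ext w
      exact congrArg κ (hder w).symm
    have hα' : α₁.comp (der E EQ q x) = κ₁.comp (der E G μ x) := by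
      ext v
      exact congrArg κ (hS v)
    have e1 : P'.π y₀ (κ.comp (der d K ν y₀)) γ = PQ.π (q x) α₁ γ₁ :=
      (congrArg₂ (fun α β : d →L[ℝ] ℝ => P'.π y₀ α β) hα.symm hγ.symm).trans
        (hP'.push y₀ α₁ γ₁)
    have e2 : PQ.π (q x) α₁ γ₁ = P.π x (κ₁.comp (der E G μ x)) (γ₁.comp (der E EQ q x)) :=
      (hπ x α₁ γ₁).symm.trans (congrArg (fun α : E →L[ℝ] ℝ =>
        P.π x α (γ₁.comp (der E EQ q x))) hα')
    refine (e1.trans (e2.trans (hε x κ₁ _))).trans (congrArg (ε * ·) ?_)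
    refine htt'.sharp_apply ht hh (fun u => ?_) (fun u => ?_)
    · have h1 := hactO x a D ha hD u
      have h2 : (der E G μ x (P.ρ x (u : g)) : G) = PN.ρ (μ x) (u : g) := he u x
      rw [h2] at h1
      change κ (der F K qO a (D (PN.ρ (μ x) (u : g)))) =
        κ (PO.ρ (ν y₀) (LieSubmodule.Quotient.mk u))
      rw [h1, hν x hx a ha]
    · have h1 := hact x hx u
      change γ₁ (der E EQ q x (P.ρ x (u : g))) = γ (P'.ρ y₀ (LieSubmodule.Quotient.mk u))
      rw [← h1, ← hγ]
      rfl

end InducedMap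

/-! ### Level sets under submersions and their tangent spaces -/

section LevelSets

variable {E : Type*} [NormedAddCommGroup E] [NormedSpace ℝ E]
  {M : Type*} [TopologicalSpace M] [ChartedSpace E M]
  {F : Type*} [NormedAddCommGroup F] [NormedSpace ℝ F]
  {Q : Type*} [TopologicalSpace Q] [ChartedSpace F Q]
  {W : Type*} [NormedAddCommGroup W] [NormedSpace ℝ W]

/-- The image of a saturated level set under a submersion is a level set. -/
theorem submersion_image_level_set {q : M → Q} {Z : Set M}
    (hq : Manifold.IsSubmersion 𝓘(ℝ, E) 𝓘(ℝ, F) ∞ q) (hZ : IsSaturated q Z) {x : M} (hx : x ∈ Z)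
    {U : Set M} (hU : IsOpen U) (hxU : x ∈ U) {f : M → W}
    (hf : ContMDiffOn 𝓘(ℝ, E) 𝓘(ℝ, W) ∞ f U) (hfs : Function.Surjective (der E W f x))
    (hfZ : ∀ z ∈ U, z ∈ Z ↔ f z = 0) :
    ∃ (V : Set Q) (Ψ : Q → W), IsOpen V ∧ q x ∈ V ∧ ContMDiffOn 𝓘(ℝ, F) 𝓘(ℝ, W) ∞ Ψ V ∧
      Function.Surjective (der F W Ψ (q x)) ∧ (∀ y ∈ V, y ∈ q '' Z ↔ Ψ y = 0) ∧
      ∀ v, der F W Ψ (q x) (der E F q x v) = der E W f x v := by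
  obtain ⟨V, s, hV, hxV, hs, hsx, hqs⟩ := submersion_exists_section hq x
  have hfx : MDifferentiableAt 𝓘(ℝ, E) 𝓘(ℝ, W) f x := hf.mdifferentiableAt_of_mem hU hxU
  have hsm := hs.mdifferentiableAt_of_mem hV hxV
  have hqx : MDifferentiableAt 𝓘(ℝ, E) 𝓘(ℝ, F) q x := hq.contMDiff.mdifferentiableAt (by simp)
  have hΨ : ∀ v, der F W (f ∘ s) (q x) (der E F q x v) = der E W f x v := by
    intro v
    have h1 := der_comp_apply (j := f) (i := s) (x := q x) (by rwa [hsx]) hsm (der E F q x v)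
    have h2 := der_comp_apply (j := q) (i := s) (x := q x) (by rwa [hsx]) hsm (der E F q x v)
    rw [hsx, der_congr (j := id), der_id] at h2
    · rw [hsx] at h1
      rw [h1, ← sub_eq_zero, ← map_sub]
      -- The derivative of `s ∘ q` changes `v` by a vector tangent to the fibre, and `f` vanishes on
      -- the nearby part of the fibre through `x`.
      refine submersion_der_eq_zero hq hfx ?_ ?_
      · filter_upwards [hU.mem_nhds hxU] with z hz hqz
        rw [(hfZ z hz).1 (hZ x z hqz.symm hx), (hfZ x hxU).1 hx]
      · rw [map_sub, ← h2]
        exact sub_self _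
    · filter_upwards [hV.mem_nhds hxV] with y hy using hqs y hy
  refine ⟨V ∩ s ⁻¹' U, f ∘ s, hs.continuousOn.isOpen_inter_preimage hV hU,
    ⟨hxV, by rwa [mem_preimage, hsx]⟩, hf.comp (hs.mono inter_subset_left) fun y hy => hy.2,
    fun w => ?_, ?_, hΨ⟩
  · obtain ⟨v, rfl⟩ := hfs w
    exact ⟨_, hΨ v⟩
  · rintro y ⟨hy, hyU⟩
    rw [Function.comp_apply, ← hfZ _ hyU]
    refine ⟨?_, fun h => ⟨_, h, hqs y hy⟩⟩
    rintro ⟨z, hz, hzy⟩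
    exact hZ z (s y) (hzy.trans (hqs y hy).symm) hz

/-- The tangent space of a level set is the kernel of the derivative of a defining map. -/
theorem exists_der_eq_of_level_set [FiniteDimensional ℝ E] [FiniteDimensional ℝ F] {i : M → Q}
    (hi : Manifold.IsSmoothEmbedding 𝓘(ℝ, E) 𝓘(ℝ, F) ∞ i) {a : M} {V : Set Q} (hV : IsOpen V)
    (ha : i a ∈ V) {Ψ : Q → W} (hΨ : ContMDiffOn 𝓘(ℝ, F) 𝓘(ℝ, W) ∞ Ψ V)
    (hs : Function.Surjective (der F W Ψ (i a))) (h0 : ∀ y ∈ V, y ∈ range i → Ψ y = 0)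
    (hd : Module.finrank ℝ E + Module.finrank ℝ W = Module.finrank ℝ F) {v : F}
    (hv : der F W Ψ (i a) v = 0) : ∃ w, der E F i a w = v := by
  have hle : LinearMap.range (der E F i a).toLinearMap ≤
      LinearMap.ker (der F W Ψ (i a)).toLinearMap := by
    rintro _ ⟨w, rfl⟩
    have h1 := der_comp_apply (hΨ.mdifferentiableAt_of_mem hV ha)
      (hi.isImmersion.contMDiff.mdifferentiableAt (x := a) (by simp)) w
    rw [der_congr (j := fun _ => (0 : W)), der_const] at h1
    · exact h1.symm
    · filter_upwards [hi.isImmersion.contMDiff.continuous.continuousAt.preimage_mem_nhds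
        (hV.mem_nhds ha)] with b hb using h0 _ hb (mem_range_self b)
  have h1 := LinearMap.finrank_range_of_inj (f := (der E F i a).toLinearMap)
    (embedding_der_injective hi a)
  have h2 := (der F W Ψ (i a)).toLinearMap.finrank_range_add_finrank_ker
  rw [LinearMap.range_eq_top.2 hs, finrank_top] at h2
  -- The tangent space lies in the kernel, and by `hd` both have dimension `dim F - dim W`.
  have h3 := Submodule.eq_of_le_of_finrank_eq hle (by omega)
  have h4 : v ∈ LinearMap.ker (der F W Ψ (i a)).toLinearMap := hv
  rw [← h3] at h4
  exact h4

end LevelSets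

/-! ### Transversality and the constraint set -/

section Constraint

universe uL uR

variable {EM : Type*} [NormedAddCommGroup EM] [NormedSpace ℝ EM]
  {M : Type*} [TopologicalSpace M] [ChartedSpace EM M]
  {EL : Type uL} [NormedAddCommGroup EL] [NormedSpace ℝ EL]
  {NL : Type*} [TopologicalSpace NL] [ChartedSpace EL NL]
  {ER : Type uR} [NormedAddCommGroup ER] [NormedSpace ℝ ER]
  {NR : Type*} [TopologicalSpace NR] [ChartedSpace ER NR]
  {FL : Type*} [NormedAddCommGroup FL] [NormedSpace ℝ FL]
  {OL : Type*} [TopologicalSpace OL] [ChartedSpace FL OL]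
  {FR : Type*} [NormedAddCommGroup FR] [NormedSpace ℝ FR]
  {OR : Type*} [TopologicalSpace OR] [ChartedSpace FR OR]
  {μL : M → NL} {μR : M → NR} {iL : OL → NL} {iR : OR → NR}

theorem IsTransverse.exists_decomposition
    (htrans : IsTransverse 𝓘(ℝ, EM) (𝓘(ℝ, FL).prod 𝓘(ℝ, FR)) (𝓘(ℝ, EL).prod 𝓘(ℝ, ER))
      (fun x => (μL x, μR x)) (Prod.map iL iR)) {x : M} {a : OL} {b : OR}
    (hμL : MDifferentiableAt 𝓘(ℝ, EM) 𝓘(ℝ, EL) μL x)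
    (hμR : MDifferentiableAt 𝓘(ℝ, EM) 𝓘(ℝ, ER) μR x)
    (hiL : MDifferentiableAt 𝓘(ℝ, FL) 𝓘(ℝ, EL) iL a)
    (hiR : MDifferentiableAt 𝓘(ℝ, FR) 𝓘(ℝ, ER) iR b)
    (ha : iL a = μL x) (hb : iR b = μR x) (vL : EL) (vR : ER) :
    ∃ v wL wR, der EM EL μL x v + der FL EL iL a wL = vL ∧
      der EM ER μR x v + der FR ER iR b wR = vR := by
  have h1 := htrans x (a, b) (Prod.ext ha.symm hb.symm)
  obtain ⟨_, ⟨v, rfl⟩, _, ⟨w, rfl⟩, hvw⟩ :=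
    Submodule.mem_sup.1 (h1.ge (Submodule.mem_top (x := ((vL, vR) : EL × ER))))
  have h3 := hμL.hasMFDerivAt.prodMk hμR.hasMFDerivAt
  have h4 := HasMFDerivAt.prodMap (p := ((a, b) : OL × OR)) hiL.hasMFDerivAt hiR.hasMFDerivAt
  refine ⟨v, w.1, w.2, ?_, ?_⟩
  · have h5 := congrArg Prod.fst hvw
    simp only [h3.mfderiv, h4.mfderiv] at h5
    exact h5
  · have h5 := congrArg Prod.snd hvw
    simp only [h3.mfderiv, h4.mfderiv] at h5
    exact h5

/-- By transversality the constraint set is a level set. -/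
theorem constraintSet_exists_defining
    (htrans : IsTransverse 𝓘(ℝ, EM) (𝓘(ℝ, FL).prod 𝓘(ℝ, FR)) (𝓘(ℝ, EL).prod 𝓘(ℝ, ER))
      (fun x => (μL x, μR x)) (Prod.map iL iR))
    (hμL : ContMDiff 𝓘(ℝ, EM) 𝓘(ℝ, EL) ∞ μL) (hμR : ContMDiff 𝓘(ℝ, EM) 𝓘(ℝ, ER) ∞ μR)
    (hiL : Manifold.IsSmoothEmbedding 𝓘(ℝ, FL) 𝓘(ℝ, EL) ∞ iL)
    (hiR : Manifold.IsSmoothEmbedding 𝓘(ℝ, FR) 𝓘(ℝ, ER) ∞ iR) :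
    ∃ (WL : Type uL) (_ : NormedAddCommGroup WL) (_ : NormedSpace ℝ WL)
      (WR : Type uR) (_ : NormedAddCommGroup WR) (_ : NormedSpace ℝ WR),
      ∀ x ∈ constraintSet μL μR iL iR, ∃ (U : Set M) (f : M → WL × WR) (l : EL →L[ℝ] WL)
        (r : ER →L[ℝ] WR), IsOpen U ∧ x ∈ U ∧ ContMDiffOn 𝓘(ℝ, EM) 𝓘(ℝ, WL × WR) ∞ f U ∧
        (∀ z ∈ U, z ∈ constraintSet μL μR iL iR ↔ f z = 0) ∧
        Function.Surjective (der EM (WL × WR) f x) ∧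
        (∀ v, der EM (WL × WR) f x v = (l (der EM EL μL x v), r (der EM ER μR x v))) ∧
        (∀ a, iL a = μL x → ∀ w, l (der FL EL iL a w) = 0) ∧
        ∀ b, iR b = μR x → ∀ w, r (der FR ER iR b w) = 0 := by
  obtain ⟨WL, _, _, hSL⟩ := embedding_exists_sliceData hiL
  obtain ⟨WR, _, _, hSR⟩ := embedding_exists_sliceData hiR
  refine ⟨WL, inferInstance, inferInstance, WR, inferInstance, inferInstance, ?_⟩
  rintro x ⟨⟨a, ha⟩, ⟨b, hb⟩⟩
  obtain ⟨UL, rL, ΦL, hL⟩ := hSL a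
  obtain ⟨UR, rR, ΦR, hR⟩ := hSR b
  have hxL : μL x ∈ UL := ha ▸ hL.mem
  have hxR : μR x ∈ UR := hb ▸ hR.mem
  have hlx : MDifferentiableAt 𝓘(ℝ, EL) 𝓘(ℝ, WL) ΦL (μL x) :=
    hL.smooth_Φ.mdifferentiableAt_of_mem hL.isOpen hxL
  have hrx : MDifferentiableAt 𝓘(ℝ, ER) 𝓘(ℝ, WR) ΦR (μR x) :=
    hR.smooth_Φ.mdifferentiableAt_of_mem hR.isOpen hxR
  have hμLx : MDifferentiableAt 𝓘(ℝ, EM) 𝓘(ℝ, EL) μL x := hμL.mdifferentiableAt (by simp)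
  have hμRx : MDifferentiableAt 𝓘(ℝ, EM) 𝓘(ℝ, ER) μR x := hμR.mdifferentiableAt (by simp)
  have hder : ∀ v, der EM (WL × WR) (fun z => (ΦL (μL z), ΦR (μR z))) x v =
      (der EL WL ΦL (μL x) (der EM EL μL x v), der ER WR ΦR (μR x) (der EM ER μR x v)) := by
    intro v
    have h1 : HasMFDerivAt 𝓘(ℝ, EM) 𝓘(ℝ, WL × WR) (fun z => (ΦL (μL z), ΦR (μR z))) x
        ((der EM WL (ΦL ∘ μL) x).prod (der EM WR (ΦR ∘ μR) x)) := by
      have hl := (hlx.comp x hμLx).hasMFDerivAt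
      have hr := (hrx.comp x hμRx).hasMFDerivAt
      exact ⟨hl.1.prodMk hr.1, hl.2.prodMk hr.2⟩
    have h2 : der EM (WL × WR) (fun z => (ΦL (μL z), ΦR (μR z))) x v =
        (der EM WL (ΦL ∘ μL) x v, der EM WR (ΦR ∘ μR) x v) :=
      congrArg (fun D : EM →L[ℝ] WL × WR => D v) h1.mfderiv
    rw [h2, der_comp_apply hlx hμLx, der_comp_apply hrx hμRx]
  have hkL : ∀ a', iL a' = μL x → ∀ w, der EL WL ΦL (μL x) (der FL EL iL a' w) = 0 := by
    intro a' ha' w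
    obtain rfl : a' = a := hiL.isEmbedding.injective (ha'.trans ha.symm)
    rw [← ha]
    exact hL.der_Φ_der hiL.isImmersion.contMDiff w
  have hkR : ∀ b', iR b' = μR x → ∀ w, der ER WR ΦR (μR x) (der FR ER iR b' w) = 0 := by
    intro b' hb' w
    obtain rfl : b' = b := hiR.isEmbedding.injective (hb'.trans hb.symm)
    rw [← hb]
    exact hR.der_Φ_der hiR.isImmersion.contMDiff w
  refine ⟨μL ⁻¹' UL ∩ μR ⁻¹' UR, fun z => (ΦL (μL z), ΦR (μR z)), der EL WL ΦL (μL x),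
    der ER WR ΦR (μR x),
    (hL.isOpen.preimage hμL.continuous).inter (hR.isOpen.preimage hμR.continuous), ⟨hxL, hxR⟩,
    ?_, ?_, ?_, hder, hkL, hkR⟩
  · exact (hL.smooth_Φ.comp hμL.contMDiffOn fun z hz => hz.1).prodMk_space
      (hR.smooth_Φ.comp hμR.contMDiffOn fun z hz => hz.2)
  · rintro z ⟨hzL, hzR⟩
    rw [Prod.mk_eq_zero, ← hL.mem_range_iff _ hzL, ← hR.mem_range_iff _ hzR]
    rfl
  · rintro ⟨wL, wR⟩
    obtain ⟨vL, hvL⟩ := hL.surjective wL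
    obtain ⟨vR, hvR⟩ := hR.surjective wR
    -- Transversality realizes `(vL, vR)` by a vector of `M` up to vectors tangent to `O_L` and
    -- `O_R`, which the defining maps kill.
    obtain ⟨v, uL, uR, huL, huR⟩ := htrans.exists_decomposition hμLx hμRx
      (hiL.isImmersion.contMDiff.mdifferentiableAt (by simp))
      (hiR.isImmersion.contMDiff.mdifferentiableAt (by simp)) ha hb vL vR
    rw [ha] at hvL
    rw [hb] at hvR
    refine ⟨v, ?_⟩
    rw [hder, ← hvL, ← hvR, ← huL, ← huR, map_add, map_add, hkL a ha, hkR b hb, add_zero,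
      add_zero]

end Constraint

/-! ### Conormals of invariant submanifolds -/

section Tangency

variable {g : Type*} [LieRing g] [LieAlgebra ℝ g] {c : LieSubalgebra ℝ g} {h : LieIdeal ℝ c}
  {t : g ⊗[ℝ] g}
  {E : Type*} [NormedAddCommGroup E] [NormedSpace ℝ E]
  {M : Type*} [TopologicalSpace M] [ChartedSpace E M] [IsManifold 𝓘(ℝ, E) ∞ M]
  {G : Type*} [NormedAddCommGroup G] [NormedSpace ℝ G]
  {N : Type*} [TopologicalSpace N] [ChartedSpace G N] [IsManifold 𝓘(ℝ, G) ∞ N]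
  {F : Type*} [NormedAddCommGroup F] [NormedSpace ℝ F]
  {O : Type*} [TopologicalSpace O] [ChartedSpace F O] [IsManifold 𝓘(ℝ, F) ∞ O]
  {P : QPStructure t E M} {PN : QPStructure t G N} {μ : M → N}

/-- Conormals to a `c`-invariant submanifold pair trivially with `h`-basic covectors. -/
theorem IsCentralWith.eq_zero {ε : ℝ} (hh : perp t c ≤ idealSpan h) (hε : IsCentralWith ε P PN μ)
    {x : M} {κ : G →L[ℝ] ℝ} (hκ : ∀ u : c, κ (PN.ρ (μ x) (u : g)) = 0) {γ : E →L[ℝ] ℝ}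
    (hγ : ∀ u : c, u ∈ h → γ (P.ρ x (u : g)) = 0) :
    P.π x (κ.comp (der E G μ x)) γ = 0 := by
  -- Hence `t♯ (ρ^* κ)` lies in `c^⊥ ⊆ h`, and `γ` kills `ρ(h)`.
  have h1 : PN.dual (μ x) κ ∈ c.toSubmodule.dualAnnihilator :=
    (Submodule.mem_dualAnnihilator _).2 fun u hu => hκ ⟨u, hu⟩
  obtain ⟨v, hv, hv'⟩ := mem_idealSpan.1 (hh (Submodule.mem_map_of_mem h1))
  refine (hε x κ γ).trans ?_
  rw [← hv']
  exact mul_eq_zero_of_right ε (hγ v hv)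

end Tangency

/-! ### Quasi-Poisson structures on the reduced spaces -/

section Reduction

variable {g : Type*} [LieRing g] [LieAlgebra ℝ g] {c : LieSubalgebra ℝ g} {h : LieIdeal ℝ c}
  {t : g ⊗[ℝ] g} {t' : (c ⧸ h) ⊗[ℝ] (c ⧸ h)}
  {E : Type*} [NormedAddCommGroup E] [NormedSpace ℝ E] [FiniteDimensional ℝ E]
  {M : Type*} [TopologicalSpace M] [T2Space M] [ChartedSpace E M] [IsManifold 𝓘(ℝ, E) ∞ M]
  {F : Type*} [NormedAddCommGroup F] [NormedSpace ℝ F] [FiniteDimensional ℝ F]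
  {Q : Type*} [TopologicalSpace Q] [T2Space Q] [ChartedSpace F Q] [IsManifold 𝓘(ℝ, F) ∞ Q]
  {P : QPStructure t E M} {q : M → Q}

/-- The quotient of a quasi-Poisson manifold by `h` is quasi-Poisson for `c / h`. -/
theorem IsOrbitQuotient.exists_qpStructure (ht : IsInvariantSymmetric t)
    (hh : perp t c ≤ idealSpan h) (htt' : DescendsTo h t t')
    (hq : IsOrbitQuotient (E₁ := E) (E₂ := F) P.toAction (idealSpan h) id q) :
    ∃ PQ : QPStructure t' F Q,
      (∀ u : c, Related P.toAction PQ.toAction q (u : g) (LieSubmodule.Quotient.mk u)) ∧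
      PushesForward P.π PQ.π q := by
  -- `M` is treated as an invariant submanifold of itself.
  obtain ⟨A, BQ, hqA, hA, hBQ⟩ := hq.exists_actions (i := (id : M → M)) (q := q)
    Manifold.IsSmoothEmbedding.id (fun x y _ _ => ⟨y, rfl⟩)
  have hAρ : ∀ x (u : c), A.ρ x u = P.ρ x (u : g) := by
    intro x u
    have h1 : der E E id x (A.ρ x u) = P.ρ x (u : g) := hA u x
    rw [der_id] at h1
    exact h1
  obtain ⟨PQ, rfl, hπ⟩ := P.exists_descend (ι := fun u : c => (u : g)) hAρ hqA hBQ
    (t' := t') fun α β γ α' β' γ' hα hβ hγ => htt'.phi_eq ht hh hα hβ hγ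
  refine ⟨PQ, fun u x => ?_, hπ⟩
  rw [← hAρ]
  exact hBQ u x

/-- A `c`-invariant, saturated set whose image is a submanifold reduces to a quasi-Poisson
submanifold when the bivector field is tangent to it. -/
theorem exists_reduced_qpStructure {PQ : QPStructure t' F Q} {Z : Set M}
    (hq : ContMDiff 𝓘(ℝ, E) 𝓘(ℝ, F) ∞ q)
    (hPQ : ∀ u : c, Related P.toAction PQ.toAction q (u : g) (LieSubmodule.Quotient.mk u))
    (hZ : P.IsInvariantSet c.toSubmodule Z)
    {D : Type*} [NormedAddCommGroup D] [NormedSpace ℝ D] [FiniteDimensional ℝ D]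
    [ChartedSpace D (q '' Z)] [IsManifold 𝓘(ℝ, D) ∞ (q '' Z)]
    (hi : Manifold.IsSmoothEmbedding 𝓘(ℝ, D) 𝓘(ℝ, F) ∞ (Subtype.val : q '' Z → Q))
    (hπ : ∀ (y : q '' Z) (α β : F →L[ℝ] ℝ), α.comp (der D F Subtype.val y) = 0 →
      PQ.π y α β = 0) :
    ∃ P' : QPStructure t' D (q '' Z), IsQuasiPoissonMap P' PQ Subtype.val := by
  -- Integral curves of `ρ(u)`, `u ∈ c`, that start in `Z` stay in `Z`; their projections lie in `q
  -- '' Z`, so the reduced fields are tangent to it.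
  obtain ⟨A', hA'⟩ := Action.exists_restrict PQ.toAction hi (by
    rintro ⟨_, x, hx, rfl⟩ w
    obtain ⟨u, rfl⟩ := LieSubmodule.Quotient.surjective_mk' h w
    obtain ⟨γ, hγ0, hγd, hγ', hγ⟩ := P.exists_curve (h := c.toSubmodule) u.2 x
    have hqγ : MDifferentiableAt 𝓘(ℝ, E) 𝓘(ℝ, F) q (γ 0) := hq.mdifferentiableAt (by simp)
    obtain ⟨w, hw⟩ := embedding_der_curve_mem_range hi (hqγ.comp 0 hγd)
      (hγ.mono fun s hs => ⟨⟨q (γ s), mem_image_of_mem q (hZ _ _ (.rel _ _ hs) hx)⟩, rfl⟩)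
      (a := (⟨q x, mem_image_of_mem q hx⟩ : q '' Z)) (by rw [Function.comp_apply, hγ0])
    refine ⟨w, hw.trans ?_⟩
    rw [der_comp_apply hqγ hγd, hγ', hγ0]
    exact hPQ u x)
  obtain ⟨P', -, hP'⟩ := PQ.exists_restrict hi hA' hπ
  exact ⟨P', hP'⟩

end Reduction

/-! ### Tangency of the reduced bivector -/

section BivectorTangency

variable {g : Type*} [LieRing g] [LieAlgebra ℝ g] {c : LieSubalgebra ℝ g} {h : LieIdeal ℝ c}
  {t : g ⊗[ℝ] g} {t' : (c ⧸ h) ⊗[ℝ] (c ⧸ h)}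
  {E : Type*} [NormedAddCommGroup E] [NormedSpace ℝ E]
  {M : Type*} [TopologicalSpace M] [ChartedSpace E M] [IsManifold 𝓘(ℝ, E) ∞ M]
  {EL : Type*} [NormedAddCommGroup EL] [NormedSpace ℝ EL]
  {NL : Type*} [TopologicalSpace NL] [ChartedSpace EL NL] [IsManifold 𝓘(ℝ, EL) ∞ NL]
  {ER : Type*} [NormedAddCommGroup ER] [NormedSpace ℝ ER]
  {NR : Type*} [TopologicalSpace NR] [ChartedSpace ER NR] [IsManifold 𝓘(ℝ, ER) ∞ NR]
  {FL : Type*} [NormedAddCommGroup FL] [NormedSpace ℝ FL]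
  {OL : Type*} [TopologicalSpace OL] [ChartedSpace FL OL] [IsManifold 𝓘(ℝ, FL) ∞ OL]
  {FR : Type*} [NormedAddCommGroup FR] [NormedSpace ℝ FR]
  {OR : Type*} [TopologicalSpace OR] [ChartedSpace FR OR] [IsManifold 𝓘(ℝ, FR) ∞ OR]
  {F : Type*} [NormedAddCommGroup F] [NormedSpace ℝ F] [FiniteDimensional ℝ F]
  {Q : Type*} [TopologicalSpace Q] [ChartedSpace F Q] [IsManifold 𝓘(ℝ, F) ∞ Q]
  {P : QPStructure t E M} {PL : QPStructure t EL NL} {PR : QPStructure t ER NR}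
  {PQ : QPStructure t' F Q} {AL : Action c FL OL} {AR : Action c FR OR}
  {μL : M → NL} {μR : M → NR} {iL : OL → NL} {iR : OR → NR} {q : M → Q}
  {WL WR : Type*} [NormedAddCommGroup WL] [NormedSpace ℝ WL] [NormedAddCommGroup WR]
  [NormedSpace ℝ WR]

/-- A functional vanishing on the kernel of a surjective map factors through it. -/
theorem exists_factor_of_surjective {W : Type*} [NormedAddCommGroup W] [NormedSpace ℝ W]
    {D : F →L[ℝ] W} (hD : Function.Surjective D) {α : F →L[ℝ] ℝ} (hα : ∀ v, D v = 0 → α v = 0) :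
    ∃ l : W →L[ℝ] ℝ, ∀ v, α v = l (D v) := by
  have : FiniteDimensional ℝ W := Module.Finite.of_surjective D.toLinearMap hD
  obtain ⟨S, hS⟩ := D.toLinearMap.exists_rightInverse_of_surjective (LinearMap.range_eq_top.2 hD)
  refine ⟨α.comp (LinearMap.toContinuousLinearMap S), fun v => ?_⟩
  have h1 : D (S (D v)) = D v := LinearMap.congr_fun hS (D v)
  have h2 := hα (v - S (D v)) (by rw [map_sub, h1, sub_self])
  rw [map_sub, sub_eq_zero] at h2
  exact h2

/-- The reduced bivector field annihilates the conormals of the reduced submanifold. -/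
theorem reduced_bivector_eq_zero {εL εR : ℝ} (hh : perp t c ≤ idealSpan h)
    (hL : IsCentralWith εL P PL μL) (hR : IsCentralWith εR P PR μR)
    (hPQ : ∀ u : c, Related P.toAction PQ.toAction q (u : g) (LieSubmodule.Quotient.mk u))
    (hπ : PushesForward P.π PQ.π q)
    (hAL : ∀ u : c, Related AL PL.toAction iL u (u : g))
    (hAR : ∀ u : c, Related AR PR.toAction iR u (u : g))
    {x : M} (hxL : μL x ∈ range iL) (hxR : μR x ∈ range iR)
    {f : M → WL × WR} {l : EL →L[ℝ] WL} {r : ER →L[ℝ] WR}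
    (hfd : ∀ v, der E (WL × WR) f x v = (l (der E EL μL x v), r (der E ER μR x v)))
    (hl : ∀ a, iL a = μL x → ∀ w, l (der FL EL iL a w) = 0)
    (hr : ∀ b, iR b = μR x → ∀ w, r (der FR ER iR b w) = 0)
    {Ψ : Q → WL × WR}
    (hΨd : ∀ v, der F (WL × WR) Ψ (q x) (der E F q x v) = der E (WL × WR) f x v)
    (hΨs : Function.Surjective (der F (WL × WR) Ψ (q x))) {α : F →L[ℝ] ℝ}
    (hα : ∀ v, der F (WL × WR) Ψ (q x) v = 0 → α v = 0) (β : F →L[ℝ] ℝ) :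
    PQ.π (q x) α β = 0 := by
  -- A conormal is a functional `m` of the derivative of `Ψ`. Its two halves on `WL` and `WR` pull
  -- back to conormals `κL` of `O_L` and `κR` of `O_R`.
  obtain ⟨m, hm⟩ := exists_factor_of_surjective hΨs hα
  set κL : EL →L[ℝ] ℝ := (m.comp (ContinuousLinearMap.inl ℝ WL WR)).comp l with hκL
  set κR : ER →L[ℝ] ℝ := (m.comp (ContinuousLinearMap.inr ℝ WL WR)).comp r with hκR
  have hαq : α.comp (der E F q x) = κL.comp (der E EL μL x) + κR.comp (der E ER μR x) := by
    ext v
    change α (der E F q x v) = m (l (der E EL μL x v), 0) + m (0, r (der E ER μR x v))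
    rw [hm, hΨd, hfd, ← map_add, Prod.mk_add_mk, add_zero, zero_add]
  have hβ : ∀ u : c, u ∈ h → β.comp (der E F q x) (P.ρ x (u : g)) = 0 := by
    intro u hu
    have h1 : der E F q x (P.ρ x (u : g)) = PQ.ρ (q x) (LieSubmodule.Quotient.mk u) := hPQ u x
    have h2 : (LieSubmodule.Quotient.mk u : c ⧸ h) = 0 := LieSubmodule.Quotient.mk_eq_zero'.2 hu
    rw [h2] at h1
    refine (congrArg β (h1.trans (map_zero _))).trans (map_zero β)
  have hκL0 : ∀ u : c, κL (PL.ρ (μL x) (u : g)) = 0 := by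
    intro u
    obtain ⟨a, ha⟩ := hxL
    have h1 : der FL EL iL a (AL.ρ a u) = PL.ρ (iL a) (u : g) := hAL u a
    have h2 : l (PL.ρ (iL a) (u : g)) = 0 := (congrArg l h1).symm.trans (hl a ha _)
    rw [← ha]
    exact (congrArg (m.comp (ContinuousLinearMap.inl ℝ WL WR)) h2).trans (map_zero _)
  have hκR0 : ∀ u : c, κR (PR.ρ (μR x) (u : g)) = 0 := by
    intro u
    obtain ⟨b, hb⟩ := hxR
    have h1 : der FR ER iR b (AR.ρ b u) = PR.ρ (iR b) (u : g) := hAR u b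
    have h2 : r (PR.ρ (iR b) (u : g)) = 0 := (congrArg r h1).symm.trans (hr b hb _)
    rw [← hb]
    exact (congrArg (m.comp (ContinuousLinearMap.inr ℝ WL WR)) h2).trans (map_zero _)
  have h1 : PQ.π (q x) α β = P.π x (α.comp (der E F q x)) (β.comp (der E F q x)) :=
    (hπ x α β).symm
  have h2 : P.π x (κL.comp (der E EL μL x) + κR.comp (der E ER μR x)) (β.comp (der E F q x)) =
      P.π x (κL.comp (der E EL μL x)) (β.comp (der E F q x)) +
        P.π x (κR.comp (der E ER μR x)) (β.comp (der E F q x)) :=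
    LinearMap.map_add₂ (P.π x) _ _ _
  refine h1.trans ((congrArg (fun δ : E →L[ℝ] ℝ => P.π x δ (β.comp (der E F q x))) hαq).trans
    (h2.trans ?_))
  exact (congrArg₂ (· + ·) (hL.eq_zero hh hκL0 hβ) (hR.eq_zero hh hκR0 hβ)).trans (add_zero 0)

end BivectorTangency

end QuasiPoisson

/-! ### Central reduction -/

theorem mainTheorem3
    {g : Type*} [LieRing g] [LieAlgebra ℝ g]
    (t : g ⊗[ℝ] g) (ht : QuasiPoisson.IsInvariantSymmetric t)
    -- the manifolds `M`, `N_L`, `N_R`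
    {EM : Type*} [NormedAddCommGroup EM] [NormedSpace ℝ EM] [FiniteDimensional ℝ EM]
    {M : Type*} [TopologicalSpace M] [T2Space M] [ChartedSpace EM M] [IsManifold 𝓘(ℝ, EM) ∞ M]
    {EL : Type*} [NormedAddCommGroup EL] [NormedSpace ℝ EL] [FiniteDimensional ℝ EL]
    {NL : Type*} [TopologicalSpace NL] [T2Space NL] [ChartedSpace EL NL]
    [IsManifold 𝓘(ℝ, EL) ∞ NL]
    {ER : Type*} [NormedAddCommGroup ER] [NormedSpace ℝ ER] [FiniteDimensional ℝ ER]
    {NR : Type*} [TopologicalSpace NR] [T2Space NR] [ChartedSpace ER NR]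
    [IsManifold 𝓘(ℝ, ER) ∞ NR]
    -- the central pair
    (P : QuasiPoisson.QPStructure t EM M) (PL : QuasiPoisson.QPStructure t EL NL)
    (PR : QuasiPoisson.QPStructure t ER NR) (μL : M → NL) (μR : M → NR)
    (hμ : QuasiPoisson.IsCentralPair P PL PR μL μR)
    -- the coisotropic subalgebra `c` and its ideal `h`
    (c : LieSubalgebra ℝ g) (hc : QuasiPoisson.IsCoisotropic t c)
    (h : LieIdeal ℝ c) (hh : QuasiPoisson.perp t c ≤ QuasiPoisson.idealSpan h)
    -- the `c`-invariant submanifolds `O_L` and `O_R`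
    {FL : Type*} [NormedAddCommGroup FL] [NormedSpace ℝ FL] [FiniteDimensional ℝ FL]
    {OL : Type*} [TopologicalSpace OL] [ChartedSpace FL OL] [IsManifold 𝓘(ℝ, FL) ∞ OL]
    {FR : Type*} [NormedAddCommGroup FR] [NormedSpace ℝ FR] [FiniteDimensional ℝ FR]
    {OR : Type*} [TopologicalSpace OR] [ChartedSpace FR OR] [IsManifold 𝓘(ℝ, FR) ∞ OR]
    (iL : OL → NL) (hiL : Manifold.IsSmoothEmbedding 𝓘(ℝ, FL) 𝓘(ℝ, EL) ∞ iL)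
    (iR : OR → NR) (hiR : Manifold.IsSmoothEmbedding 𝓘(ℝ, FR) 𝓘(ℝ, ER) ∞ iR)
    (hOL : PL.IsInvariantSet c.toSubmodule (Set.range iL))
    (hOR : PR.IsInvariantSet c.toSubmodule (Set.range iR))
    (htrans : QuasiPoisson.IsTransverse 𝓘(ℝ, EM) (𝓘(ℝ, FL).prod 𝓘(ℝ, FR))
      (𝓘(ℝ, EL).prod 𝓘(ℝ, ER)) (fun x => (μL x, μR x)) (Prod.map iL iR))
    -- the quotient manifolds `M / h`, `O_L / h`, `O_R / h`
    {EQ : Type*} [NormedAddCommGroup EQ] [NormedSpace ℝ EQ] [FiniteDimensional ℝ EQ]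
    {Q : Type*} [TopologicalSpace Q] [T2Space Q] [ChartedSpace EQ Q] [IsManifold 𝓘(ℝ, EQ) ∞ Q]
    {KL : Type*} [NormedAddCommGroup KL] [NormedSpace ℝ KL] [FiniteDimensional ℝ KL]
    {QL : Type*} [TopologicalSpace QL] [T2Space QL] [ChartedSpace KL QL]
    [IsManifold 𝓘(ℝ, KL) ∞ QL]
    {KR : Type*} [NormedAddCommGroup KR] [NormedSpace ℝ KR] [FiniteDimensional ℝ KR]
    {QR : Type*} [TopologicalSpace QR] [T2Space QR] [ChartedSpace KR QR]
    [IsManifold 𝓘(ℝ, KR) ∞ QR]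
    (q : M → Q) (qL : OL → QL) (qR : OR → QR)
    (hq : QuasiPoisson.IsOrbitQuotient (E₁ := EM) (E₂ := EQ) P.toAction
      (QuasiPoisson.idealSpan h) id q)
    (hqL : QuasiPoisson.IsOrbitQuotient (E₁ := FL) (E₂ := KL) PL.toAction
      (QuasiPoisson.idealSpan h) iL qL)
    (hqR : QuasiPoisson.IsOrbitQuotient (E₁ := FR) (E₂ := KR) PR.toAction
      (QuasiPoisson.idealSpan h) iR qR) :
    -- `t` descends to an invariant symmetric element `t'` of `(c / h) ⊗ (c / h)`
    ∃ t' : (c ⧸ h) ⊗[ℝ] (c ⧸ h),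
      QuasiPoisson.DescendsTo h t t' ∧ QuasiPoisson.IsInvariantSymmetric t' ∧
    -- `M / h` is `c / h`-quasi-Poisson, with the action and the bivector field induced from `M`
    ∃ PQ : QuasiPoisson.QPStructure t' EQ Q,
      (∀ u : c, QuasiPoisson.Related P.toAction PQ.toAction q (u : g)
        (LieSubmodule.Quotient.mk u)) ∧
      QuasiPoisson.PushesForward P.π PQ.π q ∧
    -- the subset `M' = (μ_L⁻¹(O_L) ∩ μ_R⁻¹(O_R)) / h` of `M / h` is a quasi-Poisson submanifold
    ∃ (d : ℕ)
      (_ : ChartedSpace (EuclideanSpace ℝ (Fin d))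
        (q '' QuasiPoisson.constraintSet μL μR iL iR))
      (_ : IsManifold (𝓡 d) ∞ (q '' QuasiPoisson.constraintSet μL μR iL iR)),
      Manifold.IsSmoothEmbedding (𝓡 d) 𝓘(ℝ, EQ) ∞
        (Subtype.val : q '' QuasiPoisson.constraintSet μL μR iL iR → Q) ∧
    ∃ P' : QuasiPoisson.QPStructure t' (EuclideanSpace ℝ (Fin d))
        (q '' QuasiPoisson.constraintSet μL μR iL iR),
      QuasiPoisson.IsQuasiPoissonMap P' PQ Subtype.val ∧
    -- `c` acts on `O_L` and `O_R` by restriction, and `c / h` acts on `O_L / h` and `O_R / h`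
    ∃ (AL : QuasiPoisson.Action c FL OL) (AR : QuasiPoisson.Action c FR OR)
      (PL' : QuasiPoisson.QPStructure t' KL QL) (PR' : QuasiPoisson.QPStructure t' KR QR),
      (∀ u : c, QuasiPoisson.Related AL PL.toAction iL u (u : g) ∧
        QuasiPoisson.Related AL PL'.toAction qL u (LieSubmodule.Quotient.mk u)) ∧
      (∀ u : c, QuasiPoisson.Related AR PR.toAction iR u (u : g) ∧
        QuasiPoisson.Related AR PR'.toAction qR u (LieSubmodule.Quotient.mk u)) ∧
    -- the maps induced by `μ_L` and `μ_R` form a central pair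
    ∃ (νL : q '' QuasiPoisson.constraintSet μL μR iL iR → QL)
      (νR : q '' QuasiPoisson.constraintSet μL μR iL iR → QR),
      (∀ (x : M) (hx : x ∈ QuasiPoisson.constraintSet μL μR iL iR) (a : OL) (b : OR),
        iL a = μL x → iR b = μR x →
        νL ⟨q x, Set.mem_image_of_mem q hx⟩ = qL a ∧
        νR ⟨q x, Set.mem_image_of_mem q hx⟩ = qR b) ∧
      QuasiPoisson.IsCentralPair P' PL' PR' νL νR := by
  obtain ⟨t', htt', ht'⟩ := QuasiPoisson.exists_descendsTo ht hh
  refine ⟨t', htt', ht', ?_⟩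
  obtain ⟨PQ, hPQ, hπ⟩ := hq.exists_qpStructure ht hh htt'
  refine ⟨PQ, hPQ, hπ, ?_⟩
  have hμL := hμ.left.smooth
  have hμR := hμ.right.smooth
  set Z := QuasiPoisson.constraintSet μL μR iL iR with hZdef
  have hZc : P.IsInvariantSet c.toSubmodule Z := fun x y hxy hx =>
    ⟨hOL _ _ (hμ.left.equivariant.sameOrbit hμL hxy) hx.1,
      hOR _ _ (hμ.right.equivariant.sameOrbit hμR hxy) hx.2⟩
  -- The fibres of `q` are `h`-orbits, hence contained in `c`-orbits.
  have hZs : QuasiPoisson.IsSaturated q Z := fun x y hxy hx =>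
    hZc x y (((hq.fibres x y).1 hxy).mono QuasiPoisson.idealSpan_le) hx
  have hZL : Z ⊆ μL ⁻¹' Set.range iL := fun x hx => hx.1
  have hZR : Z ⊆ μR ⁻¹' Set.range iR := fun x hx => hx.2
  obtain ⟨WL, _, _, WR, _, _, hdef⟩ :=
    QuasiPoisson.constraintSet_exists_defining htrans hμL hμR hiL hiR
  obtain ⟨d, cs, hm, hemb, hdim⟩ := QuasiPoisson.exists_submanifold_of_level_set
    (F := EQ) (W := WL × WR) (q '' Z) (by
      rintro _ ⟨x, hx, rfl⟩
      obtain ⟨U, f, l, r, hU, hxU, hf, hfZ, hfs, -⟩ := hdef x hx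
      obtain ⟨V, Ψ, hV, hxV, hΨ, hΨs, hΨZ, -⟩ :=
        QuasiPoisson.submersion_image_level_set hq.submersion hZs hx hU hxU hf hfs hfZ
      exact ⟨V, Ψ, hV, hxV, hΨ, hΨs, hΨZ⟩)
  refine ⟨d, cs, hm, hemb, ?_⟩
  obtain ⟨AL, BL, hqAL, hAL, hBL⟩ := hqL.exists_actions hiL hOL
  obtain ⟨PL', rfl, hPL'⟩ := BL.exists_commutative
    (QuasiPoisson.IsOrbitQuotient.dual_sharp_eq_zero ht hh htt' hμ.left.commutative hiL hAL
      hqAL.surjective hBL)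
  obtain ⟨AR, BR, hqAR, hAR, hBR⟩ := hqR.exists_actions hiR hOR
  obtain ⟨PR', rfl, hPR'⟩ := BR.exists_commutative
    (QuasiPoisson.IsOrbitQuotient.dual_sharp_eq_zero ht hh htt' hμ.right.commutative hiR hAR
      hqAR.surjective hBR)
  have hcL := hμ.left.isCentralWith
  have hcR := hμ.right.isCentralWith ht
  obtain ⟨P', hP'⟩ := QuasiPoisson.exists_reduced_qpStructure hq.submersion.contMDiff hPQ hZc hemb
    (by
      rintro ⟨_, x, hx, rfl⟩ α β hα
      obtain ⟨U, f, l, r, hU, hxU, hf, hfZ, hfs, hfd, hl, hr⟩ := hdef x hx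
      obtain ⟨V, Ψ, hV, hxV, hΨ, hΨs, hΨZ, hΨd⟩ :=
        QuasiPoisson.submersion_image_level_set hq.submersion hZs hx hU hxU hf hfs hfZ
      -- A covector that kills the tangent space of `M'` kills the kernel of the derivative of `Ψ`,
      -- because the two spaces coincide by dimension.
      exact QuasiPoisson.reduced_bivector_eq_zero hh hcL hcR hPQ hπ hAL hAR (hZL hx) (hZR hx) hfd
        hl hr hΨd hΨs (fun v hv => by
          obtain ⟨w, rfl⟩ := QuasiPoisson.exists_der_eq_of_level_set hemb
            (a := (⟨q x, Set.mem_image_of_mem q hx⟩ : q '' Z)) hV hxV hΨ hΨs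
            (fun y hy hyr => (hΨZ y hy).1 (by simpa using hyr))
            (by rw [finrank_euclideanSpace_fin]; exact hdim ⟨_, Set.mem_image_of_mem q hx⟩) hv
          exact DFunLike.congr_fun hα w) β)
  refine ⟨P', hP', AL, AR, PL', PR', fun u => ⟨hAL u, hBL u⟩, fun u => ⟨hAR u, hBR u⟩, ?_⟩
  obtain ⟨νL, hνL⟩ := QuasiPoisson.exists_inducedMap hμL hμ.left.equivariant hq hqL hZL
  obtain ⟨νR, hνR⟩ := QuasiPoisson.exists_inducedMap hμR hμ.right.equivariant hq hqR hZR
  refine ⟨νL, νR, fun x hx a b ha hb => ⟨hνL x hx a ha, hνR x hx b hb⟩, ?_⟩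
  obtain ⟨hL₁, hL₂, hL₃⟩ := QuasiPoisson.inducedMap_central ht hh htt' hμL hμ.left.equivariant hcL
    hiL hq hqL hPQ hπ hAL hBL hZL hZs hemb hP' hνL
  obtain ⟨hR₁, hR₂, hR₃⟩ := QuasiPoisson.inducedMap_central ht hh htt' hμR hμ.right.equivariant hcR
    hiR hq hqR hPQ hπ hAR hBR hZR hZs hemb hP' hνR
  exact ⟨hL₃.isLeftCentralMap hPL' hL₁ hL₂, hR₃.isRightCentralMap ht' hPR' hR₁ hR₂⟩
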